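/- **Setting.** Let $\mathcal M$ be a Markov decision process with initial law $\rho$, transition dynamics $\mathcal P$, rewards $\mathcal R(s,a)\in[0,R]$, $R>0$, discount $\gamma\in(0,1)$, and let $H\ge 1$ be the horizon. Let $\pi_\theta(a\mid s)>0$, $\theta\in\mathbb R^d$, be a class of stationary policies (densities with respect to a $\sigma$-finite reference measure on the actions, jointly measurable in $(\theta,s,a)$), $p(\cdot\mid\theta)$ the law and density of the trajectory $\tau=(s_0,a_0,\dots,s_{H-1},a_{H-1})$ under $\pi_\theta$, $\mathcal R(\tau)=\sum_h\gamma^h\mathcal R(s_h,a_h)$, and $J(\theta)=\mathbb E_{\tau\sim p(\cdot\mid\theta)}[\mathcal R(\tau)]$. Let $g(\tau\mid\theta)$ be the REINFORCE estimator $\big(\sum_h\nabla\log\pi_\theta(a_h\mid s_h)\big)\big(\mathcal R(\tau)-C_b\big)$ or the GPOMDP estimator $\sum_h\big(\sum_{t\le h}\nabla\log\pi_\theta(a_t\mid s_t)\big)\big(\gamma^h\mathcal R(s_h,a_h)-C_{b_h}\big)$ with constant baselines, and let $\omega(\tau\mid\theta_b,\theta_a)=p(\tau\mid\theta_a)/p(\tau\mid\theta_b)$.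 Suppose that there are constants $G,M,\sigma,W>0$ such that, for all $s,a,\theta,\theta_a,\theta_b$: $\|\nabla_\theta\log\pi_\theta(a\mid s)\|\le G$; $\pi_\theta(a\mid s)$ is twice differentiable in $\theta$ with $\|\nabla^2_\theta\log\pi_\theta(a\mid s)\|\le M$; $\mathbb E_{\tau\sim p(\cdot\mid\theta)}\|g(\tau\mid\theta)-\nabla J(\theta)\|^2\le\sigma^2$; $\operatorname{Var}_{\tau\sim p(\cdot\mid\theta_b)}[\omega(\tau\mid\theta_b,\theta_a)]\le W\|\theta_a-\theta_b\|^2$. Put $L=HR(M+HG^2)/(1-\gamma)$. **Agents.** There are $K\ge1$ agents. In iteration $t$ the agents in $\mathcal H_t\subset[K]$ are honest, where $|\mathcal H_t|\ge(1-\alpha)K$; here $\alpha\ge0$, $\bar\epsilon>0$ and $\bar\alpha:=\alpha+\bar\epsilon<1/4$. The other (Byzantine) agents send arbitrary vectors, possibly different ones to different agents, chosen by an omniscient adversary that knows everything that has happened so far (but not future randomness); the local state of an agent is never corrupted. A measurable map $\mathrm{Aggregate}:(\mathbb R^d)^K\to\mathbb R^d$ is an $(\alpha,C_{ra})$-robust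 aggregator if for all random inputs $\theta^{(1)},\dots,\theta^{(K)}$ and all $\mathcal H\subset[K]$ with $|\mathcal H|\ge(1-\alpha)K$, $\mathbb E\|\mathrm{Aggregate}(\theta^{(1)},\dots,\theta^{(K)})-\bar\theta\|^2\le\frac{C_{ra}\alpha}{|\mathcal H|(|\mathcal H|-1)}\sum_{i,l\in\mathcal H}\mathbb E\|\theta^{(i)}-\theta^{(l)}\|^2$, where $\bar\theta$ is the mean over $\mathcal H$ (and $0/0=0$). $\mathrm{AvgAgree}_\kappa$ is a synchronous all-to-all message passing protocol of $\kappa$ rounds with inputs, messages and outputs in $\mathbb R^d$. Let $\mathcal U$ be the set of agents that are honest in at least one of the $T$ iterations. The protocol achieves $C_{avg}$-averaging agreement if in every iteration $t$, for every $\mathcal G\subset\mathcal H_t$ with $|\mathcal G|\ge(1-\bar\alpha)K$, all inputs $\theta^{(k)}$ and all Byzantine messages, its outputs $\hat\theta^{(k)}$ satisfy, with $D=\max_{i,l\in\mathcal G}\|\theta^{(i)}-\theta^{(l)}\|$, $$\max_{i,l\in\mathcal G\cup(\mathcal U\setminus\mathcal H_t)}\|\hat\theta^{(i)}-\hat\theta^{(l)}\|\le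 2^{-\kappa}D,\qquad\Big\|\tfrac1{|\mathcal G|}\sum_{k\in\mathcal G}\hat\theta^{(k)}-\tfrac1{|\mathcal G|}\sum_{k\in\mathcal G}\theta^{(k)}\Big\|\le C_{avg}D.$$ (If $\mathcal H_t$ does not depend on $t$, the first maximum is over $\mathcal G$.) **Algorithm (DecByzPG).** Input: $\theta_0$, batch sizes $N,B\ge1$, step size $\eta$, probability $p$, number of iterations $T\ge 1$. All agents start at $\theta_0^{(k)}=\theta_0$. In iteration $t=0,\dots,T-1$ a common coin $c_t\sim\mathrm{Be}(p)$ is tossed. If $c_t=1$ or $t=0$, agent $k$ samples $N$ independent trajectories $\tau_i\sim p(\cdot\mid\theta_t^{(k)})$ and sets $\tilde v_t^{(k)}=\frac1N\sum_i g(\tau_i\mid\theta_t^{(k)})$. Otherwise it samples $B$ such trajectories and sets $\tilde v_t^{(k)}=\frac1B\sum_i g(\tau_i\mid\theta_t^{(k)})+\frac1\eta(\theta_t^{(k)}-\theta_{t-1}^{(k)})-\frac1B\sum_i\omega(\tau_i\mid\theta_t^{(k)},\theta_{t-1}^{(k)})\,g(\tau_i\mid\theta_{t-1}^{(k)})$.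 The agents broadcast the $\tilde v_t^{(k)}$; agent $k$ applies $\mathrm{Aggregate}$ to the vectors it received, which gives $v_t^{(k)}$, and sets $\tilde\theta_{t+1}^{(k)}=\theta_t^{(k)}+\eta v_t^{(k)}$. Then $\mathrm{AvgAgree}_\kappa$ with inputs $\tilde\theta_{t+1}^{(k)}$ yields $\theta_{t+1}^{(k)}$. The output of agent $k$ is $\theta_{\widehat T}^{(k)}$ with a common $\widehat T$, uniform on $\{0,\dots,T-1\}$. The algorithm achieves a $K$-agent $\bar\alpha$-tolerant $\varepsilon$-approximate solution if there is $\mathcal G\subset[K]$ with $|\mathcal G|\ge(1-\bar\alpha)K$ and $\mathbb E\|\nabla J(\theta^{(k)}_{\widehat T})\|^2\le\varepsilon^2$ for all $k\in\mathcal G$. **Claim.** Fix $\mathcal M$, $H$, the policy class, $g$, and $G,M,\sigma,W,C_{ra},C_{avg}>0$ as above. There are constants $C,c_A,c_1,c_2>0$ such that for all $K\ge1$, $\alpha\ge0$, $\bar\epsilon>0$ with $\bar\alpha=\alpha+\bar\epsilon<1/4$ and all $\varepsilon\in(0,1]$ there are integers $N,B,T\ge1$ and $\kappa\geq 0$ with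 $$c_1\max\{\log(NK),\log(1/\varepsilon)\}\le\kappa\le c_2\max\{\log(NK),\log(1/\varepsilon)\}$$ such that the following holds for $p=1/N$, $A=c_A\big(\frac{\alpha}{p^2}+\frac1{pK}\big)$ and $\eta=\frac12\min\{A^{-1/2},L^{-1}\}$. For all sets $\mathcal H_t$ of honest agents with $|\mathcal H_t|\ge(1-\alpha)K$, every $(\alpha,C_{ra})$-robust aggregator, every $\mathrm{AvgAgree}_\kappa$ that achieves $C_{avg}$-averaging agreement, every adversary and every $\theta_0$, DecByzPG achieves a $K$-agent $\bar\alpha$-tolerant $\varepsilon$-approximate solution, and the expected number $n$ of trajectories that each agent samples satisfies $$n\le C\max\Big\{\rho,\ \frac1{\varepsilon^{2}}\Big\},\qquad \rho:=\frac{\alpha^{3/2}}{\varepsilon^4}+\frac{\alpha^{1/2}}{K\varepsilon^4}+\frac{\alpha^{1/2}}{K^{1/2}\varepsilon^3}+\frac1{K\varepsilon^3}.$$ In particular $n\le C\rho$ whenever $\varepsilon\le 1/K$. -/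

import Mathlib

open MeasureTheory ProbabilityTheory
open scoped ENNReal

universe u v w w'

noncomputable section

namespace DecByzPG

/-- The parameter space `ℝ^d` with the Euclidean norm. -/
abbrev Param (d : ℕ) : Type := EuclideanSpace ℝ (Fin d)

/-- Trajectories `(s₀, a₀, …, s_{H-1}, a_{H-1})`. -/
abbrev Traj (S : Type u) (A : Type v) (H : ℕ) : Type (max u v) := Fin H → S × A

/-! ### Episodic Markov decision processes and policy classes -/

/-- A discounted Markov decision process with rewards in `[0, R]`. -/
structure MDP (S : Type u) (A : Type v) [MeasurableSpace S] [MeasurableSpace A] where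
  /-- initial state distribution `ρ` -/
  init : Measure S
  init_prob : IsProbabilityMeasure init
  /-- transition dynamics `P(s' | s, a)` -/
  transition : Kernel (S × A) S
  transition_markov : IsMarkovKernel transition
  /-- upper bound `R` on the reward -/
  R : ℝ
  R_pos : 0 < R
  reward : S → A → ℝ
  reward_measurable : Measurable (Function.uncurry reward)
  reward_nonneg : ∀ s a, 0 ≤ reward s a
  reward_le : ∀ s a, reward s a ≤ R
  /-- discount factor -/
  γ : ℝ
  γ_pos : 0 < γ
  γ_lt_one : γ < 1

/-- A class of stationary policies parameterized by `θ ∈ ℝ^d`. `prob θ s a` is the probability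
(density with respect to the reference measure `ref`, e.g. counting measure if `A` is finite)
`π_θ(a | s)`. It is positive, so that `log π_θ(a | s)` and all importance weights are defined. -/
structure PolicyClass (S : Type u) (A : Type v) [MeasurableSpace S] [MeasurableSpace A]
    (d : ℕ) where
  ref : Measure A
  ref_sigmaFinite : SigmaFinite ref
  prob : Param d → S → A → ℝ
  prob_measurable : Measurable (fun x : Param d × S × A => prob x.1 x.2.1 x.2.2)
  prob_pos : ∀ θ s a, 0 < prob θ s a
  prob_total : ∀ θ s, ∫⁻ a, ENNReal.ofReal (prob θ s a) ∂ref = 1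

section RL

variable {S : Type u} {A : Type v} [MeasurableSpace S] [MeasurableSpace A] {d H : ℕ}

/-- The law of the next state, given the first `n` state-action pairs. -/
def MDP.nextState (M : MDP S A) : (n : ℕ) → Kernel (Fin n → S × A) S
  | 0 => Kernel.const _ M.init
  | n + 1 => M.transition.comap (fun τ => τ (Fin.last n)) (measurable_pi_apply _)

/-- The reference measure `dτ` on trajectories of length `n`: states are drawn from the initial
distribution and the transition dynamics, actions "from" the reference measure on `A`. -/
def MDP.trajRef (M : MDP S A) (ref : Measure A) : (n : ℕ) → Measure (Traj S A n)
  | 0 => Measure.dirac Fin.elim0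
  | n + 1 => (M.trajRef ref n ⊗ₘ (M.nextState n ×ₖ Kernel.const _ ref)).map
      (fun x => (Fin.snoc x.1 x.2 : Fin (n + 1) → S × A))

/-- The trajectory density `p(τ | θ)` with respect to `dτ`. -/
def PolicyClass.trajDensity (π : PolicyClass S A d) (θ : Param d) (τ : Traj S A H) : ℝ :=
  ∏ h, π.prob θ (τ h).1 (τ h).2

/-- The law `p(· | θ)` of the trajectory of length `H` obtained by following `π_θ`. -/
def trajLaw (M : MDP S A) (π : PolicyClass S A d) (H : ℕ) (θ : Param d) :
    Measure (Traj S A H) :=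
  (M.trajRef π.ref H).withDensity (fun τ => ENNReal.ofReal (π.trajDensity θ τ))

/-- The cumulative discounted reward `R(τ)`. -/
def MDP.ret (M : MDP S A) (τ : Traj S A H) : ℝ :=
  ∑ h : Fin H, M.γ ^ (h : ℕ) * M.reward (τ h).1 (τ h).2

/-- The objective `J(θ)`. -/
def objective (M : MDP S A) (π : PolicyClass S A d) (H : ℕ) (θ : Param d) : ℝ :=
  ∫ τ, M.ret τ ∂(trajLaw M π H θ)

/-- `∇J(θ)`. -/
def gradJ (M : MDP S A) (π : PolicyClass S A d) (H : ℕ) (θ : Param d) : Param d :=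
  gradient (objective M π H) θ

/-- The score `∇_θ log π_θ(a | s)`. -/
def PolicyClass.score (π : PolicyClass S A d) (θ : Param d) (s : S) (a : A) : Param d :=
  gradient (fun θ' => Real.log (π.prob θ' s a)) θ

/-- The two gradient estimators, with their baselines. -/
inductive Estimator (H : ℕ) where
  | reinforce (b : ℝ) : Estimator H
  | gpomdp (b : Fin H → ℝ) : Estimator H

/-- The single-trajectory gradient estimate `g(τ | θ)`. -/
def Estimator.g (M : MDP S A) (π : PolicyClass S A d) :
    Estimator H → Traj S A H → Param d → Param d
  | .reinforce b, τ, θ =>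
      (M.ret τ - b) • ∑ h : Fin H, π.score θ (τ h).1 (τ h).2
  | .gpomdp b, τ, θ =>
      ∑ h : Fin H, (M.γ ^ (h : ℕ) * M.reward (τ h).1 (τ h).2 - b h) •
        ∑ t ∈ Finset.Iic h, π.score θ (τ t).1 (τ t).2

/-- The importance weight `ω(τ | θ_b, θ_a) = p(τ | θ_a) / p(τ | θ_b)`. -/
def PolicyClass.weight (π : PolicyClass S A d) (τ : Traj S A H) (θb θa : Param d) : ℝ :=
  π.trajDensity θa τ / π.trajDensity θb τ

/-! ### The reinforcement learning assumptions -/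

/-- Log-policy gradient norm: `‖∇_θ log π_θ(a | s)‖ ≤ G`. -/
def LogPolicyGradientBound (π : PolicyClass S A d) (G : ℝ) : Prop :=
  ∀ s a θ, ‖π.score θ s a‖ ≤ G

/-- Log-policy smoothness: `π_θ` is twice differentiable in `θ`, and
`‖∇²_θ log π_θ(a | s)‖ ≤ M₂`. -/
def LogPolicySmooth (π : PolicyClass S A d) (M₂ : ℝ) : Prop :=
  ∀ s a, Differentiable ℝ (fun θ => π.prob θ s a) ∧
    Differentiable ℝ (fderiv ℝ (fun θ => π.prob θ s a)) ∧
    ∀ θ, ‖fderiv ℝ (fun θ' => π.score θ' s a) θ‖ ≤ M₂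

/-- Gradient estimator variance: `E ‖g(τ | θ) - ∇J(θ)‖² ≤ σ²`. -/
def EstimatorVarianceBound (M : MDP S A) (π : PolicyClass S A d) (est : Estimator H)
    (σ : ℝ) : Prop :=
  ∀ θ, ∫⁻ τ, ‖est.g M π τ θ - gradJ M π H θ‖ₑ ^ 2 ∂(trajLaw M π H θ) ≤ ENNReal.ofReal (σ ^ 2)

/-- Importance weight variance: `Var[ω(τ | θ_b, θ_a)] ≤ W ‖θ_a - θ_b‖²` for
`τ ∼ p(· | θ_b)`. -/
def WeightVarianceBound (M : MDP S A) (π : PolicyClass S A d) (H : ℕ) (W : ℝ) : Prop :=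
  ∀ θa θb, evariance (fun τ : Traj S A H => π.weight τ θb θa) (trajLaw M π H θb) ≤
    ENNReal.ofReal (W * ‖θa - θb‖ ^ 2)

/-- The smoothness constant `L = H R (M₂ + H G²) / (1 - γ)` of `J`. -/
def MDP.L (M : MDP S A) (H : ℕ) (G M₂ : ℝ) : ℝ :=
  H * M.R * (M₂ + H * G ^ 2) / (1 - M.γ)

end RL

/-! ### Robust aggregation and averaging agreement -/

section Distributed

variable {K d : ℕ}

/-- The average of the vectors `x i`, `i ∈ s`. -/
def avg (s : Finset (Fin K)) (x : Fin K → Param d) : Param d :=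
  (s.card : ℝ)⁻¹ • ∑ i ∈ s, x i

/-- The diameter `max_{i, l ∈ s} ‖x i - x l‖`. -/
def diam (s : Finset (Fin K)) (x : Fin K → Param d) : ℝ :=
  Metric.diam (x '' (s : Set (Fin K)))

/-- `(α, C_ra)`-robust aggregation; `μ` is the joint law of the (random) inputs. -/
def IsRobustAggregator (α Cra : ℝ) (agg : (Fin K → Param d) → Param d) : Prop :=
  ∀ (μ : Measure (Fin K → Param d)), IsProbabilityMeasure μ →
    ∀ H : Finset (Fin K), (1 - α) * K ≤ H.card →
      ∫⁻ x, ‖agg x - avg H x‖ₑ ^ 2 ∂μ ≤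
        ENNReal.ofReal (Cra * α / (H.card * (H.card - 1))) *
          ∑ i ∈ H, ∑ l ∈ H, ∫⁻ x, ‖x i - x l‖ₑ ^ 2 ∂μ

/-- A synchronous all-to-all message passing protocol for `K` agents whose inputs, messages and
outputs are vectors in `ℝ^d`. In round `r`, agent `j` sends `msg r j m k` to agent `k` if its
local memory is `m`; then each agent updates its memory with the `K` received vectors. -/
structure Protocol (K d : ℕ) where
  Mem : Type w
  memMeasurableSpace : MeasurableSpace Mem
  start : Fin K → Param d → Mem
  msg : ℕ → Fin K → Mem → Fin K → Param d
  step : ℕ → Fin K → Mem → (Fin K → Param d) → Mem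
  out : Fin K → Mem → Param d
  start_measurable : ∀ k, Measurable (start k)
  msg_measurable : ∀ r j k, Measurable (fun m => msg r j m k)
  step_measurable : ∀ r k, Measurable (fun x : Mem × (Fin K → Param d) => step r k x.1 x.2)
  out_measurable : ∀ k, Measurable (out k)

/-- What agent `k` receives if the agents in `H` send `sent` and all others send `byz`. -/
def received (H : Finset (Fin K)) (sent : Fin K → Param d)
    (byz : Fin K → Fin K → Param d) (k : Fin K) : Fin K → Param d :=
  fun j => if j ∈ H then sent j else byz j k

/-- The local memories after `r` rounds with honest agents `H` and input `θ`, where in round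
`r` a Byzantine agent `j ∉ H` sends the arbitrary vector `byz r j k` to agent `k`. Byzantine
agents corrupt messages only, not local memories. -/
def Protocol.mem (P : Protocol.{w} K d) (H : Finset (Fin K)) (θ : Fin K → Param d)
    (byz : ℕ → Fin K → Fin K → Param d) : ℕ → Fin K → P.Mem
  | 0, k => P.start k (θ k)
  | r + 1, k => P.step r k (P.mem H θ byz r k)
      (received H (fun j => P.msg r j (P.mem H θ byz r j) k) (byz r) k)

/-- The output of the protocol after `κ` rounds of communication. -/
def Protocol.run (P : Protocol.{w} K d) (κ : ℕ) (H : Finset (Fin K)) (θ : Fin K → Param d)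
    (byz : ℕ → Fin K → Fin K → Param d) (k : Fin K) : Param d :=
  P.out k (P.mem H θ byz κ k)

/-- `C_avg`-averaging agreement after `κ` rounds, in an iteration with honest agents `H`, where
`U ⊇ H` is the set of all agents that are honest in some iteration. For `U = H` the first
inequality is about the agents in `G` only. In general it also covers the outputs stored by those
agents that send corrupted messages now and act honestly in another iteration. -/
def Protocol.AveragingAgreement (P : Protocol.{w} K d) (κ : ℕ) (αbar Cavg : ℝ)
    (H U : Finset (Fin K)) : Prop :=
  ∀ G ⊆ H, (1 - αbar) * K ≤ G.card →
    ∀ (θ : Fin K → Param d) (byz : ℕ → Fin K → Fin K → Param d),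
      diam (G ∪ (U \ H)) (P.run κ H θ byz) ≤ diam G θ / 2 ^ κ ∧
      ‖avg G (P.run κ H θ byz) - avg G θ‖ ≤ Cavg * diam G θ

end Distributed

/-! ### The algorithm -/

section Algorithm

variable {S : Type u} {A : Type v} [MeasurableSpace S] [MeasurableSpace A]

/-- The trajectories sampled by the `K` agents in one iteration: either `N` trajectories per
agent (large batch) or `B` trajectories per agent (small batch). -/
abbrev Batch (S : Type u) (A : Type v) (H K N B : ℕ) : Type (max u v) :=
  (Fin K → Fin N → Traj S A H) ⊕ (Fin K → Fin B → Traj S A H)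

/-- What the adversary sees in an iteration `t`: its own memory, the agents' parameters
`θ_{t-1}` and `θ_t`, and all trajectories sampled in this iteration. -/
abbrev View (Mem : Type w) (S : Type u) (A : Type v) (d H K N B : ℕ) : Type (max u v w) :=
  Mem × (Fin K → Param d) × (Fin K → Param d) × Batch S A H K N B

/-- An omniscient adversary that controls all messages sent by Byzantine agents. Its memory is
arbitrary, so it may record the entire past; its initial memory is random, which provides private
randomness. `gradMsg t x j k` is the vector sent by `j` to `k` in place of a gradient estimate,
`agreeMsg t x r j k` the one sent in round `r` of the agreement protocol. -/
structure Adversary (S : Type u) (A : Type v) [MeasurableSpace S] [MeasurableSpace A]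
    (d H K N B : ℕ) where
  Mem : Type w
  memMeasurableSpace : MeasurableSpace Mem
  seed : Measure Mem
  seed_prob : IsProbabilityMeasure seed
  gradMsg : ℕ → View Mem S A d H K N B → Fin K → Fin K → Param d
  agreeMsg : ℕ → View Mem S A d H K N B → ℕ → Fin K → Fin K → Param d
  update : ℕ → View Mem S A d H K N B → Mem
  gradMsg_measurable : ∀ t j k, Measurable (fun x => gradMsg t x j k)
  agreeMsg_measurable : ∀ t r j k, Measurable (fun x => agreeMsg t x r j k)
  update_measurable : ∀ t, Measurable (update t)

attribute [instance] Protocol.memMeasurableSpace Adversary.memMeasurableSpace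

variable {d H K N B : ℕ}

/-- The law of the trajectories sampled in iteration `t` at parameters `θ`: all trajectories of
agent `k` are drawn independently from `p(· | θ k)`. The batch is large if `t = 0` or if the
common coin `c_t ∼ Be(p)` shows `1`. -/
def batchLaw (M : MDP S A) (π : PolicyClass S A d) (H N B : ℕ) (p : ℝ) (t : ℕ)
    (θ : Fin K → Param d) : Measure (Batch S A H K N B) :=
  let large : Measure (Batch S A H K N B) :=
    (Measure.pi fun k => Measure.pi fun _ : Fin N => trajLaw M π H (θ k)).map Sum.inl
  let small : Measure (Batch S A H K N B) :=
    (Measure.pi fun k => Measure.pi fun _ : Fin B => trajLaw M π H (θ k)).map Sum.inr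
  if t = 0 then large else ENNReal.ofReal p • large + ENNReal.ofReal (1 - p) • small

/-- The number of trajectories that each agent samples in an iteration. -/
def batchSize : Batch S A H K N B → ℕ
  | .inl _ => N
  | .inr _ => B

/-- The local gradient estimate `ṽ_t^{(k)}`, with `θ' = θ_{t-1}` and `θ = θ_t`. -/
def localEstimate (M : MDP S A) (π : PolicyClass S A d) (est : Estimator H) (η : ℝ)
    (θ' θ : Fin K → Param d) : Batch S A H K N B → Fin K → Param d
  | .inl τ, k => (N : ℝ)⁻¹ • ∑ i, est.g M π (τ k i) (θ k)
  | .inr τ, k => (B : ℝ)⁻¹ • ∑ i, est.g M π (τ k i) (θ k) + η⁻¹ • (θ k - θ' k) -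
      (B : ℝ)⁻¹ • ∑ i, π.weight (τ k i) (θ k) (θ' k) • est.g M π (τ k i) (θ' k)

/-- The new local parameters `θ_{t+1}` after one iteration: the agents exchange their estimates,
each of them aggregates what it received and makes a gradient step, and all of them run the
agreement protocol for `κ` rounds. `Hn` is the set of honest agents in this iteration. -/
def nextParams (M : MDP S A) (π : PolicyClass S A d) (est : Estimator H) (η : ℝ) (κ : ℕ)
    (agg : (Fin K → Param d) → Param d) (P : Protocol.{w'} K d) (Hn : Finset (Fin K))
    (gradByz : Fin K → Fin K → Param d) (agreeByz : ℕ → Fin K → Fin K → Param d)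
    (θ' θ : Fin K → Param d) (x : Batch S A H K N B) : Fin K → Param d :=
  let vtilde : Fin K → Param d := localEstimate M π est η θ' θ x
  let θtilde : Fin K → Param d := fun k => θ k + η • agg (received Hn vtilde gradByz k)
  P.run κ Hn θtilde agreeByz

/-- The state of a run: adversary memory, `θ_{t-1}`, `θ_t`, and the number of trajectories each
agent has sampled so far. -/
abbrev RunState (Mem : Type w) (d K : ℕ) : Type w :=
  Mem × (Fin K → Param d) × (Fin K → Param d) × ℕ

/-- The law of the state of the algorithm after `t` iterations, with honest agents `Hs t` in
iteration `t`. -/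
def runLaw (M : MDP S A) (π : PolicyClass S A d) (est : Estimator H) (p η : ℝ) (κ : ℕ)
    (agg : (Fin K → Param d) → Param d) (P : Protocol.{w'} K d) (Hs : ℕ → Finset (Fin K))
    (adv : Adversary.{u, v, w} S A d H K N B) (θ₀ : Param d) :
    ℕ → Measure (RunState adv.Mem d K)
  | 0 => adv.seed.map (fun z => (z, (fun _ => θ₀), (fun _ => θ₀), 0))
  | t + 1 => (runLaw M π est p η κ agg P Hs adv θ₀ t).bind fun st =>
      (batchLaw M π H N B p t st.2.2.1).map fun x =>
        let view : View adv.Mem S A d H K N B := (st.1, st.2.1, st.2.2.1, x)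
        (adv.update t view, st.2.2.1,
          nextParams M π est η κ agg P (Hs t) (adv.gradMsg t view) (adv.agreeMsg t view)
            st.2.1 st.2.2.1 x,
          st.2.2.2 + batchSize x)

/-- The law of the output `θ_{T̂}^{(k)}` of agent `k`, where `T̂` is uniform on `{0, …, T-1}` and
independent of the run. -/
def outputLaw (M : MDP S A) (π : PolicyClass S A d) (est : Estimator H) (p η : ℝ) (κ T : ℕ)
    (agg : (Fin K → Param d) → Param d) (P : Protocol.{w'} K d) (Hs : ℕ → Finset (Fin K))
    (adv : Adversary.{u, v, w} S A d H K N B) (θ₀ : Param d) (k : Fin K) :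
    Measure (Param d) :=
  (T : ℝ≥0∞)⁻¹ • ∑ t ∈ Finset.range T,
    (runLaw M π est p η κ agg P Hs adv θ₀ t).map (fun st => st.2.2.1 k)

/-- The expected number of trajectories that each agent samples in `T` iterations. -/
def expectedTrajectories (M : MDP S A) (π : PolicyClass S A d) (est : Estimator H) (p η : ℝ)
    (κ T : ℕ) (agg : (Fin K → Param d) → Param d) (P : Protocol.{w'} K d)
    (Hs : ℕ → Finset (Fin K)) (adv : Adversary.{u, v, w} S A d H K N B) (θ₀ : Param d) :
    ℝ≥0∞ :=
  ∫⁻ st, (st.2.2.2 : ℝ≥0∞) ∂(runLaw M π est p η κ agg P Hs adv θ₀ T)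

/-- Agents with (random) outputs of laws `out k` achieve a `K`-agent `a`-tolerant
`ε`-approximate solution. -/
def ApproxSolution (M : MDP S A) (π : PolicyClass S A d) (H : ℕ) (a ε : ℝ)
    (out : Fin K → Measure (Param d)) : Prop :=
  ∃ G : Finset (Fin K), (1 - a) * K ≤ G.card ∧
    ∀ k ∈ G, ∫⁻ θ, ‖gradJ M π H θ‖ₑ ^ 2 ∂(out k) ≤ ENNReal.ofReal (ε ^ 2)

end Algorithm

/-- `α^{3/2}/ε⁴ + α^{1/2}/(K ε⁴) + α^{1/2}/(K^{1/2} ε³) + 1/(K ε³)`. -/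
def rate (K : ℕ) (α ε : ℝ) : ℝ :=
  α ^ (3 / 2 : ℝ) / ε ^ 4 + α ^ (1 / 2 : ℝ) / (K * ε ^ 4) +
    α ^ (1 / 2 : ℝ) / ((K : ℝ) ^ (1 / 2 : ℝ) * ε ^ 3) + 1 / (K * ε ^ 3)

end DecByzPG

end

noncomputable section

namespace DecByzPG

/-! ### The trajectory law -/

section TrajLaw

variable {S : Type u} {A : Type v} [MeasurableSpace S] [MeasurableSpace A] {d : ℕ}

/-! Fix an agent `u` in the set `U` of agents that are honest at least once, and read its whole
update as one ascent step along the effective direction d = (θ_{t+1} − θ_t)/η. Sampling, aggregation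
and agreement errors are then all contained in e = ‖d − ∇J(θ_t)‖². Since J is L-smooth and 2ηL ≤ 1,
the step gains η/2 ‖∇J(θ_t)‖² + η/4 ‖d‖² and loses at most η/2 e (`le_objective`,
`StepAssumptions.descent`).

The error e obeys a recursion of variance-reduction type. A large batch, of probability p, discards
the old error and leaves noise O((1/K + α)/N) plus disagreement (`StepAssumptions.large_batch`). A
small batch adds to the old direction an importance sampling estimate of ∇J(θ_t) − ∇J(θ_{t−1}),
whose variance is O(‖θ_t − θ_{t−1}‖²) (`Estimator.exists_hasMeanVar_difference`). As the correction
term is the effective direction itself, and not the last aggregate, the old error of `u` is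
inherited exactly; the other agents differ from `u` only through disagreement
(`StepAssumptions.small_batch`). The factor 1/K comes from averaging independent honest samples. The
aggregator adds α times their dispersion, and with a factor 1/p, since Young's inequality may
inflate the old error only by 1 + O(p).

The adversary enters only through inequalities valid for every message: robust aggregation is
applied to Dirac laws, and averaging agreement holds for all inputs (`communication_step`). Hence
its dependence on the samples is harmless, and probability concerns only the honest estimates.

These quantities are combined in `potential`. The weight η/p on e matches the rate p at which e is
reset. The term η/4 ‖d‖² stores the gain of the ascent step and pays for the variance of the next
small batch, which works because (1/K + α/p)η² is small compared with p; this dictates A.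
Disagreement at two consecutive times is stored because a small batch involves two parameters; κ
rounds contract it by 4^{-κ}, up to a constant. `drift_algebra` shows that the expected potential
plus η/2 ‖∇J‖² grows only by a noise term, and summation over time bounds the average squared
gradient (`sum_lintegral_gradJ_le`).

With N of order (1/K + α)/ε² (up to an additive constant), B = 1 and T of order N + 1/(ηε²), the
cost is at most N + 2T. Here 1/η is at most of order √α N + √(N/K) + L, and inserting N yields the
four summands of the rate and a remainder 1/ε² (`sample_count_le`). -/

instance (M : MDP S A) (n : ℕ) : IsMarkovKernel (M.nextState n) := by
  have := M.init_prob
  have := M.transition_markov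
  cases n with
  | zero => exact inferInstanceAs (IsMarkovKernel (Kernel.const _ M.init))
  | succ n => exact inferInstanceAs (IsMarkovKernel (M.transition.comap (fun τ : Fin (n + 1) → S × A =>
      τ (Fin.last n)) (measurable_pi_apply _)))

instance (π : PolicyClass S A d) : SigmaFinite π.ref := π.ref_sigmaFinite

instance (M : MDP S A) (ref : Measure A) [SFinite ref] (n : ℕ) : SFinite (M.trajRef ref n) := by
  induction n with
  | zero => exact inferInstanceAs (SFinite (Measure.dirac _))
  | succ n ih =>
    exact inferInstanceAs (SFinite ((M.trajRef ref n ⊗ₘ (M.nextState n ×ₖ Kernel.const _ ref)).map _))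

lemma measurable_snoc (X : Type*) [MeasurableSpace X] (n : ℕ) :
    Measurable (fun x : (Fin n → X) × X => (Fin.snoc x.1 x.2 : Fin (n + 1) → X)) := by
  refine measurable_pi_lambda _ fun i => ?_
  refine Fin.lastCases ?_ (fun j => ?_) i
  · simpa using measurable_snd
  · simpa [Function.comp_def] using (measurable_pi_apply j).comp (measurable_fst (α := Fin n → X) (β := X))

lemma measurable_init (X : Type*) [MeasurableSpace X] (n : ℕ) :
    Measurable (fun x : Fin (n + 1) → X => (Fin.init x : Fin n → X)) :=
  measurable_pi_lambda _ fun _ => measurable_pi_apply _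

variable (M : MDP S A) (π : PolicyClass S A d)

lemma PolicyClass.measurable_prob (θ : Param d) :
    Measurable (fun x : S × A => π.prob θ x.1 x.2) :=
  π.prob_measurable.comp (measurable_const.prodMk measurable_id)

lemma PolicyClass.trajDensity_pos {H : ℕ} (θ : Param d) (τ : Traj S A H) :
    0 < π.trajDensity θ τ := Finset.prod_pos fun _ _ => π.prob_pos _ _ _

lemma PolicyClass.measurable_trajDensity {H : ℕ} (θ : Param d) :
    Measurable (fun τ : Traj S A H => π.trajDensity θ τ) :=
  Finset.measurable_prod _ fun h _ => (π.measurable_prob θ).comp (measurable_pi_apply h)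

/-- The density factorizes over the last pair: its action factor integrates to 1 by `prob_total`,
and the transition is Markov. Both total mass 1 and the marginals needed for GPOMDP follow from this
by induction. -/
lemma trajLaw_map_init (n : ℕ) (θ : Param d) :
    (trajLaw M π (n + 1) θ).map Fin.init = trajLaw M π n θ := by
  refine Measure.ext_of_lintegral _ fun f hf => ?_
  have hm : Measurable (fun τ : Traj S A (n + 1) => (Fin.init τ : Traj S A n)) := measurable_init _ n
  have hp : ∀ n, Measurable (fun τ : Traj S A n => ENNReal.ofReal (π.trajDensity θ τ)) :=
    fun n => (π.measurable_trajDensity θ).ennreal_ofReal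
  have hq : Measurable (fun x : S × A => ENNReal.ofReal (π.prob θ x.1 x.2)) :=
    (π.measurable_prob θ).ennreal_ofReal
  rw [lintegral_map hf hm, trajLaw, trajLaw,
    lintegral_withDensity_eq_lintegral_mul _ (hp _) (show Measurable fun τ => f (Fin.init τ) from hf.comp hm),
    lintegral_withDensity_eq_lintegral_mul _ (hp _) hf, MDP.trajRef,
    lintegral_map ((hp _).mul (show Measurable fun τ => f (Fin.init τ) from hf.comp hm)) (measurable_snoc _ n)]
  have key : ∀ x : Traj S A n × (S × A),
      ENNReal.ofReal (π.trajDensity θ (Fin.snoc x.1 x.2 : Traj S A (n + 1))) *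
        f (Fin.init (Fin.snoc x.1 x.2 : Traj S A (n + 1))) =
      (ENNReal.ofReal (π.trajDensity θ x.1) * f x.1) * ENNReal.ofReal (π.prob θ x.2.1 x.2.2) := by
    rintro ⟨τ, x⟩
    simp only [Fin.init_snoc, PolicyClass.trajDensity, Fin.prod_univ_castSucc,
      Fin.snoc_castSucc, Fin.snoc_last]
    rw [ENNReal.ofReal_mul (Finset.prod_nonneg fun _ _ => (π.prob_pos _ _ _).le)]
    ring
  refine (lintegral_congr key).trans ?_
  refine (Measure.lintegral_compProd
    ((((hp n).mul hf).comp measurable_fst).mul (hq.comp measurable_snd))).trans ?_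
  refine lintegral_congr fun τ => ?_
  refine (lintegral_const_mul (ENNReal.ofReal (π.trajDensity θ τ) * f τ) hq).trans ?_
  rw [Kernel.lintegral_prod _ _ _ hq]
  simp [π.prob_total]

instance (n : ℕ) (θ : Param d) : IsProbabilityMeasure (trajLaw M π n θ) := by
  induction n with
  | zero =>
    have : trajLaw M π 0 θ = Measure.dirac Fin.elim0 := by
      simp [trajLaw, PolicyClass.trajDensity, MDP.trajRef]
    rw [this]; infer_instance
  | succ n ih =>
    rw [← trajLaw_map_init] at ih
    exact Measure.isProbabilityMeasure_of_map (Fin.init : Traj S A (n + 1) → Traj S A n)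

lemma trajLaw_map_restrict {n H : ℕ} (h : n ≤ H) (θ : Param d) :
    (trajLaw M π H θ).map (fun τ i => τ (Fin.castLE h i)) = trajLaw M π n θ := by
  induction H, h using Nat.le_induction with
  | base => exact Measure.map_id
  | succ m hm ih =>
    rw [← ih, ← trajLaw_map_init M π m, Measure.map_map
      (measurable_pi_lambda _ fun _ => measurable_pi_apply _) (measurable_init _ m)]
    rfl

lemma integral_trajLaw {E : Type*} [NormedAddCommGroup E] [NormedSpace ℝ E] {H : ℕ} (θ : Param d)
    (f : Traj S A H → E) :
    ∫ τ, f τ ∂(trajLaw M π H θ) = ∫ τ, π.trajDensity θ τ • f τ ∂(M.trajRef π.ref H) := by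
  rw [trajLaw, integral_withDensity_eq_integral_toReal_smul
    (π.measurable_trajDensity θ).ennreal_ofReal (by simp)]
  simp [ENNReal.toReal_ofReal (π.trajDensity_pos θ _).le]

lemma integrable_trajLaw_iff {E : Type*} [NormedAddCommGroup E] [NormedSpace ℝ E] {H : ℕ}
    (θ : Param d) (f : Traj S A H → E) :
    Integrable f (trajLaw M π H θ) ↔
      Integrable (fun τ => π.trajDensity θ τ • f τ) (M.trajRef π.ref H) := by
  rw [trajLaw, integrable_withDensity_iff_integrable_smul'
    (π.measurable_trajDensity θ).ennreal_ofReal (by simp)]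
  simp [ENNReal.toReal_ofReal (π.trajDensity_pos θ _).le]

lemma integrable_trajDensity (H : ℕ) (θ : Param d) :
    Integrable (fun τ : Traj S A H => π.trajDensity θ τ) (M.trajRef π.ref H) := by
  simpa using (integrable_trajLaw_iff M π θ (fun _ : Traj S A H => (1 : ℝ))).1
    (integrable_const _)

end TrajLaw

/-! ### Scores -/

section Score

variable {S : Type u} {A : Type v} [MeasurableSpace S] [MeasurableSpace A] {d : ℕ}
variable {π : PolicyClass S A d} {G M₂ : ℝ}

lemma hasGradientAt_log_prob (hs : LogPolicySmooth π M₂) (s : S) (a : A) (θ : Param d) :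
    HasGradientAt (fun θ' => Real.log (π.prob θ' s a)) (π.score θ s a) θ :=
  (((hs s a).1 θ).log (π.prob_pos _ _ _).ne').hasGradientAt

lemma abs_log_prob_sub_le (hs : LogPolicySmooth π M₂) (hG : LogPolicyGradientBound π G)
    (s : S) (a : A) (θ θ' : Param d) :
    |Real.log (π.prob θ' s a) - Real.log (π.prob θ s a)| ≤ G * ‖θ' - θ‖ := by
  refine convex_univ.norm_image_sub_le_of_norm_hasFDerivWithin_le (𝕜 := ℝ)
    (f := fun θ' => Real.log (π.prob θ' s a))
    (f' := fun θ => InnerProductSpace.toDual ℝ _ (π.score θ s a)) (fun θ _ =>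
    (hasGradientAt_log_prob hs s a θ).hasFDerivAt.hasFDerivWithinAt) (fun θ _ => ?_)
    (Set.mem_univ _) (Set.mem_univ _)
  simpa using hG s a θ

lemma differentiable_score (hs : LogPolicySmooth π M₂) (s : S) (a : A) :
    Differentiable ℝ (fun θ => π.score θ s a) := by
  have h : (fun θ => π.score θ s a) = fun θ => (InnerProductSpace.toDual ℝ (Param d)).symm
      ((π.prob θ s a)⁻¹ • fderiv ℝ (fun θ' => π.prob θ' s a) θ) := by
    funext θ
    rw [PolicyClass.score, gradient, fderiv.log ((hs s a).1 θ) (π.prob_pos _ _ _).ne']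
  rw [h]
  refine (InnerProductSpace.toDual ℝ (Param d)).symm.toContinuousLinearEquiv.differentiable.comp ?_
  exact (((hs s a).1).inv fun θ => (π.prob_pos _ _ _).ne').smul (hs s a).2.1

lemma norm_score_sub_le (hs : LogPolicySmooth π M₂) (s : S) (a : A) (θ θ' : Param d) :
    ‖π.score θ' s a - π.score θ s a‖ ≤ M₂ * ‖θ' - θ‖ :=
  convex_univ.norm_image_sub_le_of_norm_fderiv_le (𝕜 := ℝ) (f := fun θ' => π.score θ' s a)
    (fun θ _ => differentiable_score hs s a θ) (fun θ _ => (hs s a).2.2 θ)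
    (Set.mem_univ _) (Set.mem_univ _)

/-- Each coordinate is a pointwise limit of difference quotients with step 1/(n+1), which are
measurable in the state and action. -/
lemma measurable_score (hs : LogPolicySmooth π M₂) (θ : Param d) :
    Measurable (fun x : S × A => π.score θ x.1 x.2) := by
  have hlog : ∀ θ, Measurable (fun x : S × A => Real.log (π.prob θ x.1 x.2)) :=
    fun θ => (π.measurable_prob θ).log
  have hcoord : ∀ i, Measurable (fun x : S × A => π.score θ x.1 x.2 i) := by
    intro i
    have hlim : ∀ x : S × A, Filter.Tendsto (fun n : ℕ => ((n : ℝ) + 1) *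
        (Real.log (π.prob (θ + ((n : ℝ) + 1)⁻¹ • EuclideanSpace.single i 1) x.1 x.2) -
          Real.log (π.prob θ x.1 x.2))) Filter.atTop (nhds (π.score θ x.1 x.2 i)) := by
      intro x
      have h := (hasGradientAt_log_prob hs x.1 x.2 θ).hasFDerivAt.hasLineDerivAt
        (EuclideanSpace.single i (1 : ℝ))
      have h1 := HasDerivAt.tendsto_slope_zero (show HasDerivAt _ _ _ from h)
      have h2 : Filter.Tendsto (fun n : ℕ => ((n : ℝ) + 1)⁻¹) Filter.atTop (nhdsWithin 0 {0}ᶜ) := by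
        refine tendsto_nhdsWithin_iff.2 ⟨?_, Filter.Eventually.of_forall fun n => ?_⟩
        · simpa using tendsto_one_div_add_atTop_nhds_zero_nat (𝕜 := ℝ)
        · simp only [Set.mem_compl_iff, Set.mem_singleton_iff]; positivity
      simpa [Function.comp_def, EuclideanSpace.inner_single_right] using h1.comp h2
    refine measurable_of_tendsto_metrizable (fun n => ?_) (tendsto_pi_nhds.2 hlim)
    exact ((hlog _).sub (hlog _)).const_mul _
  exact (PiLp.continuous_toLp 2 _).measurable.comp (measurable_pi_lambda _ hcoord)

/-- The score `∇_θ log p(τ | θ)` of a trajectory. -/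
def PolicyClass.trajScore (π : PolicyClass S A d) {H : ℕ} (θ : Param d) (τ : Traj S A H) :
    Param d := ∑ h, π.score θ (τ h).1 (τ h).2

variable {H : ℕ}

lemma norm_trajScore_le (hG : LogPolicyGradientBound π G) (θ : Param d) (τ : Traj S A H) :
    ‖π.trajScore θ τ‖ ≤ H * G := by
  refine (norm_sum_le_of_le _ fun h _ => hG (τ h).1 (τ h).2 θ).trans ?_
  simp

lemma norm_trajScore_sub_le (hs : LogPolicySmooth π M₂) (θ θ' : Param d) (τ : Traj S A H) :
    ‖π.trajScore θ' τ - π.trajScore θ τ‖ ≤ H * M₂ * ‖θ' - θ‖ := by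
  rw [PolicyClass.trajScore, PolicyClass.trajScore, ← Finset.sum_sub_distrib]
  refine (norm_sum_le_of_le _ fun h _ => norm_score_sub_le hs (τ h).1 (τ h).2 θ θ').trans ?_
  simp [mul_assoc]

lemma measurable_trajScore (hs : LogPolicySmooth π M₂) (θ : Param d) :
    Measurable (fun τ : Traj S A H => π.trajScore θ τ) :=
  Finset.measurable_sum _ fun h _ => (measurable_score hs θ).comp (measurable_pi_apply h)

lemma log_trajDensity (θ : Param d) (τ : Traj S A H) :
    Real.log (π.trajDensity θ τ) = ∑ h, Real.log (π.prob θ (τ h).1 (τ h).2) :=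
  Real.log_prod fun _ _ => (π.prob_pos _ _ _).ne'

lemma hasGradientAt_trajDensity (hs : LogPolicySmooth π M₂) (θ : Param d) (τ : Traj S A H) :
    HasGradientAt (fun θ => π.trajDensity θ τ) (π.trajDensity θ τ • π.trajScore θ τ) θ := by
  have h1 : HasFDerivAt (fun θ => ∑ h, Real.log (π.prob θ (τ h).1 (τ h).2))
      (∑ h, InnerProductSpace.toDual ℝ (Param d) (π.score θ (τ h).1 (τ h).2)) θ :=
    HasFDerivAt.fun_sum fun h _ => (hasGradientAt_log_prob hs (τ h).1 (τ h).2 θ).hasFDerivAt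
  have h2 := h1.exp
  simp only [← log_trajDensity, Real.exp_log (π.trajDensity_pos _ τ)] at h2
  rw [hasGradientAt_iff_hasFDerivAt]
  simpa [PolicyClass.trajScore] using h2

lemma abs_log_trajDensity_sub_le (hs : LogPolicySmooth π M₂) (hG : LogPolicyGradientBound π G)
    (θ θ' : Param d) (τ : Traj S A H) :
    |Real.log (π.trajDensity θ' τ) - Real.log (π.trajDensity θ τ)| ≤ H * G * ‖θ' - θ‖ := by
  rw [log_trajDensity, log_trajDensity, ← Finset.sum_sub_distrib]
  refine (Finset.abs_sum_le_sum_abs _ _).trans ((Finset.sum_le_sum fun h _ =>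
    abs_log_prob_sub_le hs hG (τ h).1 (τ h).2 θ θ').trans ?_)
  simp [mul_assoc]

lemma trajDensity_le (hs : LogPolicySmooth π M₂) (hG : LogPolicyGradientBound π G)
    (θ θ' : Param d) (τ : Traj S A H) :
    π.trajDensity θ' τ ≤ Real.exp (H * G * ‖θ' - θ‖) * π.trajDensity θ τ := by
  have h := (abs_le.1 (abs_log_trajDensity_sub_le hs hG θ θ' τ)).2
  have h' : Real.log (π.trajDensity θ' τ) ≤ H * G * ‖θ' - θ‖ + Real.log (π.trajDensity θ τ) := by
    linarith
  rw [← Real.exp_log (π.trajDensity_pos θ τ), ← Real.exp_add]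
  exact (Real.log_le_iff_le_exp (π.trajDensity_pos _ τ)).1 h'

/-- The ratio of the densities is e^y with |y| ≤ x, and |e^y − 1| ≤ x e^x. The factor e^x is removed
later by `norm_sub_le_of_exp_mul`, so no second derivative is taken under the integral. -/
lemma abs_trajDensity_sub_le (hs : LogPolicySmooth π M₂) (hG : LogPolicyGradientBound π G)
    (θ θ' : Param d) (τ : Traj S A H) :
    |π.trajDensity θ' τ - π.trajDensity θ τ| ≤
      π.trajDensity θ τ * (Real.exp (H * G * ‖θ' - θ‖) * (H * G * ‖θ' - θ‖)) := by
  have h := abs_log_trajDensity_sub_le hs hG θ θ' τ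
  set x := H * G * ‖θ' - θ‖
  have hx : 0 ≤ x := (abs_nonneg _).trans h
  have hp := π.trajDensity_pos θ τ
  set y := Real.log (π.trajDensity θ' τ) - Real.log (π.trajDensity θ τ)
  have hy : π.trajDensity θ' τ = π.trajDensity θ τ * Real.exp y := by
    rw [Real.exp_sub, Real.exp_log hp, Real.exp_log (π.trajDensity_pos _ τ)]
    field_simp
  have e1 : Real.exp y ≤ Real.exp x := Real.exp_le_exp.2 (abs_le.1 h).2
  have e2 : 1 - x ≤ Real.exp y := by
    have := Real.add_one_le_exp y; linarith [(abs_le.1 h).1]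
  have e3 : Real.exp x - 1 ≤ Real.exp x * x := by
    have h1 := Real.add_one_le_exp (-x)
    have h2 : Real.exp x * Real.exp (-x) = 1 := by rw [← Real.exp_add]; simp
    nlinarith [Real.exp_pos x]
  have e4 : x ≤ Real.exp x * x := le_mul_of_one_le_left hx (Real.one_le_exp hx)
  rw [hy, show π.trajDensity θ τ * Real.exp y - π.trajDensity θ τ =
    π.trajDensity θ τ * (Real.exp y - 1) by ring, abs_mul, abs_of_pos hp]
  gcongr
  rw [abs_le]
  constructor <;> linarith

lemma norm_trajDensity_smul_trajScore_sub_le (hs : LogPolicySmooth π M₂)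
    (hG : LogPolicyGradientBound π G) (hM₂ : 0 ≤ M₂) (θ θ' : Param d) (τ : Traj S A H) :
    ‖π.trajDensity θ' τ • π.trajScore θ' τ - π.trajDensity θ τ • π.trajScore θ τ‖ ≤
      π.trajDensity θ τ * (Real.exp (H * G * ‖θ' - θ‖) * (H * (M₂ + H * G ^ 2) * ‖θ' - θ‖)) := by
  have e : π.trajDensity θ' τ • π.trajScore θ' τ - π.trajDensity θ τ • π.trajScore θ τ =
      (π.trajDensity θ' τ - π.trajDensity θ τ) • π.trajScore θ' τ +
        π.trajDensity θ τ • (π.trajScore θ' τ - π.trajScore θ τ) := by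
    rw [sub_smul, smul_sub]; abel
  have h0 := abs_log_trajDensity_sub_le hs hG θ θ' τ
  have hx : 0 ≤ H * G * ‖θ' - θ‖ := (abs_nonneg _).trans h0
  have hp := π.trajDensity_pos θ τ
  have h3 : H * M₂ * ‖θ' - θ‖ ≤ Real.exp (H * G * ‖θ' - θ‖) * (H * M₂ * ‖θ' - θ‖) :=
    le_mul_of_one_le_left (by positivity) (Real.one_le_exp hx)
  have h1 := abs_trajDensity_sub_le hs hG θ θ' τ
  rw [e]
  calc _ ≤ |π.trajDensity θ' τ - π.trajDensity θ τ| * ‖π.trajScore θ' τ‖ +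
        π.trajDensity θ τ * ‖π.trajScore θ' τ - π.trajScore θ τ‖ := by
        refine (norm_add_le _ _).trans ?_
        rw [norm_smul, norm_smul, Real.norm_eq_abs, Real.norm_eq_abs, abs_of_pos hp]
    _ ≤ π.trajDensity θ τ * (Real.exp (H * G * ‖θ' - θ‖) * (H * G * ‖θ' - θ‖)) * (H * G) +
        π.trajDensity θ τ * (Real.exp (H * G * ‖θ' - θ‖) * (H * M₂ * ‖θ' - θ‖)) := by
        gcongr
        · exact norm_trajScore_le hG θ' τ
        · exact (norm_trajScore_sub_le hs θ θ' τ).trans h3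
    _ = _ := by ring

end Score

/-! ### The policy gradient theorem and smoothness of the objective -/

section PolicyGradient

variable {S : Type u} {A : Type v} [MeasurableSpace S] [MeasurableSpace A] {d : ℕ}
variable {π : PolicyClass S A d} {G M₂ : ℝ} {H : ℕ} (M : MDP S A)

lemma integrable_trajLaw_of_bound {E : Type*} [NormedAddCommGroup E] [NormedSpace ℝ E]
    [MeasurableSpace E] [BorelSpace E] [SecondCountableTopology E]
    {f : Traj S A H → E} (hf : Measurable f) {c : ℝ} (hc : ∀ τ, ‖f τ‖ ≤ c) (θ : Param d) :
    Integrable f (trajLaw M π H θ) :=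
  Integrable.of_bound hf.aestronglyMeasurable c (Filter.Eventually.of_forall hc)

/-- Differentiation under the integral, with ∇p = p ∇log p. In the unit ball around `θ` all
densities are at most a constant times the density at `θ`, which gives an integrable majorant. -/
lemma hasGradientAt_integral_trajLaw (hs : LogPolicySmooth π M₂) (hG : LogPolicyGradientBound π G)
    {f : Traj S A H → ℝ} (hf : Measurable f) {c : ℝ} (hc : ∀ τ, |f τ| ≤ c) (θ : Param d) :
    HasGradientAt (fun θ => ∫ τ, f τ ∂(trajLaw M π H θ))
      (∫ τ, f τ • π.trajScore θ τ ∂(trajLaw M π H θ)) θ := by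
  have hfp : ∀ θ, Measurable (fun τ : Traj S A H => π.trajDensity θ τ • f τ) :=
    fun θ => (π.measurable_trajDensity θ).smul hf
  have hms : Measurable (fun τ : Traj S A H => π.trajDensity θ τ • f τ • π.trajScore θ τ) :=
    (π.measurable_trajDensity θ).smul (hf.smul (measurable_trajScore hs θ))
  have hbd : ∀ θ τ, ‖f τ • π.trajScore θ τ‖ ≤ c * (H * G) := fun θ τ => by
    rw [norm_smul]
    exact mul_le_mul (hc τ) (norm_trajScore_le hG θ τ) (norm_nonneg _) ((abs_nonneg _).trans (hc τ))
  have hder := hasFDerivAt_integral_of_dominated_of_fderiv_le (𝕜 := ℝ)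
    (μ := M.trajRef π.ref H) (x₀ := θ) (s := Metric.ball θ 1)
    (F := fun θ τ => π.trajDensity θ τ • f τ)
    (F' := fun θ τ => InnerProductSpace.toDual ℝ (Param d)
      (π.trajDensity θ τ • f τ • π.trajScore θ τ))
    (bound := fun τ => Real.exp (|H * G| * 1) * π.trajDensity θ τ * (c * (H * G)))
    (Metric.ball_mem_nhds θ one_pos)
    (Filter.Eventually.of_forall fun θ => (hfp θ).aestronglyMeasurable)
    ((integrable_trajLaw_iff M π θ f).1 (integrable_trajLaw_of_bound M hf hc θ))
    ((InnerProductSpace.toDual ℝ (Param d)).continuous.comp_aestronglyMeasurable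
      hms.aestronglyMeasurable)
    (Filter.Eventually.of_forall fun τ θ' hθ' => ?_)
    (((integrable_trajDensity M π H θ).const_mul _).mul_const _)
    (Filter.Eventually.of_forall fun τ θ' _ => ?_)
  · have hi : Integrable (fun τ : Traj S A H => π.trajDensity θ τ • f τ • π.trajScore θ τ)
        (M.trajRef π.ref H) :=
      (integrable_trajLaw_iff M π θ _).1 (integrable_trajLaw_of_bound M
        (hf.smul (measurable_trajScore hs θ)) (hbd θ) θ)
    rw [hasGradientAt_iff_hasFDerivAt]
    simp only [integral_trajLaw]
    exact hder.congr_fderiv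
      ((InnerProductSpace.toDual ℝ
        (Param d)).toContinuousLinearEquiv.toContinuousLinearMap.integral_comp_comm hi)
  · simp only [LinearIsometryEquiv.norm_map]
    rw [norm_smul, Real.norm_eq_abs, abs_of_pos (π.trajDensity_pos _ _)]
    refine mul_le_mul ?_ (hbd θ' τ) (norm_nonneg _) ?_
    · refine (trajDensity_le hs hG θ θ' τ).trans ?_
      have : ‖θ' - θ‖ ≤ 1 := by rw [← dist_eq_norm]; exact (Metric.mem_ball.1 hθ').le
      have hp := (π.trajDensity_pos θ τ).le
      gcongr
      exact le_abs_self _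
    · have := (π.trajDensity_pos θ τ).le
      positivity
  · have h := (hasGradientAt_trajDensity hs θ' τ).hasFDerivAt.mul_const (f τ)
    refine h.congr_fderiv ?_
    ext v
    simp only [smul_apply, InnerProductSpace.toDual_apply_apply,
      inner_smul_left, smul_eq_mul, RCLike.conj_to_real]
    ring

lemma measurable_castLE {X : Type*} [MeasurableSpace X] {n : ℕ} (h : n ≤ H) :
    Measurable (fun (τ : Fin H → X) (i : Fin n) => τ (Fin.castLE h i)) :=
  measurable_pi_lambda _ fun _ => measurable_pi_apply _

lemma hasGradientAt_integral_restrict (hs : LogPolicySmooth π M₂)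
    (hG : LogPolicyGradientBound π G) {n : ℕ} (h : n ≤ H)
    {f : Traj S A n → ℝ} (hf : Measurable f) {c : ℝ} (hc : ∀ τ, |f τ| ≤ c) (θ : Param d) :
    HasGradientAt (fun θ => ∫ τ, f (fun i => τ (Fin.castLE h i)) ∂(trajLaw M π H θ))
      (∫ τ, f (fun i => τ (Fin.castLE h i)) • π.trajScore θ (fun i => τ (Fin.castLE h i))
        ∂(trajLaw M π H θ)) θ := by
  have key := hasGradientAt_integral_trajLaw M hs hG hf hc θ
  simp only [← trajLaw_map_restrict M π h] at key
  rw [integral_map (measurable_castLE h).aemeasurable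
    (show Measurable (fun τ => f τ • π.trajScore θ τ) from
      hf.smul (measurable_trajScore hs θ)).aestronglyMeasurable] at key
  simpa only [integral_map (measurable_castLE h).aemeasurable hf.aestronglyMeasurable] using key

lemma MDP.measurable_reward_apply (h : Fin H) :
    Measurable (fun τ : Traj S A H => M.reward (τ h).1 (τ h).2) :=
  M.reward_measurable.comp (measurable_pi_apply h)

lemma MDP.measurable_ret : Measurable (fun τ : Traj S A H => M.ret τ) :=
  Finset.measurable_sum _ fun h _ => (M.measurable_reward_apply h).const_mul _

lemma MDP.ret_nonneg (τ : Traj S A H) : 0 ≤ M.ret τ :=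
  Finset.sum_nonneg fun _ _ => mul_nonneg (pow_nonneg M.γ_pos.le _) (M.reward_nonneg _ _)

lemma MDP.ret_le (τ : Traj S A H) : M.ret τ ≤ M.R / (1 - M.γ) := by
  have hγ := M.γ_pos
  have hγ' := M.γ_lt_one
  calc M.ret τ ≤ ∑ h : Fin H, M.γ ^ (h : ℕ) * M.R :=
        Finset.sum_le_sum fun h _ => by gcongr; exact M.reward_le _ _
    _ = (∑ i ∈ Finset.range H, M.γ ^ i) * M.R := by
        rw [Finset.sum_mul, Finset.sum_range (fun i => M.γ ^ i * M.R)]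
    _ ≤ (1 - M.γ)⁻¹ * M.R := by
        have := M.R_pos
        gcongr
        rw [← tsum_geometric_of_lt_one hγ.le hγ']
        exact (summable_geometric_of_lt_one hγ.le hγ').sum_le_tsum _ fun i _ => by positivity
    _ = _ := by ring

lemma MDP.norm_ret_le (τ : Traj S A H) : |M.ret τ| ≤ M.R / (1 - M.γ) := by
  rw [abs_of_nonneg (M.ret_nonneg τ)]; exact M.ret_le τ

lemma objective_nonneg (θ : Param d) : 0 ≤ objective M π H θ :=
  integral_nonneg fun τ => M.ret_nonneg τ

lemma objective_le (θ : Param d) : objective M π H θ ≤ M.R / (1 - M.γ) := by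
  have h : objective M π H θ ≤ ∫ _, M.R / (1 - M.γ) ∂(trajLaw M π H θ) :=
    integral_mono (integrable_trajLaw_of_bound M M.measurable_ret M.norm_ret_le θ)
      (integrable_const _) fun τ => M.ret_le τ
  simpa using h

lemma hasGradientAt_objective' (hs : LogPolicySmooth π M₂) (hG : LogPolicyGradientBound π G)
    (θ : Param d) : HasGradientAt (objective M π H)
      (∫ τ, M.ret τ • π.trajScore θ τ ∂(trajLaw M π H θ)) θ :=
  hasGradientAt_integral_trajLaw M hs hG M.measurable_ret M.norm_ret_le θ

lemma gradJ_eq (hs : LogPolicySmooth π M₂) (hG : LogPolicyGradientBound π G) (θ : Param d) :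
    gradJ M π H θ = ∫ τ, M.ret τ • π.trajScore θ τ ∂(trajLaw M π H θ) :=
  (hasGradientAt_objective' M hs hG θ).gradient

lemma hasGradientAt_objective (hs : LogPolicySmooth π M₂) (hG : LogPolicyGradientBound π G)
    (θ : Param d) : HasGradientAt (objective M π H) (gradJ M π H θ) θ := by
  rw [gradJ_eq M hs hG]; exact hasGradientAt_objective' M hs hG θ

/-- A function that is Lipschitz with constant `L e^{c r}` at scale `r` is `L`-Lipschitz. -/
lemma norm_sub_le_of_exp_mul {E F : Type*} [NormedAddCommGroup E] [NormedSpace ℝ E]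
    [NormedAddCommGroup F] {f : E → F} {c L : ℝ}
    (h : ∀ x y, ‖f y - f x‖ ≤ Real.exp (c * ‖y - x‖) * (L * ‖y - x‖)) (x y : E) :
    ‖f y - f x‖ ≤ L * ‖y - x‖ := by
  set r := ‖y - x‖ with hr
  have hn : ∀ n : ℕ, ‖f y - f x‖ ≤ Real.exp (c * (r * (1 / ((n : ℝ) + 1)))) * (L * r) := by
    intro n
    have hn0 : (0 : ℝ) < (n : ℝ) + 1 := by positivity
    -- Cut the segment into n + 1 equal pieces. The linear factors add up to L r, while each
    -- exponential is taken at scale r/(n+1) and tends to 1.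
    let z : ℕ → E := fun i => x + ((i : ℝ) / ((n : ℝ) + 1)) • (y - x)
    have hz : ∀ i, ‖z (i + 1) - z i‖ = r * (1 / ((n : ℝ) + 1)) := fun i => by
      have : z (i + 1) - z i = (1 / ((n : ℝ) + 1)) • (y - x) := by
        simp only [z, add_sub_add_left_eq_sub, ← sub_smul]
        congr 1
        push_cast; ring
      rw [this, norm_smul, Real.norm_eq_abs, abs_of_pos (by positivity), mul_comm]
    have htel : f y - f x = ∑ i ∈ Finset.range (n + 1), (f (z (i + 1)) - f (z i)) := by
      rw [Finset.sum_range_sub (fun i => f (z i))]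
      simp only [z]
      congr 2
      · push_cast
        rw [div_self hn0.ne']; simp
      · simp
    rw [htel]
    refine (norm_sum_le_of_le _ fun i _ => h (z i) (z (i + 1))).trans (le_of_eq ?_)
    simp only [hz, Finset.sum_const, Finset.card_range, nsmul_eq_mul]
    push_cast
    field_simp
  have ht : Filter.Tendsto (fun n : ℕ => Real.exp (c * (r * (1 / ((n : ℝ) + 1)))) * (L * r))
      Filter.atTop (nhds (Real.exp (c * (r * 0)) * (L * r))) :=
    (Real.continuous_exp.tendsto _ |>.comp
      ((tendsto_one_div_add_atTop_nhds_zero_nat.const_mul r).const_mul c)).mul_const _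
  simpa using ge_of_tendsto' ht hn

lemma MDP.L_pos (hH : 1 ≤ H) (hG : 0 < G) (hM₂ : 0 < M₂) : 0 < M.L H G M₂ := by
  have := M.R_pos
  have : (0 : ℝ) < H := by exact_mod_cast hH
  have : 0 < 1 - M.γ := sub_pos.2 M.γ_lt_one
  unfold MDP.L
  positivity

/-- Comparing the integrands p ∇log p at the two parameters gives the Lipschitz bound up to a factor
e^{HGr} at distance r; subdivision of the segment then yields the sharp constant. -/
lemma norm_gradJ_sub_le (hs : LogPolicySmooth π M₂) (hG : LogPolicyGradientBound π G)
    (hM₂ : 0 ≤ M₂) (θ θ' : Param d) :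
    ‖gradJ M π H θ' - gradJ M π H θ‖ ≤ M.L H G M₂ * ‖θ' - θ‖ := by
  refine norm_sub_le_of_exp_mul (c := H * G) (fun θ θ' => ?_) θ θ'
  have hb : ∀ (θ : Param d) (τ : Traj S A H), ‖M.ret τ • π.trajScore θ τ‖ ≤
      M.R / (1 - M.γ) * (H * G) := fun θ τ => by
    rw [norm_smul]
    exact mul_le_mul (M.norm_ret_le τ) (norm_trajScore_le hG θ τ) (norm_nonneg _)
      ((abs_nonneg _).trans (M.norm_ret_le τ))
  have hint : ∀ θ, Integrable (fun τ : Traj S A H => π.trajDensity θ τ • M.ret τ •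
      π.trajScore θ τ) (M.trajRef π.ref H) := fun θ =>
    (integrable_trajLaw_iff M π θ _).1 (integrable_trajLaw_of_bound M
      (M.measurable_ret.smul (measurable_trajScore hs θ)) (hb θ) θ)
  rw [gradJ_eq M hs hG, gradJ_eq M hs hG, integral_trajLaw, integral_trajLaw,
    ← integral_sub (hint _) (hint _)]
  set x := Real.exp (H * G * ‖θ' - θ‖) * (H * (M₂ + H * G ^ 2) * ‖θ' - θ‖) with hx
  have hx0 : 0 ≤ x := by positivity
  have hbound : ∀ τ : Traj S A H, ‖π.trajDensity θ' τ • M.ret τ • π.trajScore θ' τ -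
      π.trajDensity θ τ • M.ret τ • π.trajScore θ τ‖ ≤
        π.trajDensity θ τ * (M.R / (1 - M.γ) * x) := fun τ => by
    rw [smul_comm, smul_comm _ (M.ret τ), ← smul_sub, norm_smul]
    refine (mul_le_mul (M.norm_ret_le τ) (norm_trajDensity_smul_trajScore_sub_le hs hG hM₂ θ θ' τ)
      (norm_nonneg _) ((abs_nonneg _).trans (M.norm_ret_le τ))).trans (le_of_eq ?_)
    rw [← hx]; ring
  refine (norm_integral_le_of_norm_le ((integrable_trajDensity M π H θ).mul_const _)
    (Filter.Eventually.of_forall hbound)).trans (le_of_eq ?_)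
  have h1 : ∫ τ : Traj S A H, π.trajDensity θ τ ∂(M.trajRef π.ref H) = 1 := by
    simpa using (integral_trajLaw M π θ (fun _ : Traj S A H => (1 : ℝ))).symm
  rw [integral_mul_const, h1, hx, MDP.L]
  ring

/-- The ascent lemma for the smooth objective `J`. -/
lemma le_objective (hs : LogPolicySmooth π M₂) (hG : LogPolicyGradientBound π G)
    (hM₂ : 0 ≤ M₂) (x v : Param d) :
    objective M π H x + inner ℝ (gradJ M π H x) v - M.L H G M₂ / 2 * ‖v‖ ^ 2 ≤
      objective M π H (x + v) := by
  -- The Lipschitz bound on the gradient makes the derivative of `ψ` nonnegative on (0, 1); the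
  -- claim is `ψ 0 ≤ ψ 1`.
  let ψ : ℝ → ℝ := fun s => objective M π H (x + s • v) - s * inner ℝ (gradJ M π H x) v +
    M.L H G M₂ / 2 * ‖v‖ ^ 2 * s ^ 2
  have hψ : ∀ s, HasDerivAt ψ (inner ℝ (gradJ M π H (x + s • v)) v - inner ℝ (gradJ M π H x) v +
      M.L H G M₂ * ‖v‖ ^ 2 * s) s := fun s => by
    have h1 : HasDerivAt (fun s : ℝ => x + s • v) v s := by
      simpa using ((hasDerivAt_id s).smul_const v).const_add x
    have h2 := (hasGradientAt_objective (H := H) M hs hG (x + s • v)).hasFDerivAt.comp_hasDerivAt s h1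
    have h3 := ((hasDerivAt_id s).mul_const (inner ℝ (gradJ M π H x) v))
    have h4 := (hasDerivAt_pow 2 s).const_mul (M.L H G M₂ / 2 * ‖v‖ ^ 2)
    refine ((h2.sub h3).add h4).congr_deriv ?_
    simp
    ring
  have hmono : MonotoneOn ψ (Set.Icc 0 1) := by
    refine monotoneOn_of_deriv_nonneg (convex_Icc 0 1)
      (fun s _ => (hψ s).continuousAt.continuousWithinAt)
      (fun s _ => (hψ s).differentiableAt.differentiableWithinAt) fun s hs' => ?_
    rw [interior_Icc] at hs'
    rw [(hψ s).deriv, ← inner_sub_left]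
    have h1 := abs_real_inner_le_norm (gradJ M π H (x + s • v) - gradJ M π H x) v
    have h2 := norm_gradJ_sub_le (H := H) M hs hG hM₂ x (x + s • v)
    rw [add_sub_cancel_left, norm_smul, Real.norm_eq_abs, abs_of_pos hs'.1] at h2
    have h3 := mul_le_mul_of_nonneg_right h2 (norm_nonneg v)
    have h4 := (abs_le.1 h1).1
    nlinarith
  have h := hmono (Set.left_mem_Icc.2 zero_le_one) (Set.right_mem_Icc.2 zero_le_one) zero_le_one
  simp only [ψ] at h
  simp at h
  linarith

end PolicyGradient

/-! ### Means and variances of vector-valued estimators -/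

section MeanVar

variable {Ω : Type*} [MeasurableSpace Ω] {d : ℕ}

/-- `f` is square integrable with mean `m` and variance at most `s`. -/
structure HasMeanVar (μ : Measure Ω) (f : Ω → Param d) (m : Param d) (s : ℝ) : Prop where
  memLp : MemLp f 2 μ
  mean : ∫ x, f x ∂μ = m
  var_le : ∫ x, ‖f x - m‖ ^ 2 ∂μ ≤ s

variable {μ : Measure Ω} {f : Ω → Param d} {m : Param d} {s : ℝ}

lemma HasMeanVar.mono (h : HasMeanVar μ f m s) {s' : ℝ} (hs : s ≤ s') : HasMeanVar μ f m s' :=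
  ⟨h.memLp, h.mean, h.var_le.trans hs⟩

lemma HasMeanVar.const_smul (h : HasMeanVar μ f m s) (c : ℝ) :
    HasMeanVar μ (fun x => c • f x) (c • m) (c ^ 2 * s) := by
  refine ⟨h.memLp.const_smul c, by rw [integral_smul, h.mean], ?_⟩
  simp only [← smul_sub, norm_smul, mul_pow, integral_const_mul, Real.norm_eq_abs, sq_abs]
  exact mul_le_mul_of_nonneg_left h.var_le (sq_nonneg c)

variable [IsProbabilityMeasure μ]

lemma integrable_norm_sub_sq (hf : MemLp f 2 μ) (z : Param d) :
    Integrable (fun x => ‖f x - z‖ ^ 2) μ :=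
  (hf.sub (memLp_const z)).integrable_norm_pow two_ne_zero

lemma integral_norm_sub_sq_eq (hf : MemLp f 2 μ) (z : Param d) :
    ∫ x, ‖f x - z‖ ^ 2 ∂μ = ∫ x, ‖f x‖ ^ 2 ∂μ - 2 * inner ℝ (∫ x, f x ∂μ) z + ‖z‖ ^ 2 := by
  have hi := hf.integrable one_le_two
  have h2 : Integrable (fun x => ‖f x‖ ^ 2) μ := hf.integrable_norm_pow two_ne_zero
  have h3 : Integrable (fun x => 2 * inner ℝ z (f x)) μ := (hi.const_inner z).const_mul 2
  simp only [norm_sub_sq_real, real_inner_comm z]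
  rw [integral_add (f := fun x => ‖f x‖ ^ 2 - 2 * inner ℝ z (f x)) (h2.sub h3)
    (integrable_const _), integral_sub h2 h3, integral_const_mul, integral_inner hi z]
  simp

lemma HasMeanVar.integral_norm_sub_sq_le (h : HasMeanVar μ f m s) (z : Param d) :
    ∫ x, ‖f x - z‖ ^ 2 ∂μ ≤ ‖m - z‖ ^ 2 + s := by
  have h1 := integral_norm_sub_sq_eq h.memLp z
  have h2 := integral_norm_sub_sq_eq h.memLp m
  rw [h.mean] at h1 h2
  have h3 := h.var_le
  rw [real_inner_self_eq_norm_sq] at h2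
  rw [norm_sub_sq_real]
  linarith

lemma hasMeanVar_of_integral_norm_sq_le (hf : MemLp f 2 μ) (hm : ∫ x, f x ∂μ = m)
    (hs : ∫ x, ‖f x‖ ^ 2 ∂μ ≤ s) : HasMeanVar μ f m s := by
  refine ⟨hf, hm, ?_⟩
  rw [integral_norm_sub_sq_eq hf, hm, real_inner_self_eq_norm_sq]
  nlinarith [sq_nonneg ‖m‖]

lemma HasMeanVar.const_add (h : HasMeanVar μ f m s) (c : Param d) :
    HasMeanVar μ (fun x => c + f x) (c + m) s := by
  refine ⟨(memLp_const c).add h.memLp, ?_, by simpa using h.var_le⟩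
  rw [integral_add (integrable_const _) (h.memLp.integrable one_le_two), h.mean]
  simp

/-- Reduces vector variances to coordinates, where additivity over product measures is available for
real random variables. -/
lemma integral_norm_sub_sq_eq_sum_variance (hf : MemLp f 2 μ) (hm : ∫ x, f x ∂μ = m) :
    ∫ x, ‖f x - m‖ ^ 2 ∂μ = ∑ j, Var[fun x => f x j; μ] := by
  have hj : ∀ j, MemLp (fun x => f x j) 2 μ := fun j =>
    (EuclideanSpace.proj j : Param d →L[ℝ] ℝ).comp_memLp' hf
  have hmj : ∀ j, ∫ x, f x j ∂μ = m j := fun j => by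
    rw [← hm]
    exact (EuclideanSpace.proj j : Param d →L[ℝ] ℝ).integral_comp_comm
      (hf.integrable one_le_two)
  have h1 : ∀ j, Var[fun x => f x j; μ] = ∫ x, ‖f x j - m j‖ ^ 2 ∂μ := fun j => by
    rw [variance_eq_integral (hj j).aestronglyMeasurable.aemeasurable, hmj]
    simp
  simp only [h1, EuclideanSpace.norm_sq_eq, PiLp.sub_apply]
  rw [integral_finsetSum]
  exact fun j _ => ((hj j).sub (memLp_const _)).integrable_norm_pow two_ne_zero

/-- Means and variances of independent vectors add up. -/
lemma HasMeanVar.sum_pi {ι : Type*} [Fintype ι] {Ω : ι → Type*} [∀ i, MeasurableSpace (Ω i)]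
    {μ : ∀ i, Measure (Ω i)} [∀ i, IsProbabilityMeasure (μ i)] {f : ∀ i, Ω i → Param d}
    {m : ι → Param d} {s : ι → ℝ} (h : ∀ i, HasMeanVar (μ i) (f i) (m i) (s i)) :
    HasMeanVar (Measure.pi μ) (fun ω => ∑ i, f i (ω i)) (∑ i, m i) (∑ i, s i) := by
  have hL : ∀ i, MemLp (fun ω : ∀ i, Ω i => f i (ω i)) 2 (Measure.pi μ) := fun i =>
    (h i).memLp.comp_measurePreserving (measurePreserving_eval μ i)
  have hI : ∀ i, ∫ ω, f i (ω i) ∂(Measure.pi μ) = m i := fun i => by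
    have hmap := (measurePreserving_eval μ i).map_eq
    have hae : AEStronglyMeasurable (f i) ((Measure.pi μ).map (Function.eval i)) := by
      rw [hmap]; exact (h i).memLp.aestronglyMeasurable
    rw [← (h i).mean, ← hmap, integral_map (measurable_pi_apply i).aemeasurable hae]
  have hS : MemLp (fun ω : ∀ i, Ω i => ∑ i, f i (ω i)) 2 (Measure.pi μ) :=
    memLp_finsetSum _ fun i _ => hL i
  have hM : ∫ ω, ∑ i, f i (ω i) ∂(Measure.pi μ) = ∑ i, m i := by
    rw [integral_finsetSum _ fun i _ => (hL i).integrable one_le_two]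
    exact Finset.sum_congr rfl fun i _ => hI i
  refine ⟨hS, hM, ?_⟩
  rw [integral_norm_sub_sq_eq_sum_variance hS hM]
  have hv : ∀ j, Var[fun ω : ∀ i, Ω i => (∑ i, f i (ω i)) j; Measure.pi μ] =
      ∑ i, Var[fun x => f i x j; μ i] := fun j => by
    refine Eq.trans ?_ (variance_sum_pi (fun i => (EuclideanSpace.proj j :
      Param d →L[ℝ] ℝ).comp_memLp' (h i).memLp))
    congr 1
    funext ω
    simp
  simp only [hv]
  rw [Finset.sum_comm]
  refine Finset.sum_le_sum fun i _ => ?_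
  rw [← integral_norm_sub_sq_eq_sum_variance (h i).memLp (h i).mean]
  exact (h i).var_le

lemma HasMeanVar.average (h : HasMeanVar μ f m s) {n : ℕ} (hn : 1 ≤ n) :
    HasMeanVar (Measure.pi fun _ : Fin n => μ) (fun ω => (n : ℝ)⁻¹ • ∑ i, f (ω i)) m (s / n) := by
  have hn' : (n : ℝ) ≠ 0 := by positivity
  have h1 := (HasMeanVar.sum_pi (fun _ : Fin n => h)).const_smul (n : ℝ)⁻¹
  simp only [Finset.sum_const, Finset.card_univ, Fintype.card_fin, nsmul_eq_mul] at h1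
  convert h1 using 1
  · rw [← Nat.cast_smul_eq_nsmul ℝ, smul_smul, inv_mul_cancel₀ hn', one_smul]
  · field_simp

lemma HasMeanVar.sum_smul_pi {ι : Type*} [Fintype ι] {Ω : ι → Type*} [∀ i, MeasurableSpace (Ω i)]
    {μ : ∀ i, Measure (Ω i)} [∀ i, IsProbabilityMeasure (μ i)] {f : ∀ i, Ω i → Param d}
    {m : ι → Param d} {s : ι → ℝ} (h : ∀ i, HasMeanVar (μ i) (f i) (m i) (s i)) (a : ι → ℝ) :
    HasMeanVar (Measure.pi μ) (fun ω => ∑ i, a i • f i (ω i)) (∑ i, a i • m i)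
      (∑ i, a i ^ 2 * s i) :=
  HasMeanVar.sum_pi fun i => (h i).const_smul (a i)

end MeanVar

/-! ### The single-trajectory estimators -/

section Estimators

variable {S : Type u} {A : Type v} [MeasurableSpace S] [MeasurableSpace A] {d : ℕ}
variable {π : PolicyClass S A d} {G M₂ : ℝ} {H : ℕ} (M : MDP S A)

lemma MDP.abs_discounted_reward_sub_le (h : ℕ) (s : S) (a : A) (b : ℝ) :
    |M.γ ^ h * M.reward s a - b| ≤ M.R + |b| := by
  refine (abs_sub _ _).trans (add_le_add_left ?_ _)
  rw [abs_of_nonneg (mul_nonneg (pow_nonneg M.γ_pos.le _) (M.reward_nonneg _ _))]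
  exact (mul_le_of_le_one_left (M.reward_nonneg _ _)
    (pow_le_one₀ M.γ_pos.le M.γ_lt_one.le)).trans (M.reward_le _ _)

/-- Both estimators are linear in the scores, with bounded coefficients. -/
lemma Estimator.exists_coeff (π : PolicyClass S A d) (est : Estimator H) :
    ∃ (C : ℝ) (c : Fin H → Traj S A H → ℝ), 0 ≤ C ∧ (∀ h, Measurable (c h)) ∧
      (∀ h τ, |c h τ| ≤ C) ∧
      ∀ τ θ, est.g M π τ θ = ∑ h, c h τ • π.score θ (τ h).1 (τ h).2 := by
  have hR := M.R_pos
  cases est with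
  | reinforce b =>
    have hγ : 0 < 1 - M.γ := sub_pos.2 M.γ_lt_one
    refine ⟨M.R / (1 - M.γ) + |b|, fun _ τ => M.ret τ - b, by positivity,
      fun _ => M.measurable_ret.sub_const _, fun _ τ => (abs_sub _ _).trans
      (add_le_add_left (M.norm_ret_le τ) _), fun τ θ => ?_⟩
    simp only [Estimator.g, Finset.smul_sum]
  | gpomdp b =>
    -- Exchanging the two sums: the score at time t is multiplied by all baseline-corrected rewards
    -- from time t on.
    refine ⟨∑ h, (M.R + |b h|), fun t τ => ∑ h ∈ Finset.Ici t,
      (M.γ ^ (h : ℕ) * M.reward (τ h).1 (τ h).2 - b h), by positivity,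
      fun t => Finset.measurable_sum _ fun h _ =>
        ((M.measurable_reward_apply h).const_mul _).sub_const _, fun t τ => ?_, fun τ θ => ?_⟩
    · refine (Finset.abs_sum_le_sum_abs _ _).trans ((Finset.sum_le_sum fun (h : Fin H) _ =>
        M.abs_discounted_reward_sub_le h _ _ (b h)).trans ?_)
      exact Finset.sum_le_sum_of_subset_of_nonneg (Finset.subset_univ _)
        fun h _ _ => by positivity
    · simp only [Estimator.g, Finset.smul_sum, Finset.sum_smul]
      rw [Finset.sum_comm' (t' := Finset.univ) (s' := fun t => Finset.Ici t)]
      simp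

lemma Estimator.measurable_g (hs : LogPolicySmooth π M₂) (est : Estimator H) (θ : Param d) :
    Measurable (fun τ => est.g M π τ θ) := by
  obtain ⟨C, c, -, hc, -, h⟩ := est.exists_coeff M π
  simp only [h]
  exact Finset.measurable_sum _ fun i _ => (hc i).smul
    ((measurable_score hs θ).comp (measurable_pi_apply i))

lemma Estimator.exists_norm_g_le (hG : LogPolicyGradientBound π G) (est : Estimator H) :
    ∃ C : ℝ, 0 ≤ C ∧ ∀ τ θ, ‖est.g M π τ θ‖ ≤ C := by
  obtain ⟨C, c, hC, -, hc, h⟩ := est.exists_coeff M π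
  refine ⟨∑ _ : Fin H, C * |G|, by positivity, fun τ θ => ?_⟩
  rw [h]
  refine norm_sum_le_of_le _ fun i _ => ?_
  rw [norm_smul]
  exact mul_le_mul (hc i τ) ((hG _ _ _).trans (le_abs_self G)) (norm_nonneg _) hC

lemma Estimator.exists_norm_g_sub_le (hs : LogPolicySmooth π M₂) (est : Estimator H) :
    ∃ C : ℝ, 0 ≤ C ∧ ∀ τ θ θ', ‖est.g M π τ θ - est.g M π τ θ'‖ ≤ C * ‖θ - θ'‖ := by
  obtain ⟨C, c, hC, -, hc, h⟩ := est.exists_coeff M π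
  refine ⟨∑ _ : Fin H, C * |M₂|, by positivity, fun τ θ θ' => ?_⟩
  rw [h, h, ← Finset.sum_sub_distrib, Finset.sum_mul]
  refine norm_sum_le_of_le _ fun i _ => ?_
  rw [← smul_sub, norm_smul, mul_assoc]
  refine mul_le_mul (hc i τ) ((norm_score_sub_le hs _ _ _ _).trans ?_) (norm_nonneg _) hC
  gcongr
  exact le_abs_self _

/-- Both estimators are unbiased. -/
lemma Estimator.integral_g (hs : LogPolicySmooth π M₂) (hG : LogPolicyGradientBound π G)
    (est : Estimator H) (θ : Param d) :
    ∫ τ, est.g M π τ θ ∂(trajLaw M π H θ) = gradJ M π H θ := by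
  have hret : ∀ θ, Integrable (fun τ => M.ret τ) (trajLaw M π H θ) := fun θ =>
    integrable_trajLaw_of_bound M M.measurable_ret M.norm_ret_le θ
  cases est with
  | reinforce b =>
    have h := hasGradientAt_integral_trajLaw (H := H) (f := fun τ => M.ret τ - b) M hs hG
      (M.measurable_ret.sub_const b) (c := M.R / (1 - M.γ) + |b|)
      (fun τ => (abs_sub _ _).trans (add_le_add_left (M.norm_ret_le τ) _)) θ
    have e : (fun θ => ∫ τ, (M.ret τ - b) ∂(trajLaw M π H θ)) =
        fun θ => objective M π H θ - b := by
      funext θ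
      rw [integral_sub (hret θ) (integrable_const _)]
      simp [objective]
    rw [e] at h
    -- A constant baseline only shifts the expected return by a constant, so the two gradients
    -- agree.
    exact h.unique (((hasGradientAt_objective M hs hG θ).hasFDerivAt.sub_const b))
  | gpomdp b =>
    let f : (h : Fin H) → Traj S A (h + 1) → ℝ := fun h τ =>
      M.γ ^ (h : ℕ) * M.reward (τ (Fin.last h)).1 (τ (Fin.last h)).2 - b h
    have hfm : ∀ h, Measurable (f h) := fun h =>
      ((M.measurable_reward_apply (Fin.last h)).const_mul _).sub_const _
    have hfb : ∀ h τ, |f h τ| ≤ M.R + |b h| := fun h τ =>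
      M.abs_discounted_reward_sub_le h _ _ (b h)
    have hle : ∀ h : Fin H, (h : ℕ) + 1 ≤ H := fun h => h.2
    -- The reward at time h depends on the first h + 1 pairs only. Differentiating its expectation
    -- under that marginal gives the partial score up to time h, which is the GPOMDP summand.
    have key := fun h : Fin H => (hasGradientAt_integral_restrict (H := H) M hs hG (hle h)
      (hfm h) (hfb h) θ).hasFDerivAt
    have hlast : ∀ h : Fin H, Fin.castLE (hle h) (Fin.last h) = h := fun h => Fin.ext rfl
    have hf : ∀ (h : Fin H) (τ : Traj S A H), f h (fun i => τ (Fin.castLE (hle h) i)) =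
        M.γ ^ (h : ℕ) * M.reward (τ h).1 (τ h).2 - b h := fun h τ => by
      simp only [f, hlast]
    have hscore : ∀ (h : Fin H) (τ : Traj S A H),
        π.trajScore θ (fun i : Fin (h + 1) => τ (Fin.castLE (hle h) i)) =
          ∑ t ∈ Finset.Iic h, π.score θ (τ t).1 (τ t).2 := fun h τ => by
      have himg : Finset.Iic h = Finset.univ.map (Fin.castLEEmb (hle h)) := by
        ext t
        simp only [Finset.mem_Iic, Finset.mem_map, Finset.mem_univ, true_and]
        constructor
        · intro ht
          exact ⟨⟨t, Nat.lt_succ_of_le ht⟩, Fin.ext rfl⟩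
        · rintro ⟨i, rfl⟩
          exact Nat.le_of_lt_succ i.2
      rw [himg, Finset.sum_map]
      rfl
    have hint : ∀ (h : Fin H) θ, Integrable (fun τ : Traj S A H =>
        M.γ ^ (h : ℕ) * M.reward (τ h).1 (τ h).2) (trajLaw M π H θ) := fun h θ =>
      integrable_trajLaw_of_bound M ((M.measurable_reward_apply h).const_mul _)
        (c := M.R + |0|) (fun τ => by
          simpa using M.abs_discounted_reward_sub_le h (τ h).1 (τ h).2 0) θ
    have hsum : (fun θ => ∑ h : Fin H, ∫ τ : Traj S A H,
        (M.γ ^ (h : ℕ) * M.reward (τ h).1 (τ h).2 - b h) ∂(trajLaw M π H θ)) =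
        fun θ => objective M π H θ - ∑ h, b h := by
      funext θ
      simp only [integral_sub (hint _ θ) (integrable_const _), Finset.sum_sub_distrib]
      rw [← integral_finsetSum _ fun h _ => hint h θ]
      simp [objective, MDP.ret]
    simp only [hf, hscore] at key
    have key2 := HasFDerivAt.fun_sum (u := Finset.univ) fun h _ => key h
    rw [hsum] at key2
    have huniq := key2.unique ((hasGradientAt_objective M hs hG θ).hasFDerivAt.sub_const _)
    rw [← map_sum] at huniq
    have hfin := (InnerProductSpace.toDual ℝ (Param d)).injective huniq
    rw [← hfin]
    simp only [Estimator.g]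
    refine integral_finsetSum _ fun h _ => ?_
    refine integrable_trajLaw_of_bound M (c := (M.R + |b h|) * ((h + 1 : ℕ) * G)) ?_ ?_ θ
    · exact (((M.measurable_reward_apply h).const_mul _).sub_const _).smul
        (Finset.measurable_sum _ fun t _ => (measurable_score hs θ).comp (measurable_pi_apply t))
    · intro τ
      rw [norm_smul, ← hscore]
      exact mul_le_mul (M.abs_discounted_reward_sub_le h _ _ (b h)) (norm_trajScore_le hG _ _)
        (norm_nonneg _) (add_nonneg M.R_pos.le (abs_nonneg _))

lemma Estimator.memLp_g (hs : LogPolicySmooth π M₂) (hG : LogPolicyGradientBound π G)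
    (est : Estimator H) (θ θ' : Param d) :
    MemLp (fun τ => est.g M π τ θ) 2 (trajLaw M π H θ') := by
  obtain ⟨C, -, hC⟩ := est.exists_norm_g_le M hG
  exact MemLp.of_bound (est.measurable_g M hs θ).aestronglyMeasurable C
    (Filter.Eventually.of_forall fun τ => hC τ θ)

lemma Estimator.hasMeanVar_g (hs : LogPolicySmooth π M₂) (hG : LogPolicyGradientBound π G)
    (est : Estimator H) {σ : ℝ} (hvar : EstimatorVarianceBound M π est σ) (θ : Param d) :
    HasMeanVar (trajLaw M π H θ) (fun τ => est.g M π τ θ) (gradJ M π H θ) (σ ^ 2) := by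
  refine ⟨est.memLp_g M hs hG θ θ, est.integral_g M hs hG θ, ?_⟩
  have h := hvar θ
  have hi := integrable_norm_sub_sq (est.memLp_g M hs hG θ θ) (gradJ M π H θ)
  rw [← ENNReal.ofReal_le_ofReal_iff (sq_nonneg σ),
    ofReal_integral_eq_lintegral_ofReal hi (Filter.Eventually.of_forall fun _ => sq_nonneg _)]
  refine le_trans (le_of_eq (lintegral_congr fun τ => ?_)) h
  rw [ENNReal.ofReal_pow (norm_nonneg _), ofReal_norm]

lemma PolicyClass.measurable_weight (θ θ' : Param d) :
    Measurable (fun τ : Traj S A H => π.weight τ θ θ') :=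
  (π.measurable_trajDensity θ').div (π.measurable_trajDensity θ)

lemma trajDensity_mul_weight (θ θ' : Param d) (τ : Traj S A H) :
    π.trajDensity θ τ * π.weight τ θ θ' = π.trajDensity θ' τ :=
  mul_div_cancel₀ _ (π.trajDensity_pos θ τ).ne'

lemma integral_weight_smul {E : Type*} [NormedAddCommGroup E] [NormedSpace ℝ E] (θ θ' : Param d)
    (f : Traj S A H → E) :
    ∫ τ, π.weight τ θ θ' • f τ ∂(trajLaw M π H θ) = ∫ τ, f τ ∂(trajLaw M π H θ') := by
  simp only [integral_trajLaw, smul_smul, trajDensity_mul_weight]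

/-- Square integrability is read off from the finiteness of `evariance`. The weight has mean 1, so
its variance is the second moment of its deviation from 1. -/
lemma weight_memLp_and_variance {W : ℝ} (hW : 0 ≤ W) (hw : WeightVarianceBound M π H W)
    (θ θ' : Param d) :
    MemLp (fun τ : Traj S A H => π.weight τ θ θ') 2 (trajLaw M π H θ) ∧
      ∫ τ, (π.weight τ θ θ' - 1) ^ 2 ∂(trajLaw M π H θ) ≤ W * ‖θ - θ'‖ ^ 2 := by
  have h := hw θ' θ
  have hm : Measurable (fun τ : Traj S A H => π.weight τ θ θ') := π.measurable_weight θ θ'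
  refine ⟨(evariance_lt_top_iff_memLp hm.aestronglyMeasurable).1
    (h.trans_lt ENNReal.ofReal_lt_top), ?_⟩
  have h1 : ∫ τ, π.weight τ θ θ' ∂(trajLaw M π H θ) = 1 := by
    simpa using integral_weight_smul (π := π) M θ θ' (fun _ : Traj S A H => (1 : ℝ))
  have h2 := variance_eq_integral (μ := trajLaw M π H θ) hm.aemeasurable
  rw [h1] at h2
  rw [← h2, variance, norm_sub_rev]
  exact ENNReal.toReal_le_of_le_ofReal (by positivity) h

/-- The variance of the importance sampling gradient difference. -/
lemma Estimator.exists_hasMeanVar_difference (hs : LogPolicySmooth π M₂)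
    (hG : LogPolicyGradientBound π G) (est : Estimator H) {W : ℝ} (hW : 0 ≤ W)
    (hw : WeightVarianceBound M π H W) :
    ∃ C : ℝ, 0 < C ∧ ∀ θ θ', HasMeanVar (trajLaw M π H θ)
      (fun τ => est.g M π τ θ - π.weight τ θ θ' • est.g M π τ θ')
      (gradJ M π H θ - gradJ M π H θ') (C * ‖θ - θ'‖ ^ 2) := by
  obtain ⟨C₁, hC₁, hb⟩ := est.exists_norm_g_le M hG
  obtain ⟨C₂, hC₂, hl⟩ := est.exists_norm_g_sub_le M hs
  refine ⟨2 * C₂ ^ 2 + 2 * C₁ ^ 2 * W + 1, by positivity, fun θ θ' => ?_⟩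
  obtain ⟨hwL, hwV⟩ := weight_memLp_and_variance M hW hw θ θ'
  have hw1 : MemLp (fun τ : Traj S A H => π.weight τ θ θ' - 1) 2 (trajLaw M π H θ) :=
    hwL.sub (memLp_const 1)
  have hwg : MemLp (fun τ => π.weight τ θ θ' • est.g M π τ θ') 2 (trajLaw M π H θ) := by
    refine MemLp.of_le_mul (c := C₁) hwL ((π.measurable_weight θ θ').smul
      (est.measurable_g M hs θ')).aestronglyMeasurable (Filter.Eventually.of_forall fun τ => ?_)
    rw [norm_smul, mul_comm]
    gcongr
    exact hb τ θ'
  have hg := est.memLp_g M hs hG θ θ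
  refine hasMeanVar_of_integral_norm_sq_le (hg.sub hwg) ?_ ?_
  · rw [integral_sub (hg.integrable one_le_two) (hwg.integrable one_le_two),
      integral_weight_smul, est.integral_g M hs hG, est.integral_g M hs hG]
  · have hpt : ∀ τ, ‖est.g M π τ θ - π.weight τ θ θ' • est.g M π τ θ'‖ ^ 2 ≤
        2 * C₂ ^ 2 * ‖θ - θ'‖ ^ 2 + 2 * C₁ ^ 2 * (π.weight τ θ θ' - 1) ^ 2 := fun τ => by
      -- The first part is small because g is Lipschitz in the parameter, the second because g is
      -- bounded and the weight is close to 1 in L².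
      have e : est.g M π τ θ - π.weight τ θ θ' • est.g M π τ θ' =
          (est.g M π τ θ - est.g M π τ θ') - (π.weight τ θ θ' - 1) • est.g M π τ θ' := by
        rw [sub_smul, one_smul]; abel
      have h1 : ‖est.g M π τ θ - π.weight τ θ θ' • est.g M π τ θ'‖ ≤
          C₂ * ‖θ - θ'‖ + |π.weight τ θ θ' - 1| * C₁ := by
        rw [e]
        refine (norm_sub_le _ _).trans (add_le_add (hl _ _ _) ?_)
        rw [norm_smul, Real.norm_eq_abs]
        gcongr
        exact hb τ θ'
      have h2 := pow_le_pow_left₀ (norm_nonneg _) h1 2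
      rw [← sq_abs (π.weight τ θ θ' - 1)]
      nlinarith [sq_nonneg (C₂ * ‖θ - θ'‖ - |π.weight τ θ θ' - 1| * C₁)]
    have hi1 : Integrable (fun τ : Traj S A H => 2 * C₁ ^ 2 * (π.weight τ θ θ' - 1) ^ 2)
        (trajLaw M π H θ) := hw1.integrable_sq.const_mul _
    refine (integral_mono ((hg.sub hwg).integrable_norm_pow two_ne_zero)
      ((integrable_const _).add hi1) hpt).trans ?_
    rw [integral_add' (integrable_const _) hi1, integral_const_mul (2 * C₁ ^ 2)]
    simp only [integral_const, probReal_univ, one_smul]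
    nlinarith [mul_le_mul_of_nonneg_left hwV (sq_nonneg C₁), sq_nonneg ‖θ - θ'‖]

end Estimators

/-! ### Averages, diameters and one communication step -/

section Step

variable {K d : ℕ}

lemma norm_sub_le_diam {s : Finset (Fin K)} (x : Fin K → Param d) {i l : Fin K} (hi : i ∈ s)
    (hl : l ∈ s) : ‖x i - x l‖ ≤ diam s x := by
  rw [← dist_eq_norm]
  exact Metric.dist_le_diam_of_mem ((s.finite_toSet.image x).isBounded)
    (Set.mem_image_of_mem x hi) (Set.mem_image_of_mem x hl)

lemma diam_nonneg (s : Finset (Fin K)) (x : Fin K → Param d) : 0 ≤ diam s x := Metric.diam_nonneg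

lemma diam_le {s : Finset (Fin K)} {x : Fin K → Param d} {c : ℝ} (hc : 0 ≤ c)
    (h : ∀ i ∈ s, ∀ l ∈ s, ‖x i - x l‖ ≤ c) : diam s x ≤ c := by
  refine Metric.diam_le_of_forall_dist_le hc ?_
  rintro _ ⟨i, hi, rfl⟩ _ ⟨l, hl, rfl⟩
  rw [dist_eq_norm]
  exact h i hi l hl

lemma diam_const (s : Finset (Fin K)) (z : Param d) : diam s (fun _ => z) = 0 :=
  le_antisymm (diam_le le_rfl (by simp)) (diam_nonneg _ _)

lemma avg_sub_eq {s : Finset (Fin K)} (hs : s.Nonempty) (x : Fin K → Param d) (z : Param d) :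
    avg s x - z = (s.card : ℝ)⁻¹ • ∑ i ∈ s, (x i - z) := by
  have : (s.card : ℝ) ≠ 0 := by exact_mod_cast hs.card_pos.ne'
  rw [Finset.sum_sub_distrib, smul_sub, Finset.sum_const, ← Nat.cast_smul_eq_nsmul ℝ, smul_smul,
    inv_mul_cancel₀ this, one_smul, avg]

lemma norm_avg_sub_le {s : Finset (Fin K)} (hs : s.Nonempty) {x : Fin K → Param d} {z : Param d}
    {c : ℝ} (h : ∀ i ∈ s, ‖x i - z‖ ≤ c) : ‖avg s x - z‖ ≤ c := by
  have hc : (0 : ℝ) < s.card := by exact_mod_cast hs.card_pos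
  rw [avg_sub_eq hs, norm_smul, norm_inv, Real.norm_of_nonneg hc.le, inv_mul_le_iff₀ hc]
  refine (norm_sum_le_of_le _ h).trans ?_
  simp

lemma avg_congr {s : Finset (Fin K)} {x y : Fin K → Param d} (h : ∀ i ∈ s, x i = y i) :
    avg s x = avg s y := by
  rw [avg, avg, Finset.sum_congr rfl h]

/-- The mean of `‖x i - x l‖²` over pairs of distinct indices `i, l ∈ s`. -/
def dispersion (s : Finset (Fin K)) (x : Fin K → Param d) : ℝ :=
  (∑ i ∈ s, ∑ l ∈ s, ‖x i - x l‖ ^ 2) / (s.card * (s.card - 1))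

lemma card_mul_card_sub_one_nonneg (s : Finset (Fin K)) :
    (0 : ℝ) ≤ s.card * ((s.card : ℝ) - 1) := by
  rcases Nat.eq_zero_or_pos s.card with h | h
  · simp [h]
  · have : (1 : ℝ) ≤ s.card := by exact_mod_cast h
    exact mul_nonneg (by positivity) (by linarith)

lemma dispersion_nonneg (s : Finset (Fin K)) (x : Fin K → Param d) : 0 ≤ dispersion s x :=
  div_nonneg (Finset.sum_nonneg fun _ _ => Finset.sum_nonneg fun _ _ => sq_nonneg _)
    (card_mul_card_sub_one_nonneg s)

lemma dispersion_congr {s : Finset (Fin K)} {x y : Fin K → Param d} (h : ∀ i ∈ s, x i = y i) :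
    dispersion s x = dispersion s y := by
  rw [dispersion, dispersion]
  congr 1
  exact Finset.sum_congr rfl fun i hi => Finset.sum_congr rfl fun l hl => by rw [h i hi, h l hl]

/-- The guarantee of a robust aggregator for deterministic inputs. -/
lemma IsRobustAggregator.norm_sub_sq_le {α Cra : ℝ} {agg : (Fin K → Param d) → Param d}
    (hagg : IsRobustAggregator α Cra agg) (hα : 0 ≤ α) (hC : 0 ≤ Cra) {s : Finset (Fin K)}
    (hs : (1 - α) * K ≤ s.card) (x : Fin K → Param d) :
    ‖agg x - avg s x‖ ^ 2 ≤ Cra * α * dispersion s x := by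
  -- A Dirac law turns the guarantee in expectation into a pointwise inequality, valid even for
  -- messages that depend on the honest samples.
  have h := hagg (Measure.dirac x) inferInstance s hs
  simp only [lintegral_dirac, ← ofReal_norm, ← ENNReal.ofReal_pow (norm_nonneg _)] at h
  have hs2 : ∑ i ∈ s, ∑ l ∈ s, ENNReal.ofReal (‖x i - x l‖ ^ 2) =
      ENNReal.ofReal (∑ i ∈ s, ∑ l ∈ s, ‖x i - x l‖ ^ 2) := by
    rw [ENNReal.ofReal_sum_of_nonneg fun _ _ => Finset.sum_nonneg fun _ _ => sq_nonneg _]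
    refine Finset.sum_congr rfl fun i _ => ?_
    rw [ENNReal.ofReal_sum_of_nonneg fun _ _ => sq_nonneg _]
  have h0 := card_mul_card_sub_one_nonneg s
  have h1 := dispersion_nonneg s x
  rw [hs2, ← ENNReal.ofReal_mul (by positivity)] at h
  have e : Cra * α / (s.card * (s.card - 1)) * ∑ i ∈ s, ∑ l ∈ s, ‖x i - x l‖ ^ 2 =
      Cra * α * dispersion s x := by rw [dispersion]; ring
  rw [e] at h
  exact (ENNReal.ofReal_le_ofReal_iff (by positivity)).1 h

/-- One exchange of messages. `vt` are the estimates sent by the honest agents. -/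
lemma communication_step {α εbar Cra Cavg η : ℝ} {κ : ℕ} {agg : (Fin K → Param d) → Param d}
    {P : Protocol.{w'} K d} {Hn U : Finset (Fin K)}
    (hagg : IsRobustAggregator α Cra agg) (hα : 0 ≤ α) (hε : 0 ≤ εbar) (hCra : 0 ≤ Cra)
    (hCavg : 0 ≤ Cavg) (hη : 0 < η)
    (hP : P.AveragingAgreement κ (α + εbar) Cavg Hn U) (hHn : (1 - α) * K ≤ Hn.card)
    (hne : Hn.Nonempty) (hU : Hn ⊆ U) (θ vt : Fin K → Param d) (byz : Fin K → Fin K → Param d)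
    (byz' : ℕ → Fin K → Fin K → Param d) {θn : Fin K → Param d}
    (hθn : θn = P.run κ Hn (fun k => θ k + η • agg (received Hn vt byz k)) byz') :
    (∀ k ∈ U, ‖η⁻¹ • (θn k - θ k) - avg Hn vt‖ ^ 2 ≤ 2 * (3 + 2 * Cavg) ^ 2 *
      (diam U θ ^ 2 / η ^ 2 + Cra * α * dispersion Hn vt)) ∧
    diam U θn ^ 2 / η ^ 2 ≤ (1 / 2 ^ κ) ^ 2 *
      (2 * (diam U θ ^ 2 / η ^ 2) + 8 * (Cra * α * dispersion Hn vt)) := by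
  set R := Cra * α * dispersion Hn vt with hR
  have hR0 : 0 ≤ R := by have := dispersion_nonneg Hn vt; positivity
  set r := √R with hr
  have hr0 : 0 ≤ r := Real.sqrt_nonneg _
  have hr2 : r ^ 2 = R := Real.sq_sqrt hR0
  set δ := diam U θ with hδ
  have hδ0 : 0 ≤ δ := diam_nonneg _ _
  set θt : Fin K → Param d := fun k => θ k + η • agg (received Hn vt byz k) with hθt
  have hrec : ∀ k, ∀ i ∈ Hn, received Hn vt byz k i = vt i := fun k i hi => if_pos hi
  have hv : ∀ k, ‖agg (received Hn vt byz k) - avg Hn vt‖ ≤ r := fun k => by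
    have h := hagg.norm_sub_sq_le hα hCra hHn (received Hn vt byz k)
    rw [avg_congr (hrec k), dispersion_congr (hrec k)] at h
    exact Real.le_sqrt_of_sq_le h
  have hK : (1 - (α + εbar)) * K ≤ Hn.card := by
    have : (0 : ℝ) ≤ K := by positivity
    nlinarith
  -- Taking all honest agents as the good set gives `Hn ∪ (U \ Hn) = U`. The contraction therefore
  -- concerns the same set in every iteration, although inputs are controlled only on `Hn`.
  obtain ⟨h1, h2⟩ := hP Hn (Finset.Subset.refl _) hK θt byz'
  rw [Finset.union_sdiff_of_subset hU, ← hθn] at h1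
  rw [← hθn] at h2
  have hD0 := diam_nonneg Hn θt
  have hD : diam Hn θt ≤ δ + 2 * (η * r) := by
    refine diam_le (by positivity) fun i hi l hl => ?_
    have e : θt i - θt l = (θ i - θ l) + η • ((agg (received Hn vt byz i) - avg Hn vt) -
        (agg (received Hn vt byz l) - avg Hn vt)) := by
      simp only [hθt, smul_sub]; abel
    rw [e]
    refine (norm_add_le _ _).trans (add_le_add (norm_sub_le_diam θ (hU hi) (hU hl)) ?_)
    rw [norm_smul, Real.norm_of_nonneg hη.le]
    have := (norm_sub_le (agg (received Hn vt byz i) - avg Hn vt)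
      (agg (received Hn vt byz l) - avg Hn vt)).trans (add_le_add (hv i) (hv l))
    nlinarith
  set q : ℝ := 1 / 2 ^ κ with hq
  have hq0 : 0 ≤ q := by positivity
  have hq1 : q ≤ 1 := by
    rw [hq, div_le_one (by positivity)]
    exact one_le_pow₀ (by norm_num)
  have h1' : diam U θn ≤ q * (δ + 2 * (η * r)) := by
    refine h1.trans ?_
    rw [hq, div_eq_mul_inv, one_div, mul_comm]
    gcongr
  constructor
  · intro k hk
    have ha : ‖θn k - avg Hn θn‖ ≤ diam U θn := by
      rw [norm_sub_rev]
      exact norm_avg_sub_le hne fun i hi => norm_sub_le_diam θn (hU hi) hk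
    have hb : ‖avg Hn θt - (θ k + η • avg Hn vt)‖ ≤ δ + η * r := by
      refine norm_avg_sub_le hne fun i hi => ?_
      have e : θt i - (θ k + η • avg Hn vt) = (θ i - θ k) +
          η • (agg (received Hn vt byz i) - avg Hn vt) := by
        simp only [hθt, smul_sub]; abel
      rw [e]
      refine (norm_add_le _ _).trans (add_le_add (norm_sub_le_diam θ (hU hi) hk) ?_)
      rw [norm_smul, Real.norm_of_nonneg hη.le]
      exact mul_le_mul_of_nonneg_left (hv i) hη.le
    have hc : ‖θn k - (θ k + η • avg Hn vt)‖ ≤ (3 + 2 * Cavg) * (δ + η * r) := by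
      -- Three sources of error: spread of the outputs, drift of the average in the agreement, and
      -- deviation of the inputs from the ideal step of agent `k`.
      have e : θn k - (θ k + η • avg Hn vt) = (θn k - avg Hn θn) + (avg Hn θn - avg Hn θt) +
          (avg Hn θt - (θ k + η • avg Hn vt)) := by abel
      have hηr : 0 ≤ η * r := by positivity
      rw [e]
      refine (norm_add₃_le).trans ?_
      have h3 : Cavg * diam Hn θt ≤ Cavg * (δ + 2 * (η * r)) := by gcongr
      have h4 : q * (δ + 2 * (η * r)) ≤ δ + 2 * (η * r) :=
        mul_le_of_le_one_left (by positivity) hq1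
      have h5 := mul_nonneg hCavg hδ0
      nlinarith
    have e : η⁻¹ • (θn k - θ k) - avg Hn vt = η⁻¹ • (θn k - (θ k + η • avg Hn vt)) := by
      rw [← sub_sub, smul_sub _ _ (η • _), smul_smul, inv_mul_cancel₀ hη.ne', one_smul]
    rw [e, norm_smul, norm_inv, Real.norm_of_nonneg hη.le]
    have hc2 := pow_le_pow_left₀ (norm_nonneg _) hc 2
    have hsq : (δ + η * r) ^ 2 ≤ 2 * (δ ^ 2 + η ^ 2 * R) := by
      rw [← hr2]; nlinarith [sq_nonneg (δ - η * r)]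
    calc (η⁻¹ * ‖θn k - (θ k + η • avg Hn vt)‖) ^ 2
        = (η ^ 2)⁻¹ * ‖θn k - (θ k + η • avg Hn vt)‖ ^ 2 := by rw [mul_pow, inv_pow]
      _ ≤ (η ^ 2)⁻¹ * ((3 + 2 * Cavg) ^ 2 * (2 * (δ ^ 2 + η ^ 2 * R))) := by
          gcongr
          refine hc2.trans ?_
          rw [mul_pow]
          gcongr
      _ = _ := by field_simp
  · have hc2 := pow_le_pow_left₀ (diam_nonneg _ _) h1' 2
    have hsq : (δ + 2 * (η * r)) ^ 2 ≤ 2 * δ ^ 2 + 8 * (η ^ 2 * R) := by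
      rw [← hr2]; nlinarith [sq_nonneg (δ - 2 * (η * r))]
    rw [div_le_iff₀ (by positivity)]
    refine hc2.trans ?_
    rw [mul_pow]
    calc q ^ 2 * (δ + 2 * (η * r)) ^ 2 ≤ q ^ 2 * (2 * δ ^ 2 + 8 * (η ^ 2 * R)) := by gcongr
      _ = _ := by field_simp

end Step

/-! ### Averages and dispersions of independent estimates -/

section Independent

variable {K d : ℕ} {Ω : Fin K → Type*} [∀ k, MeasurableSpace (Ω k)]
  {μ : ∀ k, Measure (Ω k)} [∀ k, IsProbabilityMeasure (μ k)] {f : ∀ k, Ω k → Param d}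
  {m : Fin K → Param d} {s : Fin K → ℝ} {Hn : Finset (Fin K)} {V Z : ℝ}

/-- Independence across honest agents divides the variance by their number; this is the source of
the speedup in `K`. Other agents get weight 0. -/
lemma HasMeanVar.avg_pi (h : ∀ k, HasMeanVar (μ k) (f k) (m k) (s k)) (hne : Hn.Nonempty)
    (hs : ∀ k ∈ Hn, s k ≤ V) :
    HasMeanVar (Measure.pi μ) (fun ω => avg Hn fun k => f k (ω k)) (avg Hn m) (V / Hn.card) := by
  have hc : (0 : ℝ) < Hn.card := by exact_mod_cast hne.card_pos
  have h1 := HasMeanVar.sum_smul_pi h fun k => if k ∈ Hn then (Hn.card : ℝ)⁻¹ else 0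
  simp only [ite_smul, zero_smul, Finset.sum_ite_mem, Finset.univ_inter, ← Finset.smul_sum,
    ite_pow, ite_mul, zero_mul, ne_eq, OfNat.ofNat_ne_zero, not_false_eq_true, zero_pow] at h1
  refine HasMeanVar.mono h1 ?_
  calc ∑ k ∈ Hn, (Hn.card : ℝ)⁻¹ ^ 2 * s k ≤ ∑ k ∈ Hn, (Hn.card : ℝ)⁻¹ ^ 2 * V :=
        Finset.sum_le_sum fun k hk => by gcongr; exact hs k hk
    _ = V / Hn.card := by rw [Finset.sum_const, nsmul_eq_mul]; field_simp

lemma HasMeanVar.integral_norm_sub_pi_sq_le (h : ∀ k, HasMeanVar (μ k) (f k) (m k) (s k))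
    {i l : Fin K} (hil : i ≠ l) :
    Integrable (fun ω : ∀ k, Ω k => ‖f i (ω i) - f l (ω l)‖ ^ 2) (Measure.pi μ) ∧
    ∫ ω, ‖f i (ω i) - f l (ω l)‖ ^ 2 ∂(Measure.pi μ) ≤ ‖m i - m l‖ ^ 2 + (s i + s l) := by
  -- A difference of two independent vectors is a weighted sum with weights 1 and −1, so its
  -- variance is the sum of the two variances.
  let a : Fin K → ℝ := Pi.single i 1 - Pi.single l 1
  have h1 := HasMeanVar.sum_smul_pi h a
  have e : ∀ x : Fin K → Param d, ∑ k, a k • x k = x i - x l := fun x => by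
    simp [a, sub_smul, Finset.sum_sub_distrib, Pi.single_apply, ite_smul]
  have e2 : ∑ k, a k ^ 2 * s k = s i + s l := by
    have : ∀ k, a k ^ 2 * s k = (if k = i then s i else 0) + if k = l then s l else 0 :=
        fun k => by
      by_cases hi : k = i
      · subst hi; simp [a, hil]
      · by_cases hl : k = l
        · subst hl; simp [a, hi]
        · simp [a, hi, hl]
    simp [this, Finset.sum_add_distrib]
  rw [e, e2] at h1
  have e3 : (fun ω : ∀ k, Ω k => ∑ k, a k • f k (ω k)) = fun ω => f i (ω i) - f l (ω l) := by
    funext ω; exact e fun k => f k (ω k)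
  rw [e3] at h1
  exact ⟨h1.memLp.integrable_norm_pow two_ne_zero,
    by simpa using h1.integral_norm_sub_sq_le 0⟩

/-- Each pair contributes at most Z + 2V. The factor 2 bounds n/(n−1) for n ≥ 2; for fewer agents
the denominator vanishes and the dispersion is 0. -/
lemma HasMeanVar.dispersion_pi (h : ∀ k, HasMeanVar (μ k) (f k) (m k) (s k)) (hV : 0 ≤ V)
    (hZ : 0 ≤ Z) (hs : ∀ k ∈ Hn, s k ≤ V) (hm : ∀ i ∈ Hn, ∀ l ∈ Hn, ‖m i - m l‖ ^ 2 ≤ Z) :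
    Integrable (fun ω : ∀ k, Ω k => dispersion Hn fun k => f k (ω k)) (Measure.pi μ) ∧
    ∫ ω, dispersion Hn (fun k => f k (ω k)) ∂(Measure.pi μ) ≤ 2 * (Z + 2 * V) := by
  have hpair : ∀ i ∈ Hn, ∀ l ∈ Hn,
      Integrable (fun ω : ∀ k, Ω k => ‖f i (ω i) - f l (ω l)‖ ^ 2) (Measure.pi μ) ∧
      ∫ ω, ‖f i (ω i) - f l (ω l)‖ ^ 2 ∂(Measure.pi μ) ≤ Z + 2 * V := fun i hi l hl => by
    rcases eq_or_ne i l with rfl | hil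
    · simp; positivity
    · obtain ⟨h1, h2⟩ := HasMeanVar.integral_norm_sub_pi_sq_le h hil
      exact ⟨h1, by linarith [hs i hi, hs l hl, hm i hi l hl]⟩
  have hint : Integrable (fun ω : ∀ k, Ω k => ∑ i ∈ Hn, ∑ l ∈ Hn, ‖f i (ω i) - f l (ω l)‖ ^ 2)
      (Measure.pi μ) :=
    integrable_finsetSum _ fun i hi => integrable_finsetSum _ fun l hl => (hpair i hi l hl).1
  refine ⟨hint.div_const _, ?_⟩
  simp only [dispersion]
  rw [integral_div, integral_finsetSum _ fun i hi => integrable_finsetSum _ fun l hl =>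
    (hpair i hi l hl).1]
  have hsum : ∑ i ∈ Hn, ∫ ω, ∑ l ∈ Hn, ‖f i (ω i) - f l (ω l)‖ ^ 2 ∂(Measure.pi μ) ≤
      Hn.card * (Hn.card * (Z + 2 * V)) := by
    refine (Finset.sum_le_card_nsmul _ _ _ fun i hi => ?_).trans_eq (nsmul_eq_mul _ _)
    rw [integral_finsetSum _ fun l hl => (hpair i hi l hl).1]
    exact (Finset.sum_le_card_nsmul _ _ _ fun l hl => (hpair i hi l hl).2).trans_eq
      (nsmul_eq_mul _ _)
  rcases Nat.lt_or_ge Hn.card 2 with hc | hc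
  · have : (Hn.card : ℝ) * (Hn.card - 1) = 0 := by
      interval_cases Hn.card <;> simp
    rw [this, div_zero]
    positivity
  · have hc' : (2 : ℝ) ≤ Hn.card := by exact_mod_cast hc
    rw [div_le_iff₀ (by nlinarith)]
    refine hsum.trans ?_
    have : 0 ≤ Z + 2 * V := by positivity
    have h2 : (Hn.card : ℝ) ≤ 2 * (Hn.card - 1) := by linarith
    have h3 := mul_le_mul_of_nonneg_left h2 (mul_nonneg (by linarith : (0 : ℝ) ≤ Hn.card) this)
    linarith

end Independent

/-! ### Two tools for the drift: integration of affine bounds, and Young's inequality. -/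

lemma lintegral_ofReal_le_of_le {Ω : Type*} [MeasurableSpace Ω] {μ : Measure Ω}
    [IsProbabilityMeasure μ] {F f g : Ω → ℝ} {a b c f' g' : ℝ} (hF : ∀ ω, 0 ≤ F ω)
    (h : ∀ ω, F ω ≤ c + a * f ω + b * g ω) (hf : Integrable f μ) (hg : Integrable g μ)
    (ha : 0 ≤ a) (hb : 0 ≤ b) (hf' : ∫ ω, f ω ∂μ ≤ f') (hg' : ∫ ω, g ω ∂μ ≤ g') :
    ∫⁻ ω, ENNReal.ofReal (F ω) ∂μ ≤ ENNReal.ofReal (c + a * f' + b * g') := by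
  have hi1 : Integrable (fun ω => c + a * f ω) μ := (integrable_const c).add (hf.const_mul a)
  have hi : Integrable (fun ω => c + a * f ω + b * g ω) μ := hi1.add (hg.const_mul b)
  refine (lintegral_mono fun ω => ENNReal.ofReal_le_ofReal (h ω)).trans ?_
  rw [← ofReal_integral_eq_lintegral_ofReal hi
    (Filter.Eventually.of_forall fun ω => (hF ω).trans (h ω))]
  refine ENNReal.ofReal_le_ofReal ?_
  rw [integral_add hi1 (hg.const_mul b), integral_add (integrable_const c) (hf.const_mul a),
    integral_const_mul, integral_const_mul]
  simp only [integral_const, probReal_univ, one_smul]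
  gcongr

/-- The free parameter is 1 for large batches. For small batches it is p/8, so that two applications
inflate the old error by at most 1 + p/2. -/
lemma norm_add_sq_le_mul {E : Type*} [NormedAddCommGroup E] {r : ℝ} (hr : 0 < r) (x y : E) :
    ‖x + y‖ ^ 2 ≤ (1 + r) * ‖x‖ ^ 2 + (1 + 1 / r) * ‖y‖ ^ 2 := by
  have h := pow_le_pow_left₀ (norm_nonneg _) (norm_add_le x y) 2
  have h2 : 2 * (‖x‖ * ‖y‖) ≤ r * ‖x‖ ^ 2 + 1 / r * ‖y‖ ^ 2 := by
    have h3 : r * ‖x‖ ^ 2 + 1 / r * ‖y‖ ^ 2 - 2 * (‖x‖ * ‖y‖) = (r * ‖x‖ - ‖y‖) ^ 2 / r := by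
      field_simp; ring
    have h4 : 0 ≤ (r * ‖x‖ - ‖y‖) ^ 2 / r := by positivity
    linarith
  nlinarith

/-! ### The potential function and its drift -/

section Drift

variable {S : Type u} {A : Type v} [MeasurableSpace S] [MeasurableSpace A] {d H K : ℕ}

/-- The assumptions that hold in every iteration, for honest agents `Hn ⊆ U`. -/
structure StepAssumptions (M : MDP S A) (π : PolicyClass S A d) (est : Estimator H)
    (G M₂ σ Cra Cavg Cy α εbar η : ℝ) (κ : ℕ) (agg : (Fin K → Param d) → Param d)
    (P : Protocol.{w'} K d) (Hn U : Finset (Fin K)) : Prop where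
  smooth : LogPolicySmooth π M₂
  grad : LogPolicyGradientBound π G
  M₂_nonneg : 0 ≤ M₂
  variance : EstimatorVarianceBound M π est σ
  difference : ∀ θ θ', HasMeanVar (trajLaw M π H θ)
      (fun τ => est.g M π τ θ - π.weight τ θ θ' • est.g M π τ θ')
      (gradJ M π H θ - gradJ M π H θ') (Cy * ‖θ - θ'‖ ^ 2)
  Cy_nonneg : 0 ≤ Cy
  Cra_nonneg : 0 ≤ Cra
  Cavg_nonneg : 0 ≤ Cavg
  α_nonneg : 0 ≤ α
  α_le : α ≤ 1 / 4
  εbar_nonneg : 0 ≤ εbar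
  η_pos : 0 < η
  L_pos : 0 < M.L H G M₂
  η_le : η * (2 * M.L H G M₂) ≤ 1
  K_pos : 1 ≤ K
  card_le : (1 - α) * K ≤ Hn.card
  subset : Hn ⊆ U
  robust : IsRobustAggregator α Cra agg
  agreement : P.AveragingAgreement κ (α + εbar) Cavg Hn U

variable {M : MDP S A} {π : PolicyClass S A d} {est : Estimator H}
  {G M₂ σ Cra Cavg Cy α εbar η p ν : ℝ} {κ : ℕ} {agg : (Fin K → Param d) → Param d}
  {P : Protocol.{w'} K d} {Hn U : Finset (Fin K)}

/-- The effective update direction of agent `u`. -/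
def direction (η : ℝ) (u : Fin K) (θ' θ : Fin K → Param d) : Param d := η⁻¹ • (θ u - θ' u)

/-- The squared error of the effective update direction of agent `u`. -/
def directionError (M : MDP S A) (π : PolicyClass S A d) (H : ℕ) (η : ℝ) (u : Fin K)
    (θ' θ : Fin K → Param d) : ℝ := ‖direction η u θ' θ - gradJ M π H (θ' u)‖ ^ 2

/-- The squared disagreement of the agents in `U`, in units of the step size. -/
def disagreement (U : Finset (Fin K)) (η : ℝ) (θ : Fin K → Param d) : ℝ := diam U θ ^ 2 / η ^ 2

/-- The potential function. -/
def potential (M : MDP S A) (π : PolicyClass S A d) (H : ℕ) (η p ν : ℝ) (U : Finset (Fin K))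
    (u : Fin K) (θ' θ : Fin K → Param d) : ℝ :=
  M.R / (1 - M.γ) - objective M π H (θ u) + η / p * directionError M π H η u θ' θ +
    η / 4 * ‖direction η u θ' θ‖ ^ 2 + 2 * (η * ν) * disagreement U η θ +
    η * ν * disagreement U η θ'

lemma directionError_nonneg (u : Fin K) (θ' θ : Fin K → Param d) :
    0 ≤ directionError M π H η u θ' θ := sq_nonneg _

lemma disagreement_nonneg (θ : Fin K → Param d) : 0 ≤ disagreement U η θ := by
  unfold disagreement; positivity

lemma potential_nonneg (hη : 0 < η) (hp : 0 < p) (hν : 0 ≤ ν) (u : Fin K)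
    (θ' θ : Fin K → Param d) : 0 ≤ potential M π H η p ν U u θ' θ := by
  have h1 : 0 ≤ M.R / (1 - M.γ) - objective M π H (θ u) := sub_nonneg.2 (objective_le M _)
  have h2 := directionError_nonneg (M := M) (π := π) (H := H) (η := η) u θ' θ
  have h3 := disagreement_nonneg (U := U) (η := η) θ
  have h4 := disagreement_nonneg (U := U) (η := η) θ'
  unfold potential
  positivity

namespace StepAssumptions

lemma nonempty (h : StepAssumptions M π est G M₂ σ Cra Cavg Cy α εbar η κ agg P Hn U) :
    Hn.Nonempty := by
  have h1 := h.card_le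
  have h2 : (1 : ℝ) ≤ K := by exact_mod_cast h.K_pos
  have h3 := h.α_le
  have : (0 : ℝ) < Hn.card := by nlinarith
  exact Finset.card_pos.1 (by exact_mod_cast this)

lemma inv_card_le (h : StepAssumptions M π est G M₂ σ Cra Cavg Cy α εbar η κ agg P Hn U) :
    1 / (Hn.card : ℝ) ≤ 4 / 3 * (1 / K) := by
  have h1 := h.card_le
  have h2 : (1 : ℝ) ≤ K := by exact_mod_cast h.K_pos
  have h3 := h.α_le
  have hc : 3 / 4 * (K : ℝ) ≤ Hn.card := by nlinarith
  calc 1 / (Hn.card : ℝ) ≤ 1 / (3 / 4 * (K : ℝ)) := by gcongr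
    _ = _ := by field_simp

lemma one_div_card_le (h : StepAssumptions M π est G M₂ σ Cra Cavg Cy α εbar η κ agg P Hn U) :
    1 / (Hn.card : ℝ) ≤ 1 := by
  have : (1 : ℝ) ≤ Hn.card := by exact_mod_cast h.nonempty.card_pos
  rw [div_le_one (by linarith)]; exact this

/-- One step of gradient ascent in direction `direction η u θ θn`. -/
lemma descent (h : StepAssumptions M π est G M₂ σ Cra Cavg Cy α εbar η κ agg P Hn U)
    (u : Fin K) (θ θn : Fin K → Param d) :
    objective M π H (θ u) + η / 2 * ‖gradJ M π H (θ u)‖ ^ 2 +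
      η / 4 * ‖direction η u θ θn‖ ^ 2 - η / 2 * directionError M π H η u θ θn ≤
      objective M π H (θn u) := by
  have hη := h.η_pos
  set g := gradJ M π H (θ u)
  have h1 := le_objective (H := H) M h.smooth h.grad h.M₂_nonneg (θ u) (η • direction η u θ θn)
  have e : θ u + η • direction η u θ θn = θn u := by
    rw [direction, smul_smul, mul_inv_cancel₀ hη.ne', one_smul, add_sub_cancel]
  rw [e, inner_smul_right, norm_smul, mul_pow, Real.norm_of_nonneg hη.le] at h1
  have h2 : directionError M π H η u θ θn = ‖direction η u θ θn‖ ^ 2 -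
      2 * inner ℝ g (direction η u θ θn) + ‖g‖ ^ 2 := by
    rw [directionError, norm_sub_sq_real, real_inner_comm]
  have h3 : M.L H G M₂ / 2 * (η ^ 2 * ‖direction η u θ θn‖ ^ 2) ≤
      η / 4 * ‖direction η u θ θn‖ ^ 2 := by
    have := mul_le_mul_of_nonneg_left h.η_le (mul_nonneg hη.le (sq_nonneg ‖direction η u θ θn‖))
    linarith
  rw [h2]
  linarith

/-- The term η/4 ‖d‖² in the new potential cancels against the same gain in the ascent step, so the
new direction enters only through its error. -/
lemma potential_le (h : StepAssumptions M π est G M₂ σ Cra Cavg Cy α εbar η κ agg P Hn U)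
    (u : Fin K) (θ θn : Fin K → Param d) :
    potential M π H η p ν U u θ θn ≤ M.R / (1 - M.γ) - objective M π H (θ u) -
      η / 2 * ‖gradJ M π H (θ u)‖ ^ 2 + η * ν * disagreement U η θ +
      (η / 2 + η / p) * directionError M π H η u θ θn + 2 * (η * ν) * disagreement U η θn := by
  have := h.descent u θ θn
  unfold potential
  linarith

/-- Since 2ηL ≤ 1, gradients at different agents differ by at most half the disagreement measured in
units of η. -/
lemma norm_gradJ_sub_le (h : StepAssumptions M π est G M₂ σ Cra Cavg Cy α εbar η κ agg P Hn U)
    (θ : Fin K → Param d) {i l : Fin K} (hi : i ∈ U) (hl : l ∈ U) :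
    ‖gradJ M π H (θ i) - gradJ M π H (θ l)‖ ≤ diam U θ / η / 2 := by
  refine (DecByzPG.norm_gradJ_sub_le M h.smooth h.grad h.M₂_nonneg _ _).trans ?_
  have h1 := norm_sub_le_diam θ hi hl
  have h2 := h.η_pos
  have hL := h.L_pos
  calc M.L H G M₂ * ‖θ i - θ l‖ ≤ M.L H G M₂ * diam U θ := by gcongr
    _ = (η * (2 * M.L H G M₂)) * (diam U θ / η / 2) := by field_simp
    _ ≤ 1 * (diam U θ / η / 2) := by
        have := diam_nonneg U θ
        gcongr
        exact h.η_le
    _ = _ := one_mul _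

/-- The estimates of the agents, seen as independent vectors with means `m k`, give the expected
change of the potential. -/
lemma lintegral_potential_le
    (h : StepAssumptions M π est G M₂ σ Cra Cavg Cy α εbar η κ agg P Hn U)
    {u : Fin K} (hu : u ∈ U) (hp : 0 < p) (hν : 0 ≤ ν) {r : ℝ} (hr : 0 < r)
    {Ω : Fin K → Type*} [∀ k, MeasurableSpace (Ω k)]
    {μ : ∀ k, Measure (Ω k)} [∀ k, IsProbabilityMeasure (μ k)] {f : ∀ k, Ω k → Param d}
    {m : Fin K → Param d} {s : Fin K → ℝ} {V Z Y : ℝ}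
    (hf : ∀ k, HasMeanVar (μ k) (f k) (m k) (s k)) (hV : 0 ≤ V) (hZ : 0 ≤ Z)
    (hs : ∀ k ∈ Hn, s k ≤ V) (hm : ∀ i ∈ Hn, ∀ l ∈ Hn, ‖m i - m l‖ ^ 2 ≤ Z)
    (θ : Fin K → Param d) (hY : ‖avg Hn m - gradJ M π H (θ u)‖ ^ 2 ≤ Y)
    (next : (∀ k, Ω k) → Fin K → Param d)
    (byz : (∀ k, Ω k) → Fin K → Fin K → Param d)
    (byz' : (∀ k, Ω k) → ℕ → Fin K → Fin K → Param d)
    (hnext : ∀ ω, next ω = P.run κ Hn (fun k => θ k + η • agg (received Hn (fun k => f k (ω k))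
      (byz ω) k)) (byz' ω)) :
    ∫⁻ ω, ENNReal.ofReal (potential M π H η p ν U u θ (next ω)) ∂(Measure.pi μ) ≤
      ENNReal.ofReal (M.R / (1 - M.γ) - objective M π H (θ u) -
        η / 2 * ‖gradJ M π H (θ u)‖ ^ 2 + η * ν * disagreement U η θ +
        (η / 2 + η / p) * ((1 + r) * (Y + V / Hn.card) + (1 + 1 / r) * (2 * (3 + 2 * Cavg) ^ 2 *
          (disagreement U η θ + Cra * α * (2 * (Z + 2 * V))))) +
        2 * (η * ν) * ((1 / 2 ^ κ) ^ 2 *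
          (2 * disagreement U η θ + 8 * (Cra * α * (2 * (Z + 2 * V)))))) := by
  have hη := h.η_pos
  have hCra := h.Cra_nonneg
  have hα := h.α_nonneg
  have hA := HasMeanVar.avg_pi hf h.nonempty hs
  obtain ⟨hD, hD'⟩ := HasMeanVar.dispersion_pi hf hV hZ hs hm
  set c4 := 2 * (3 + 2 * Cavg) ^ 2 with hc4
  set q := ((1 : ℝ) / 2 ^ κ) ^ 2 with hq
  set Δ := disagreement U η θ with hΔ
  set c0 := M.R / (1 - M.γ) - objective M π H (θ u) -
        η / 2 * ‖gradJ M π H (θ u)‖ ^ 2 + η * ν * Δ with hc0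
  -- The new potential is dominated by an affine function of two random quantities with known mean
  -- bounds: the squared error of the honest average, and the dispersion of the honest estimates.
  refine (lintegral_ofReal_le_of_le (f' := Y + V / Hn.card) (g' := 2 * (Z + 2 * V))
    (c := c0 + (η / 2 + η / p) * ((1 + 1 / r) * (c4 * Δ)) + 2 * (η * ν) * (q * (2 * Δ)))
    (a := (η / 2 + η / p) * (1 + r))
    (b := (η / 2 + η / p) * ((1 + 1 / r) * (c4 * (Cra * α))) +
      2 * (η * ν) * (q * (8 * (Cra * α))))
    (fun ω => potential_nonneg hη hp hν u θ (next ω)) (fun ω => ?_)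
    (integrable_norm_sub_sq hA.memLp (gradJ M π H (θ u))) hD (by positivity) (by positivity)
    ((hA.integral_norm_sub_sq_le _).trans (by gcongr)) hD').trans (le_of_eq ?_)
  · obtain ⟨h1, h2⟩ := communication_step h.robust hα h.εbar_nonneg hCra h.Cavg_nonneg hη
      h.agreement h.card_le h.nonempty h.subset θ (fun k => f k (ω k)) (byz ω) (byz' ω) (hnext ω)
    have h1u := h1 u hu
    have h3 := h.potential_le (p := p) (ν := ν) u θ (next ω)
    change disagreement U η (next ω) ≤ q * (2 * Δ + 8 * _) at h2
    change _ ≤ c4 * (Δ + _) at h1u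
    change _ ≤ c0 + _ + _ at h3
    have h4 : directionError M π H η u θ (next ω) ≤
        (1 + r) * ‖avg Hn (fun k => f k (ω k)) - gradJ M π H (θ u)‖ ^ 2 + (1 + 1 / r) *
          (c4 * (Δ + Cra * α * dispersion Hn fun k => f k (ω k))) := by
      -- The direction error splits into the statistical error of the honest average and the
      -- communication error.
      have h5 := norm_add_sq_le_mul hr (avg Hn (fun k => f k (ω k)) - gradJ M π H (θ u))
        (η⁻¹ • (next ω u - θ u) - avg Hn fun k => f k (ω k))
      rw [show avg Hn (fun k => f k (ω k)) - gradJ M π H (θ u) +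
        (η⁻¹ • (next ω u - θ u) - avg Hn fun k => f k (ω k)) =
          direction η u θ (next ω) - gradJ M π H (θ u) by rw [direction]; abel] at h5
      refine h5.trans ?_
      gcongr
    have h6 := mul_le_mul_of_nonneg_left h4 (by positivity : 0 ≤ η / 2 + η / p)
    have h7 := mul_le_mul_of_nonneg_left h2 (by positivity : 0 ≤ 2 * (η * ν))
    refine h3.trans ((add_le_add (add_le_add_right h6 _) h7).trans (le_of_eq ?_))
    ring
  · congr 1
    ring

end StepAssumptions

end Drift

/-! ### Conditional drift for large and for small batches. -/

section BatchDrift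

variable {S : Type u} {A : Type v} [MeasurableSpace S] [MeasurableSpace A] {d H K N B : ℕ}
variable {M : MDP S A} {π : PolicyClass S A d} {est : Estimator H}
  {G M₂ σ Cra Cavg Cy α εbar η p ν : ℝ} {κ : ℕ} {agg : (Fin K → Param d) → Param d}
  {P : Protocol.{w'} K d} {Hn U : Finset (Fin K)}

/-- Here n, h and k stand for 1/N, the inverse number of honest agents and 1/K. The bound h ≤ 4k/3
reflects α ≤ 1/4. -/
lemma large_batch_error_le {c Cra σ α Δ n h k : ℝ} (hc : 0 ≤ c) (hCra : 0 ≤ Cra) (hα : 0 ≤ α)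
    (hα' : α ≤ 1 / 4) (hΔ : 0 ≤ Δ) (hn : 0 ≤ n) (hhk : h ≤ 4 / 3 * k) (hk : 0 ≤ k) :
    (1 + 1) * (Δ / 4 + σ ^ 2 * n * h) + (1 + 1 / 1) * (c *
      (Δ + Cra * α * (2 * (Δ / 4 + 2 * (σ ^ 2 * n))))) ≤
      (1 + 2 * c + c * Cra) * Δ + (3 + 8 * (c * Cra)) * σ ^ 2 * ((k + α) * n) := by
  have hs : 0 ≤ σ ^ 2 * n := by positivity
  have h1 := mul_le_mul_of_nonneg_left hhk hs
  have h2 : 0 ≤ c * Cra * Δ := by positivity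
  have h3 := mul_le_mul_of_nonneg_left hα' h2
  have h4 : 0 ≤ c * Cra * (σ ^ 2 * n) * k := by positivity
  have h5 : 0 ≤ σ ^ 2 * n * α := by positivity
  have h6 : 0 ≤ σ ^ 2 * n * k := by positivity
  nlinarith

lemma large_batch_disagreement_le {Cra σ α Δ n : ℝ} (hCra : 0 ≤ Cra)
    (hα' : α ≤ 1 / 4) (hΔ : 0 ≤ Δ) (hn : 0 ≤ n) (hn1 : n ≤ 1) :
    2 * Δ + 8 * (Cra * α * (2 * (Δ / 4 + 2 * (σ ^ 2 * n)))) ≤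
      (2 + Cra) * Δ + 8 * (Cra * σ ^ 2) := by
  have h1 := mul_le_mul_of_nonneg_left hα' (mul_nonneg hCra hΔ)
  have h2 := mul_le_mul_of_nonneg_left hα' (mul_nonneg hCra (mul_nonneg (sq_nonneg σ) hn))
  have h3 := mul_le_mul_of_nonneg_left hn1 (mul_nonneg hCra (sq_nonneg σ))
  nlinarith

/-- Here e is the old direction error, s the squared direction, D the disagreement at both times and
V the variance of one agent. The four estimates treat the inherited error, the differing means, the
variance of the average, and the communication error. The last one carries 9/p from Young's
inequality and is the source of α/p. -/
lemma small_batch_error_le {p e D Δ V h k c Cra α Cy c' η s : ℝ} (hp : 0 < p) (hp1 : p ≤ 1)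
    (he : 0 ≤ e) (hΔD : Δ ≤ D) (hΔ : 0 ≤ Δ) (hc : 0 ≤ c) (hCra : 0 ≤ Cra) (hα : 0 ≤ α)
    (hα' : α ≤ 1 / 4) (hhk : h ≤ 4 / 3 * k) (h0 : 0 ≤ h) (h1 : h ≤ 1) (hCy : 0 ≤ Cy)
    (hs : 0 ≤ s) (hc' : Cy * η ^ 2 ≤ c') (hV : V = 3 * (Cy * η ^ 2) * (s + D)) :
    (1 + p / 8) * ((1 + p / 8) * e + 9 / p * (9 / 2 * D) + V * h) +
      (1 + 1 / (p / 8)) * (c * (Δ + Cra * α * (2 * (9 / 2 * D + 2 * V)))) ≤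
    (1 + p / 2) * e + (5 * Cy + 108 * (c * Cra * Cy)) * (k + α / p) * (η ^ 2 * s) +
      (51 + 5 * c' + 9 * c * (1 + 3 * Cra * (1 + c'))) / p * D := by
  have hD : 0 ≤ D := hΔ.trans hΔD
  have hp' : 1 ≤ 1 / p := by rw [le_div_iff₀ hp]; linarith
  have ht : 0 ≤ Cy * η ^ 2 := by positivity
  have hc'0 : 0 ≤ c' := ht.trans hc'
  have hk : 0 ≤ k := by linarith
  have A1 : (1 + p / 8) * ((1 + p / 8) * e) ≤ (1 + p / 2) * e := by
    have : (1 + p / 8) * (1 + p / 8) ≤ 1 + p / 2 := by nlinarith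
    have := mul_le_mul_of_nonneg_right this he
    linarith
  have A2 : (1 + p / 8) * (9 / p * (9 / 2 * D)) ≤ 46 / p * D := by
    calc (1 + p / 8) * (9 / p * (9 / 2 * D)) ≤ (9 / 8) * (9 / p * (9 / 2 * D)) := by
          gcongr; linarith
      _ = 729 / 16 * (1 / p * D) := by ring
      _ ≤ 46 * (1 / p * D) := by gcongr; norm_num
      _ = _ := by ring
  have A3 : (1 + p / 8) * (V * h) ≤ 5 * Cy * k * (η ^ 2 * s) + 5 * c' / p * D := by
    calc (1 + p / 8) * (V * h) ≤ 9 / 8 * (V * h) := by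
          have : 0 ≤ V := by rw [hV]; positivity
          gcongr; linarith
      _ = 27 / 8 * (Cy * η ^ 2 * s * h) + 27 / 8 * (Cy * η ^ 2 * (h * D)) := by rw [hV]; ring
      _ ≤ 27 / 8 * (Cy * η ^ 2 * s * (4 / 3 * k)) + 27 / 8 * (c' * (1 / p * D)) := by
          gcongr
          exact h1.trans hp'
      _ ≤ _ := by
          have g1 : 0 ≤ Cy * η ^ 2 * s * k := by positivity
          have g2 : 0 ≤ c' * (1 / p * D) := by positivity
          have g3 : 5 * c' / p * D = 5 * (c' * (1 / p * D)) := by ring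
          rw [g3]; linarith
  have A4 : (1 + 1 / (p / 8)) * (c * (Δ + Cra * α * (2 * (9 / 2 * D + 2 * V)))) ≤
      108 * (c * Cra * Cy) * (α / p) * (η ^ 2 * s) + 9 * c * (1 + 3 * Cra * (1 + c')) / p * D := by
    have e1 : 1 + 1 / (p / 8) ≤ 9 / p := by
      rw [one_div_div]
      calc 1 + 8 / p ≤ 1 / p + 8 / p := by gcongr
        _ = 9 / p := by ring
    calc (1 + 1 / (p / 8)) * (c * (Δ + Cra * α * (2 * (9 / 2 * D + 2 * V))))
        ≤ 9 / p * (c * (D + Cra * α * (2 * (9 / 2 * D + 2 * V)))) := by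
          have : 0 ≤ V := by rw [hV]; positivity
          gcongr
      _ = 108 * (c * Cra * Cy) * (α / p) * (η ^ 2 * s) +
          9 * (c / p * (D + 9 * (Cra * D) * α + 12 * (Cra * (Cy * η ^ 2) * D) * α)) := by
          rw [hV]; field_simp; ring
      _ ≤ 108 * (c * Cra * Cy) * (α / p) * (η ^ 2 * s) +
          9 * (c / p * (D + 9 * (Cra * D) * (1 / 4) + 12 * (Cra * c' * D) * (1 / 4))) := by
          gcongr
      _ ≤ 108 * (c * Cra * Cy) * (α / p) * (η ^ 2 * s) +
          9 * (c / p * (D + 3 * (Cra * D) + 3 * (Cra * c' * D))) := by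
          have g1 : 0 ≤ Cra * D := by positivity
          have g2 : 0 ≤ Cra * c' * D := by positivity
          refine add_le_add le_rfl (mul_le_mul_of_nonneg_left
            (mul_le_mul_of_nonneg_left ?_ (by positivity)) (by norm_num))
          linarith
      _ = _ := by ring
  have e2 : (51 + 5 * c' + 9 * c * (1 + 3 * Cra * (1 + c'))) / p * D = 51 / p * D + 5 * c' / p * D +
      9 * c * (1 + 3 * Cra * (1 + c')) / p * D := by ring
  have e3 : 46 / p * D ≤ 51 / p * D := by gcongr; norm_num
  have e4 : (5 * Cy + 108 * (c * Cra * Cy)) * (k + α / p) * (η ^ 2 * s) =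
      5 * Cy * k * (η ^ 2 * s) + 108 * (c * Cra * Cy) * (α / p) * (η ^ 2 * s) +
        (5 * Cy * (α / p) * (η ^ 2 * s) + 108 * (c * Cra * Cy) * k * (η ^ 2 * s)) := by ring
  have e5 : 0 ≤ 5 * Cy * (α / p) * (η ^ 2 * s) + 108 * (c * Cra * Cy) * k * (η ^ 2 * s) := by
    positivity
  rw [e2, e4]
  linarith

lemma small_batch_disagreement_le {D Δ V Cra α Cy c' η s : ℝ}
    (hΔD : Δ ≤ D) (hΔ : 0 ≤ Δ) (hCra : 0 ≤ Cra) (hα' : α ≤ 1 / 4) (hCy : 0 ≤ Cy)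
    (hs : 0 ≤ s) (hc' : Cy * η ^ 2 ≤ c') (hV : V = 3 * (Cy * η ^ 2) * (s + D)) :
    2 * Δ + 8 * (Cra * α * (2 * (9 / 2 * D + 2 * V))) ≤
      (2 + 2 * Cra * (10 + 12 * c')) * D + 24 * (Cra * Cy) * (η ^ 2 * s) := by
  have hD : 0 ≤ D := hΔ.trans hΔD
  have ht : 0 ≤ Cy * η ^ 2 := by positivity
  have hV0 : 0 ≤ V := by rw [hV]; positivity
  have h1 : Cra * α * (2 * (9 / 2 * D + 2 * V)) ≤ Cra * (1 / 4) * (2 * (9 / 2 * D + 2 * V)) := by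
    gcongr
  have h2 : Cra * (Cy * η ^ 2) * D ≤ Cra * c' * D := by gcongr
  have h3 : 0 ≤ Cra * D := by positivity
  rw [hV] at h1 ⊢
  nlinarith

namespace StepAssumptions

/-- Conditional drift of the potential in an iteration with a large batch. -/
lemma large_batch (h : StepAssumptions M π est G M₂ σ Cra Cavg Cy α εbar η κ agg P Hn U)
    {u : Fin K} (hu : u ∈ U) (hp : 0 < p) (hν : 0 ≤ ν) (hN : 1 ≤ N)
    (θ' θ : Fin K → Param d) (byz : Batch S A H K N B → Fin K → Fin K → Param d)
    (byz' : Batch S A H K N B → ℕ → Fin K → Fin K → Param d) :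
    ∫⁻ τ, ENNReal.ofReal (potential M π H η p ν U u θ
        (nextParams M π est η κ agg P Hn (byz (Sum.inl τ)) (byz' (Sum.inl τ)) θ' θ
          (Sum.inl τ : Batch S A H K N B)))
        ∂(Measure.pi fun k => Measure.pi fun _ : Fin N => trajLaw M π H (θ k)) ≤
      ENNReal.ofReal (M.R / (1 - M.γ) - objective M π H (θ u) -
        η / 2 * ‖gradJ M π H (θ u)‖ ^ 2 + η * ν * disagreement U η θ +
        (η / 2 + η / p) * ((1 + 2 * (2 * (3 + 2 * Cavg) ^ 2) + 2 * (3 + 2 * Cavg) ^ 2 * Cra) *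
            disagreement U η θ + (3 + 8 * (2 * (3 + 2 * Cavg) ^ 2 * Cra)) * σ ^ 2 *
              ((1 / K + α) * (1 / N))) +
        2 * (η * ν) * ((1 / 2 ^ κ) ^ 2 * ((2 + Cra) * disagreement U η θ +
          8 * (Cra * σ ^ 2)))) := by
  have hη := h.η_pos
  have hN' : (1 : ℝ) ≤ N := by exact_mod_cast hN
  have hΔ := disagreement_nonneg (U := U) (η := η) θ
  have hsq : (diam U θ / η / 2) ^ 2 = disagreement U η θ / 4 := by
    rw [disagreement]; field_simp; ring
  have hgrad : ∀ i ∈ U, ∀ l ∈ U, ‖gradJ M π H (θ i) - gradJ M π H (θ l)‖ ^ 2 ≤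
      disagreement U η θ / 4 := fun i hi l hl => by
    rw [← hsq]
    exact pow_le_pow_left₀ (norm_nonneg _) (h.norm_gradJ_sub_le θ hi hl) 2
  have key := h.lintegral_potential_le (p := p) (ν := ν) hu hp hν one_pos
    (V := σ ^ 2 / N) (Z := disagreement U η θ / 4) (Y := disagreement U η θ / 4)
    (fun k => (est.hasMeanVar_g M h.smooth h.grad h.variance (θ k)).average hN)
    (by positivity) (by positivity) (fun k _ => le_rfl)
    (fun i hi l hl => hgrad i (h.subset hi) l (h.subset hl)) θ
    (by
      rw [← hsq]
      exact pow_le_pow_left₀ (norm_nonneg _) (norm_avg_sub_le h.nonempty fun i hi =>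
        h.norm_gradJ_sub_le θ (h.subset hi) hu) 2)
    (fun τ => nextParams M π est η κ agg P Hn (byz (Sum.inl τ)) (byz' (Sum.inl τ)) θ' θ
          (Sum.inl τ : Batch S A H K N B))
    (fun τ => byz (Sum.inl τ)) (fun τ => byz' (Sum.inl τ)) (fun τ => rfl)
  refine key.trans (ENNReal.ofReal_le_ofReal ?_)
  have h1 := large_batch_error_le (c := 2 * (3 + 2 * Cavg) ^ 2) (σ := σ) (n := 1 / N)
    (by positivity) h.Cra_nonneg h.α_nonneg h.α_le hΔ (by positivity) h.inv_card_le (by positivity)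
  have h2 := large_batch_disagreement_le (σ := σ) (n := 1 / N) h.Cra_nonneg h.α_le hΔ
    (by positivity) (by rw [div_le_one (by linarith)]; exact hN')
  have e1 : σ ^ 2 * (1 / (N : ℝ)) = σ ^ 2 / N := by ring
  have e2 : σ ^ 2 / N * (1 / (Hn.card : ℝ)) = σ ^ 2 / N / Hn.card := by ring
  rw [e1] at h1 h2
  rw [e2] at h1
  gcongr

lemma η_sq_le (h : StepAssumptions M π est G M₂ σ Cra Cavg Cy α εbar η κ agg P Hn U) :
    η ^ 2 ≤ 1 / (4 * M.L H G M₂ ^ 2) := by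
  have hL := h.L_pos
  have hη := h.η_pos
  rw [le_div_iff₀ (by positivity)]
  have := pow_le_pow_left₀ (by positivity) h.η_le 2
  nlinarith

/-- Given the past, the correction term is deterministic and only the importance sampling difference
is random. The gain 1/B is dropped, since B = 1 suffices. -/
lemma hasMeanVar_small (h : StepAssumptions M π est G M₂ σ Cra Cavg Cy α εbar η κ agg P Hn U)
    (hB : 1 ≤ B) (θ' θ : Fin K → Param d) (k : Fin K) :
    HasMeanVar (Measure.pi fun _ : Fin B => trajLaw M π H (θ k))
      (fun τ => (B : ℝ)⁻¹ • ∑ i, est.g M π (τ i) (θ k) + η⁻¹ • (θ k - θ' k) -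
        (B : ℝ)⁻¹ • ∑ i, π.weight (τ i) (θ k) (θ' k) • est.g M π (τ i) (θ' k))
      (η⁻¹ • (θ k - θ' k) + (gradJ M π H (θ k) - gradJ M π H (θ' k)))
      (Cy * ‖θ k - θ' k‖ ^ 2) := by
  have h1 := ((h.difference (θ k) (θ' k)).average hB).const_add (η⁻¹ • (θ k - θ' k))
  have hB' : (1 : ℝ) ≤ B := by exact_mod_cast hB
  have hCy := h.Cy_nonneg
  refine HasMeanVar.mono (s := Cy * ‖θ k - θ' k‖ ^ 2 / B) ?_
    (div_le_self (by positivity) hB')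
  convert h1 using 2 with τ
  simp only [Finset.sum_sub_distrib, smul_sub]
  abel

lemma norm_small_mean_sub_le
    (h : StepAssumptions M π est G M₂ σ Cra Cavg Cy α εbar η κ agg P Hn U)
    (θ' θ : Fin K → Param d) {i l : Fin K} (hi : i ∈ U) (hl : l ∈ U) :
    ‖(η⁻¹ • (θ i - θ' i) + (gradJ M π H (θ i) - gradJ M π H (θ' i))) -
      (η⁻¹ • (θ l - θ' l) + (gradJ M π H (θ l) - gradJ M π H (θ' l)))‖ ≤
      3 / 2 * (diam U θ / η + diam U θ' / η) := by
  have hη := h.η_pos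
  have e : (η⁻¹ • (θ i - θ' i) + (gradJ M π H (θ i) - gradJ M π H (θ' i))) -
      (η⁻¹ • (θ l - θ' l) + (gradJ M π H (θ l) - gradJ M π H (θ' l))) =
      η⁻¹ • ((θ i - θ l) - (θ' i - θ' l)) + ((gradJ M π H (θ i) - gradJ M π H (θ l)) -
        (gradJ M π H (θ' i) - gradJ M π H (θ' l))) := by
    simp only [smul_sub]; abel
  rw [e]
  have h1 : ‖η⁻¹ • ((θ i - θ l) - (θ' i - θ' l))‖ ≤ diam U θ / η + diam U θ' / η := by
    rw [norm_smul, norm_inv, Real.norm_of_nonneg hη.le, ← add_div, div_eq_inv_mul]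
    gcongr
    exact (norm_sub_le _ _).trans (add_le_add (norm_sub_le_diam θ hi hl)
      (norm_sub_le_diam θ' hi hl))
  have h2 := (norm_sub_le (gradJ M π H (θ i) - gradJ M π H (θ l))
    (gradJ M π H (θ' i) - gradJ M π H (θ' l))).trans
    (add_le_add (h.norm_gradJ_sub_le θ hi hl) (h.norm_gradJ_sub_le θ' hi hl))
  refine (norm_add_le _ _).trans ?_
  linarith

/-- Conditional drift of the potential in an iteration with a small batch. -/
lemma small_batch (h : StepAssumptions M π est G M₂ σ Cra Cavg Cy α εbar η κ agg P Hn U)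
    {u : Fin K} (hu : u ∈ U) (hp : 0 < p) (hp1 : p ≤ 1) (hν : 0 ≤ ν) (hB : 1 ≤ B)
    (θ' θ : Fin K → Param d) (byz : Batch S A H K N B → Fin K → Fin K → Param d)
    (byz' : Batch S A H K N B → ℕ → Fin K → Fin K → Param d) {c4 c7 : ℝ}
    (hc4 : c4 = 2 * (3 + 2 * Cavg) ^ 2) (hc7 : c7 = Cy / (4 * M.L H G M₂ ^ 2)) :
    ∫⁻ τ, ENNReal.ofReal (potential M π H η p ν U u θ
        (nextParams M π est η κ agg P Hn (byz (Sum.inr τ)) (byz' (Sum.inr τ)) θ' θ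
          (Sum.inr τ : Batch S A H K N B)))
        ∂(Measure.pi fun k => Measure.pi fun _ : Fin B => trajLaw M π H (θ k)) ≤
      ENNReal.ofReal (M.R / (1 - M.γ) - objective M π H (θ u) -
        η / 2 * ‖gradJ M π H (θ u)‖ ^ 2 + η * ν * disagreement U η θ +
        (η / 2 + η / p) * ((1 + p / 2) * directionError M π H η u θ' θ +
          (5 * Cy + 108 * (c4 * Cra * Cy)) * (1 / K + α / p) *
            (η ^ 2 * ‖direction η u θ' θ‖ ^ 2) +
          (51 + 5 * c7 + 9 * c4 * (1 + 3 * Cra * (1 + c7))) / p *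
            (disagreement U η θ + disagreement U η θ')) +
        2 * (η * ν) * ((1 / 2 ^ κ) ^ 2 * ((2 + 2 * Cra * (10 + 12 * c7)) *
            (disagreement U η θ + disagreement U η θ') +
          24 * (Cra * Cy) * (η ^ 2 * ‖direction η u θ' θ‖ ^ 2)))) := by
  have hη := h.η_pos
  have hCy := h.Cy_nonneg
  have hΔ := disagreement_nonneg (U := U) (η := η) θ
  have hΔ' := disagreement_nonneg (U := U) (η := η) θ'
  set D := disagreement U η θ + disagreement U η θ' with hD
  set m : Fin K → Param d := fun k =>
    η⁻¹ • (θ k - θ' k) + (gradJ M π H (θ k) - gradJ M π H (θ' k)) with hm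
  set V := 3 * (Cy * η ^ 2) * (‖direction η u θ' θ‖ ^ 2 + D) with hV
  have hsq : (3 / 2 * (diam U θ / η + diam U θ' / η)) ^ 2 ≤ 9 / 2 * D := by
    rw [hD, disagreement, disagreement, ← div_pow, ← div_pow]
    nlinarith [sq_nonneg (diam U θ / η - diam U θ' / η)]
  have hpair : ∀ i ∈ U, ∀ l ∈ U, ‖m i - m l‖ ^ 2 ≤ 9 / 2 * D := fun i hi l hl =>
    (pow_le_pow_left₀ (norm_nonneg _) (h.norm_small_mean_sub_le θ' θ hi hl) 2).trans hsq
  have havg : ‖avg Hn m - m u‖ ^ 2 ≤ 9 / 2 * D :=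
    (pow_le_pow_left₀ (norm_nonneg _) (norm_avg_sub_le h.nonempty fun i hi =>
      h.norm_small_mean_sub_le θ' θ (h.subset hi) hu) 2).trans hsq
  have hY : ‖avg Hn m - gradJ M π H (θ u)‖ ^ 2 ≤
      (1 + p / 8) * directionError M π H η u θ' θ + 9 / p * (9 / 2 * D) := by
    -- For agent `u` itself, `m u - ∇J(θ u)` is exactly the old error vector. What remains is
    -- disagreement between means, which costs only a multiple of D.
    have e : avg Hn m - gradJ M π H (θ u) = (direction η u θ' θ - gradJ M π H (θ' u)) +
        (avg Hn m - m u) := by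
      simp only [hm, direction]; abel
    rw [e]
    refine (norm_add_sq_le_mul (by positivity : 0 < p / 8) _ _).trans (add_le_add le_rfl ?_)
    have e1 : 1 + 1 / (p / 8) ≤ 9 / p := by
      have hp' : 1 ≤ 1 / p := by rw [le_div_iff₀ hp]; linarith
      rw [one_div_div]
      calc 1 + 8 / p ≤ 1 / p + 8 / p := by gcongr
        _ = 9 / p := by ring
    gcongr
  have hvar : ∀ k ∈ Hn, Cy * ‖θ k - θ' k‖ ^ 2 ≤ V := fun k hk => by
    -- The step lengths of all honest agents are controlled by that of agent `u` and the
    -- disagreement at both times; this accounts for the factor 3 in `V`.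
    have e : θ k - θ' k = (θ u - θ' u) + (θ k - θ u) - (θ' k - θ' u) := by abel
    have h1 : ‖θ k - θ' k‖ ≤ ‖θ u - θ' u‖ + diam U θ + diam U θ' := by
      rw [e]
      exact (norm_sub_le _ _).trans (add_le_add ((norm_add_le _ _).trans (add_le_add le_rfl
        (norm_sub_le_diam θ (h.subset hk) hu))) (norm_sub_le_diam θ' (h.subset hk) hu))
    have h2 := pow_le_pow_left₀ (norm_nonneg _) h1 2
    have h3 : (‖θ u - θ' u‖ + diam U θ + diam U θ') ^ 2 ≤
        3 * (‖θ u - θ' u‖ ^ 2 + (diam U θ ^ 2 + diam U θ' ^ 2)) := by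
      nlinarith [sq_nonneg (‖θ u - θ' u‖ - diam U θ), sq_nonneg (‖θ u - θ' u‖ - diam U θ'),
        sq_nonneg (diam U θ - diam U θ')]
    have h4 : ‖θ u - θ' u‖ ^ 2 + (diam U θ ^ 2 + diam U θ' ^ 2) =
        η ^ 2 * (‖direction η u θ' θ‖ ^ 2 + D) := by
      rw [hD, direction, disagreement, disagreement, norm_smul, norm_inv,
        Real.norm_of_nonneg hη.le]
      field_simp
    calc Cy * ‖θ k - θ' k‖ ^ 2 ≤ Cy * (3 * (η ^ 2 * (‖direction η u θ' θ‖ ^ 2 + D))) := by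
          rw [← h4]
          gcongr
          exact h2.trans h3
      _ = V := by rw [hV]; ring
  have key := h.lintegral_potential_le (p := p) (ν := ν) hu hp hν (by positivity : 0 < p / 8)
    (V := V) (Z := 9 / 2 * D)
    (Y := (1 + p / 8) * directionError M π H η u θ' θ + 9 / p * (9 / 2 * D))
    (fun k => h.hasMeanVar_small hB θ' θ k)
    (by positivity) (by positivity) hvar
    (fun i hi l hl => hpair i (h.subset hi) l (h.subset hl)) θ hY
    (fun τ => nextParams M π est η κ agg P Hn (byz (Sum.inr τ)) (byz' (Sum.inr τ)) θ' θ
          (Sum.inr τ : Batch S A H K N B))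
    (fun τ => byz (Sum.inr τ)) (fun τ => byz' (Sum.inr τ)) (fun τ => rfl)
  refine key.trans (ENNReal.ofReal_le_ofReal ?_)
  have hc7' : Cy * η ^ 2 ≤ c7 := by
    rw [hc7]
    have := mul_le_mul_of_nonneg_left h.η_sq_le hCy
    rwa [mul_one_div] at this
  have h1 := small_batch_error_le (c := c4) (h := 1 / (Hn.card : ℝ)) hp hp1
    (directionError_nonneg (M := M) (π := π) (H := H) (η := η) u θ' θ)
    (by linarith : disagreement U η θ ≤ D) hΔ (by rw [hc4]; positivity) h.Cra_nonneg h.α_nonneg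
    h.α_le h.inv_card_le (by positivity) h.one_div_card_le hCy
    (sq_nonneg ‖direction η u θ' θ‖) hc7' hV
  have h2 := small_batch_disagreement_le (by linarith : disagreement U η θ ≤ D) hΔ h.Cra_nonneg
    h.α_le hCy (sq_nonneg ‖direction η u θ' θ‖) hc7' hV
  rw [mul_one_div] at h1
  rw [← hc4]
  gcongr

end StepAssumptions

end BatchDrift

/-! ### Absorption of all error terms into the potential. -/

/-- Averaging over the coin multiplies e by at most 1 − p/2, and (η/2 + η/p)(1 − p/2) ≤ η/p, so the
weight of e is preserved. The squared direction s gets η/8 from the direction error and η/8 from the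
disagreement, together the stored η/4. The sum Δ + Δ' gets 3/4 ην by the choice of ν and 1/4 ην by
the contraction. Adding the ηνΔ that is carried on as the new previous disagreement gives exactly
the weights 2ην and ην. -/
lemma drift_algebra {p η ν X e s Δ Δ' a b c5 c6 c8 c9 c10 c13 q : ℝ} (hp : 0 < p) (hp1 : p ≤ 1)
    (hη : 0 < η) (he : 0 ≤ e) (hs : 0 ≤ s) (hΔ : 0 ≤ Δ) (hΔ' : 0 ≤ Δ') (ha : 0 ≤ a) (hb : 0 ≤ b)
    (hc5 : 0 ≤ c5) (hc6 : 0 ≤ c6) (hc8 : 0 ≤ c8) (hc9 : 0 ≤ c9) (hc10 : 0 ≤ c10)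
    (hc13 : 0 ≤ c13) (hq : 0 ≤ q) (hν : ν = 2 * (c9 + c5) / p ^ 2)
    (h1 : 12 * c8 * η ^ 2 ≤ p) (h2 : 2 * ν * q * c13 * η ^ 2 ≤ 1 / 8)
    (h3 : 2 * q * (c10 + c6) ≤ 1 / 4) :
    p * (X + η * ν * Δ + (η / 2 + η / p) * (c5 * Δ + a) + 2 * (η * ν) * (q * (c6 * Δ + b))) +
      (1 - p) * (X + η * ν * Δ + (η / 2 + η / p) * ((1 + p / 2) * e + c8 * (η ^ 2 * s) +
        c9 / p * (Δ + Δ')) + 2 * (η * ν) * (q * (c10 * (Δ + Δ') + c13 * (η ^ 2 * s)))) ≤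
    X + η / p * e + η / 4 * s + 2 * (η * ν) * Δ + η * ν * Δ' +
      η * (3 / 2 * a + 2 * (ν * q * b)) := by
  set D := Δ + Δ' with hD
  have hD0 : 0 ≤ D := by positivity
  have hp1' : 0 ≤ 1 - p := by linarith
  have hν0 : 0 ≤ ν := by rw [hν]; positivity
  have s1 : p * (c5 * Δ + a) + (1 - p) * ((1 + p / 2) * e + c8 * (η ^ 2 * s) + c9 / p * D) ≤
      (1 - p / 2) * e + p * a + c8 * (η ^ 2 * s) + (c9 + c5) / p * D := by
    have g1 : p * (c5 * Δ) ≤ c5 / p * D := by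
      have : p ≤ 1 / p := by rw [le_div_iff₀ hp]; nlinarith
      calc p * (c5 * Δ) ≤ 1 / p * (c5 * D) := by gcongr; linarith
        _ = _ := by ring
    have g2 : (1 - p) * (c8 * (η ^ 2 * s)) ≤ c8 * (η ^ 2 * s) :=
      mul_le_of_le_one_left (by positivity) (by linarith)
    have g3 : (1 - p) * (c9 / p * D) ≤ c9 / p * D :=
      mul_le_of_le_one_left (by positivity) (by linarith)
    have g4 : (1 - p) * ((1 + p / 2) * e) ≤ (1 - p / 2) * e := by
      have : 0 ≤ p ^ 2 * e := by positivity
      nlinarith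
    have g5 : (c9 + c5) / p * D = c9 / p * D + c5 / p * D := by ring
    rw [g5]; linarith
  have s2 : (η / 2 + η / p) * ((1 - p / 2) * e + p * a + c8 * (η ^ 2 * s) + (c9 + c5) / p * D) ≤
      η / p * e + η * (3 / 2 * a) + η / 8 * s + 3 / 4 * (η * ν * D) := by
    have g0 : η / 2 + η / p ≤ 3 / 2 * (η / p) := by
      have : η ≤ η / p := by rw [le_div_iff₀ hp]; nlinarith
      linarith
    have g1 : (η / 2 + η / p) * ((1 - p / 2) * e) ≤ η / p * e := by
      have : (η / 2 + η / p) * ((1 - p / 2) * e) = η / p * e - η * p / 4 * e := by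
        field_simp; ring
      have : 0 ≤ η * p / 4 * e := by positivity
      linarith
    have g2 : (η / 2 + η / p) * (p * a) ≤ η * (3 / 2 * a) := by
      calc (η / 2 + η / p) * (p * a) ≤ 3 / 2 * (η / p) * (p * a) := by gcongr
        _ = _ := by field_simp
    have g3 : (η / 2 + η / p) * (c8 * (η ^ 2 * s)) ≤ η / 8 * s := by
      calc (η / 2 + η / p) * (c8 * (η ^ 2 * s)) ≤ 3 / 2 * (η / p) * (c8 * (η ^ 2 * s)) := by gcongr
        _ = 1 / 8 * (η / p) * s * (12 * c8 * η ^ 2) := by ring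
        _ ≤ 1 / 8 * (η / p) * s * p := by gcongr
        _ = _ := by field_simp
    have g4 : (η / 2 + η / p) * ((c9 + c5) / p * D) ≤ 3 / 4 * (η * ν * D) := by
      calc (η / 2 + η / p) * ((c9 + c5) / p * D) ≤ 3 / 2 * (η / p) * ((c9 + c5) / p * D) := by
            gcongr
        _ = _ := by rw [hν]; field_simp; ring
    linarith
  have s3 : p * (c6 * Δ + b) + (1 - p) * (c10 * D + c13 * (η ^ 2 * s)) ≤
      (c10 + c6) * D + b + c13 * (η ^ 2 * s) := by
    have g1 : p * (c6 * Δ + b) ≤ c6 * D + b := by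
      refine (mul_le_of_le_one_left (by positivity) hp1).trans ?_
      gcongr; linarith
    have g2 : (1 - p) * (c10 * D + c13 * (η ^ 2 * s)) ≤ c10 * D + c13 * (η ^ 2 * s) :=
      mul_le_of_le_one_left (by positivity) (by linarith)
    linarith
  have s4 : 2 * (η * ν) * (q * ((c10 + c6) * D + b + c13 * (η ^ 2 * s))) ≤
      1 / 4 * (η * ν * D) + η * (2 * (ν * q * b)) + η / 8 * s := by
    have g1 : η * ν * D * (2 * q * (c10 + c6)) ≤ η * ν * D * (1 / 4) := by gcongr
    have g2 : η * s * (2 * ν * q * c13 * η ^ 2) ≤ η * s * (1 / 8) := by gcongr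
    linarith
  have t1 := mul_le_mul_of_nonneg_left s1 (by positivity : 0 ≤ η / 2 + η / p)
  have t2 := mul_le_mul_of_nonneg_left (mul_le_mul_of_nonneg_left s3 hq)
    (by positivity : 0 ≤ 2 * (η * ν))
  have t3 : η * ν * D = η * ν * Δ + η * ν * Δ' := by rw [hD]; ring
  linarith

/-! ### The law of the run and the summed drift. -/

section Run

variable {S : Type u} {A : Type v} [MeasurableSpace S] [MeasurableSpace A] {d H K N B : ℕ}

section BatchLaw

variable (M : MDP S A) (π : PolicyClass S A d)

/-- Only upper bounds on `lintegral` are needed, and these pass through `map` and `bind` without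
measurability. An iteration never has to be shown to be a kernel, and total mass at most 1 is
enough. -/
lemma lintegral_batchLaw_zero_le (p : ℝ) (θ : Fin K → Param d) (F : Batch S A H K N B → ℝ≥0∞) :
    ∫⁻ x, F x ∂(batchLaw M π H N B p 0 θ) ≤
      ∫⁻ τ, F (Sum.inl τ) ∂(Measure.pi fun k => Measure.pi fun _ : Fin N => trajLaw M π H (θ k)) := by
  simp only [batchLaw, if_true]
  exact lintegral_map_le _ _

lemma lintegral_batchLaw_le (p : ℝ) {t : ℕ} (ht : t ≠ 0) (θ : Fin K → Param d)
    (F : Batch S A H K N B → ℝ≥0∞) :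
    ∫⁻ x, F x ∂(batchLaw M π H N B p t θ) ≤ ENNReal.ofReal p *
      ∫⁻ τ, F (Sum.inl τ) ∂(Measure.pi fun k => Measure.pi fun _ : Fin N => trajLaw M π H (θ k)) +
      ENNReal.ofReal (1 - p) *
      ∫⁻ τ, F (Sum.inr τ) ∂(Measure.pi fun k => Measure.pi fun _ : Fin B => trajLaw M π H (θ k)) := by
  simp only [batchLaw, if_neg ht]
  rw [lintegral_add_measure, lintegral_smul_measure, lintegral_smul_measure]
  exact add_le_add (mul_le_mul_right (lintegral_map_le _ _) _)
    (mul_le_mul_right (lintegral_map_le _ _) _)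

lemma batchLaw_univ_le {p : ℝ} (hp : 0 ≤ p) (hp1 : p ≤ 1) (t : ℕ) (θ : Fin K → Param d) :
    batchLaw M π H N B p t θ Set.univ ≤ 1 := by
  rw [← lintegral_one]
  rcases eq_or_ne t 0 with rfl | ht
  · exact (lintegral_batchLaw_zero_le M π p θ _).trans (by simp)
  · refine (lintegral_batchLaw_le M π p ht θ _).trans ?_
    simp only [lintegral_one, measure_univ, mul_one]
    rw [← ENNReal.ofReal_add hp (by linarith)]
    simp

lemma lintegral_batchSize_le {p : ℝ} (hp : 0 ≤ p) (t : ℕ) (ht : t ≠ 0)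
    (θ : Fin K → Param d) :
    ∫⁻ x, (batchSize x : ℝ≥0∞) ∂(batchLaw M π H N B p t θ) ≤
      ENNReal.ofReal (p * N) + B := by
  refine (lintegral_batchLaw_le M π p ht θ _).trans ?_
  simp only [batchSize, lintegral_const, measure_univ, mul_one]
  rw [ENNReal.ofReal_mul hp, ENNReal.ofReal_natCast]
  refine add_le_add le_rfl (mul_le_of_le_one_left zero_le ?_)
  rw [← ENNReal.ofReal_one]
  exact ENNReal.ofReal_le_ofReal (by linarith)

end BatchLaw

variable {M : MDP S A} {π : PolicyClass S A d} {est : Estimator H}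
  {G M₂ σ Cra Cavg Cy α εbar η p ν : ℝ} {κ : ℕ} {agg : (Fin K → Param d) → Param d}
  {P : Protocol.{w'} K d} {Hn U : Finset (Fin K)}

namespace StepAssumptions

/-- An exact gradient step from x cannot raise J above its upper bound. This makes the remaining gap
nonnegative, which is needed to work with sums under `ENNReal.ofReal`. -/
lemma half_mul_norm_gradJ_sq_le
    (h : StepAssumptions M π est G M₂ σ Cra Cavg Cy α εbar η κ agg P Hn U) (x : Param d) :
    η / 2 * ‖gradJ M π H x‖ ^ 2 ≤ M.R / (1 - M.γ) - objective M π H x := by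
  obtain ⟨u, -⟩ := h.nonempty
  have hη := h.η_pos
  have h1 := h.descent u (fun _ => x) (fun _ => x + η • gradJ M π H x)
  have h2 := objective_le (π := π) (H := H) M (x + η • gradJ M π H x)
  have h3 : direction η u (fun _ => x) (fun _ => x + η • gradJ M π H x) = gradJ M π H x := by
    rw [direction, add_sub_cancel_left, smul_smul, inv_mul_cancel₀ hη.ne', one_smul]
  rw [directionError, h3, sub_self, norm_zero] at h1
  have : 0 ≤ η / 4 * ‖gradJ M π H x‖ ^ 2 := by positivity
  linarith

/-- The first iteration. -/
lemma drift_zero (h : StepAssumptions M π est G M₂ σ Cra Cavg Cy α εbar η κ agg P Hn U)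
    {u : Fin K} (hu : u ∈ U) (hp : 0 < p) (hν : 0 ≤ ν) (hN : 1 ≤ N) (θ₀ : Param d)
    (byz : Batch S A H K N B → Fin K → Fin K → Param d)
    (byz' : Batch S A H K N B → ℕ → Fin K → Fin K → Param d) {a b : ℝ}
    (ha : a = (3 + 8 * (2 * (3 + 2 * Cavg) ^ 2 * Cra)) * σ ^ 2 * ((1 / K + α) * (1 / N)))
    (hb : b = 8 * (Cra * σ ^ 2)) :
    ∫⁻ x, ENNReal.ofReal (potential M π H η p ν U u (fun _ => θ₀)
        (nextParams M π est η κ agg P Hn (byz x) (byz' x) (fun _ => θ₀) (fun _ => θ₀) x))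
        ∂(batchLaw M π H N B p 0 (fun _ => θ₀)) +
      ENNReal.ofReal (η / 2 * ‖gradJ M π H θ₀‖ ^ 2) ≤
      ENNReal.ofReal (M.R / (1 - M.γ) + (η / 2 + η / p) * a +
        2 * (η * ν) * ((1 / 2 ^ κ) ^ 2 * b)) := by
  have hη := h.η_pos
  have hCra := h.Cra_nonneg
  have hα := h.α_nonneg
  have ha0 : 0 ≤ a := by rw [ha]; positivity
  have hb0 : 0 ≤ b := by rw [hb]; positivity
  have h1 := h.large_batch (B := B) hu hp hν hN (fun _ => θ₀) (fun _ => θ₀) byz byz'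
  -- All agents start at the same point, and the first batch is large, so neither disagreement nor
  -- an old error enters.
  have hd : disagreement U η (fun _ : Fin K => θ₀) = 0 := by simp [disagreement, diam_const]
  have h2 := h.half_mul_norm_gradJ_sq_le θ₀
  have h3 := objective_nonneg (π := π) (H := H) M θ₀
  rw [← ha, ← hb, hd] at h1
  simp only [mul_zero, zero_add, add_zero] at h1
  refine (add_le_add_left ((lintegral_batchLaw_zero_le M π p _ _).trans h1) _).trans ?_
  rw [← ENNReal.ofReal_add _ (by positivity)]
  · exact ENNReal.ofReal_le_ofReal (by linarith)
  · have : 0 ≤ (η / 2 + η / p) * a + 2 * (η * ν) * ((1 / 2 ^ κ) ^ 2 * b) := by positivity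
    linarith

/-- The later iterations. -/
lemma drift_succ (h : StepAssumptions M π est G M₂ σ Cra Cavg Cy α εbar η κ agg P Hn U)
    {u : Fin K} (hu : u ∈ U) (hp : 0 < p) (hp1 : p ≤ 1) (hN : 1 ≤ N) (hB : 1 ≤ B) {t : ℕ}
    (ht : t ≠ 0) (θ' θ : Fin K → Param d)
    (byz : Batch S A H K N B → Fin K → Fin K → Param d)
    (byz' : Batch S A H K N B → ℕ → Fin K → Fin K → Param d) {a b c4 c5 c6 c7 c8 c9 c10 c13 : ℝ}
    (ha : a = (3 + 8 * (2 * (3 + 2 * Cavg) ^ 2 * Cra)) * σ ^ 2 * ((1 / K + α) * (1 / N)))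
    (hb : b = 8 * (Cra * σ ^ 2))
    (hc4 : c4 = 2 * (3 + 2 * Cavg) ^ 2) (hc7 : c7 = Cy / (4 * M.L H G M₂ ^ 2))
    (hc5 : c5 = 1 + 2 * (2 * (3 + 2 * Cavg) ^ 2) + 2 * (3 + 2 * Cavg) ^ 2 * Cra)
    (hc6 : c6 = 2 + Cra)
    (hc8 : c8 = (5 * Cy + 108 * (c4 * Cra * Cy)) * (1 / K + α / p))
    (hc9 : c9 = 51 + 5 * c7 + 9 * c4 * (1 + 3 * Cra * (1 + c7)))
    (hc10 : c10 = 2 + 2 * Cra * (10 + 12 * c7))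
    (hc13 : c13 = 24 * (Cra * Cy))
    (hν : ν = 2 * (c9 + c5) / p ^ 2) (h1 : 12 * c8 * η ^ 2 ≤ p)
    (h2 : 2 * ν * (1 / 2 ^ κ) ^ 2 * c13 * η ^ 2 ≤ 1 / 8)
    (h3 : 2 * (1 / 2 ^ κ) ^ 2 * (c10 + c6) ≤ 1 / 4) :
    ∫⁻ x, ENNReal.ofReal (potential M π H η p ν U u θ
        (nextParams M π est η κ agg P Hn (byz x) (byz' x) θ' θ x))
        ∂(batchLaw M π H N B p t θ) +
      ENNReal.ofReal (η / 2 * ‖gradJ M π H (θ u)‖ ^ 2) ≤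
      ENNReal.ofReal (potential M π H η p ν U u θ' θ) +
        ENNReal.ofReal (η * (3 / 2 * a + 2 * (ν * (1 / 2 ^ κ) ^ 2 * b))) := by
  have hη := h.η_pos
  have hCra := h.Cra_nonneg
  have hCavg := h.Cavg_nonneg
  have hCy := h.Cy_nonneg
  have hα := h.α_nonneg
  have hL := h.L_pos
  have ha0 : 0 ≤ a := by rw [ha]; positivity
  have hb0 : 0 ≤ b := by rw [hb]; positivity
  have hc4' : 0 ≤ c4 := by rw [hc4]; positivity
  have hc5' : 0 ≤ c5 := by rw [hc5]; positivity
  have hc6' : 0 ≤ c6 := by rw [hc6]; positivity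
  have hc7' : 0 ≤ c7 := by rw [hc7]; positivity
  have hc8' : 0 ≤ c8 := by rw [hc8]; positivity
  have hc9' : 0 ≤ c9 := by rw [hc9]; positivity
  have hc10' : 0 ≤ c10 := by rw [hc10]; positivity
  have hc13' : 0 ≤ c13 := by rw [hc13]; positivity
  have hν0 : 0 ≤ ν := by rw [hν]; positivity
  have hΔ := disagreement_nonneg (U := U) (η := η) θ
  have hΔ' := disagreement_nonneg (U := U) (η := η) θ'
  have he := directionError_nonneg (M := M) (π := π) (H := H) (η := η) u θ' θ
  have hlarge := h.large_batch (B := B) hu hp hν0 hN θ' θ byz byz'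
  have hsmall := h.small_batch (N := N) hu hp hp1 hν0 hB θ' θ byz byz' hc4 hc7
  rw [← ha, ← hb, ← hc5, ← hc6] at hlarge
  rw [← hc8, ← hc9, ← hc10, ← hc13] at hsmall
  have hX := h.half_mul_norm_gradJ_sq_le (θ u)
  set X := M.R / (1 - M.γ) - objective M π H (θ u) - η / 2 * ‖gradJ M π H (θ u)‖ ^ 2 with hXdef
  have hX0 : 0 ≤ X := by linarith
  have key := drift_algebra (X := X) hp hp1 hη he (sq_nonneg ‖direction η u θ' θ‖) hΔ hΔ' ha0 hb0
    hc5' hc6' hc8' hc9' hc10' hc13' (sq_nonneg (1 / 2 ^ κ)) hν h1 h2 h3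
  have hp1' : 0 ≤ 1 - p := by linarith
  refine (add_le_add_left ((lintegral_batchLaw_le M π p ht θ _).trans
    (add_le_add (mul_le_mul_right hlarge (ENNReal.ofReal p))
      (mul_le_mul_right hsmall (ENNReal.ofReal (1 - p))))) _).trans ?_
  rw [← ENNReal.ofReal_mul hp.le, ← ENNReal.ofReal_mul hp1',
    ← ENNReal.ofReal_add (by positivity) (by positivity), ← ENNReal.ofReal_add (by positivity) (by positivity),
    ← ENNReal.ofReal_add (potential_nonneg hη hp hν0 u θ' θ) (by positivity)]
  refine ENNReal.ofReal_le_ofReal ?_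
  unfold potential
  linarith

end StepAssumptions

section RunLaw

variable {Hs : ℕ → Finset (Fin K)} {adv : Adversary.{u, v, w} S A d H K N B} {θ₀ : Param d}

lemma lintegral_runLaw_zero_le (F : RunState adv.Mem d K → ℝ≥0∞) :
    ∫⁻ st, F st ∂(runLaw M π est p η κ agg P Hs adv θ₀ 0) ≤
      ∫⁻ z, F (z, (fun _ => θ₀), (fun _ => θ₀), 0) ∂adv.seed :=
  lintegral_map_le _ _

lemma lintegral_runLaw_succ_le (t : ℕ) (F : RunState adv.Mem d K → ℝ≥0∞) :
    ∫⁻ st, F st ∂(runLaw M π est p η κ agg P Hs adv θ₀ (t + 1)) ≤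
      ∫⁻ st, ∫⁻ x, F (adv.update t (st.1, st.2.1, st.2.2.1, x), st.2.2.1,
        nextParams M π est η κ agg P (Hs t) (adv.gradMsg t (st.1, st.2.1, st.2.2.1, x))
          (adv.agreeMsg t (st.1, st.2.1, st.2.2.1, x)) st.2.1 st.2.2.1 x,
          st.2.2.2 + batchSize x) ∂(batchLaw M π H N B p t st.2.2.1)
        ∂(runLaw M π est p η κ agg P Hs adv θ₀ t) :=
  (Measure.lintegral_bind_le _ _ _).trans (lintegral_mono fun _ => lintegral_map_le _ _)

lemma runLaw_univ_le (hp : 0 ≤ p) (hp1 : p ≤ 1) (t : ℕ) :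
    runLaw M π est p η κ agg P Hs adv θ₀ t Set.univ ≤ 1 := by
  have := adv.seed_prob
  induction t with
  | zero =>
    rw [← lintegral_one]
    exact (lintegral_runLaw_zero_le fun _ => 1).trans (by simp)
  | succ t ih =>
    rw [← lintegral_one]
    refine (lintegral_runLaw_succ_le t fun _ => 1).trans ?_
    simp only [lintegral_one]
    refine (lintegral_mono fun st : RunState adv.Mem d K => batchLaw_univ_le M π hp hp1 t st.2.2.1).trans ?_
    simpa using ih

lemma lintegral_const_runLaw_le (hp : 0 ≤ p) (hp1 : p ≤ 1) (t : ℕ) (c : ℝ≥0∞) :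
    ∫⁻ _, c ∂(runLaw M π est p η κ agg P Hs adv θ₀ t) ≤ c := by
  rw [lintegral_const]
  exact mul_le_of_le_one_right zero_le (runLaw_univ_le hp hp1 t)

/-- The first iteration always costs N, each of the T others at most pN + B on average. The
induction therefore starts after one iteration. -/
lemma expectedTrajectories_le (hp : 0 ≤ p) (hp1 : p ≤ 1) (T : ℕ) :
    expectedTrajectories M π est p η κ (T + 1) agg P Hs adv θ₀ ≤
      N + T * (ENNReal.ofReal (p * N) + B) := by
  have := adv.seed_prob
  unfold expectedTrajectories
  induction T with
  | zero =>
    refine (lintegral_runLaw_succ_le 0 _).trans ((lintegral_runLaw_zero_le _).trans ?_)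
    refine (lintegral_mono fun z => lintegral_batchLaw_zero_le M π p _ _).trans ?_
    simp [batchSize]
  | succ T ih =>
    refine (lintegral_runLaw_succ_le (T + 1) _).trans ?_
    have hstep : ∀ st : RunState adv.Mem d K, ∫⁻ x, ((st.2.2.2 + batchSize x : ℕ) : ℝ≥0∞)
        ∂(batchLaw M π H N B p (T + 1) st.2.2.1) ≤
        (st.2.2.2 : ℝ≥0∞) + (ENNReal.ofReal (p * N) + B) := fun st => by
      simp only [Nat.cast_add]
      rw [lintegral_add_left measurable_const, lintegral_const]
      exact add_le_add (mul_le_of_le_one_right zero_le (batchLaw_univ_le M π hp hp1 _ _))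
        (lintegral_batchSize_le M π hp _ (Nat.succ_ne_zero T) _)
    refine (lintegral_mono hstep).trans ?_
    rw [lintegral_add_right _ measurable_const]
    refine (add_le_add ih (lintegral_const_runLaw_le hp hp1 _ _)).trans (le_of_eq ?_)
    push_cast
    ring

/-- The sum of the expected squared gradient norms along the trajectory of agent `u`. -/
lemma sum_lintegral_gradJ_le {U : Finset (Fin K)} {T : ℕ}
    (h : ∀ t < T + 1, StepAssumptions M π est G M₂ σ Cra Cavg Cy α εbar η κ agg P (Hs t) U)
    {u : Fin K} (hu : u ∈ U) (hp : 0 < p) (hp1 : p ≤ 1) (hN : 1 ≤ N) (hB : 1 ≤ B)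
    {a b c4 c5 c6 c7 c8 c9 c10 c13 : ℝ}
    (ha : a = (3 + 8 * (2 * (3 + 2 * Cavg) ^ 2 * Cra)) * σ ^ 2 * ((1 / K + α) * (1 / N)))
    (hb : b = 8 * (Cra * σ ^ 2))
    (hc4 : c4 = 2 * (3 + 2 * Cavg) ^ 2) (hc7 : c7 = Cy / (4 * M.L H G M₂ ^ 2))
    (hc5 : c5 = 1 + 2 * (2 * (3 + 2 * Cavg) ^ 2) + 2 * (3 + 2 * Cavg) ^ 2 * Cra)
    (hc6 : c6 = 2 + Cra)
    (hc8 : c8 = (5 * Cy + 108 * (c4 * Cra * Cy)) * (1 / K + α / p))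
    (hc9 : c9 = 51 + 5 * c7 + 9 * c4 * (1 + 3 * Cra * (1 + c7)))
    (hc10 : c10 = 2 + 2 * Cra * (10 + 12 * c7))
    (hc13 : c13 = 24 * (Cra * Cy))
    (hν : ν = 2 * (c9 + c5) / p ^ 2) (h1 : 12 * c8 * η ^ 2 ≤ p)
    (h2 : 2 * ν * (1 / 2 ^ κ) ^ 2 * c13 * η ^ 2 ≤ 1 / 8)
    (h3 : 2 * (1 / 2 ^ κ) ^ 2 * (c10 + c6) ≤ 1 / 4) (hν0 : 0 ≤ ν) :
    ∑ t ∈ Finset.range (T + 1), ∫⁻ st, ENNReal.ofReal (η / 2 * ‖gradJ M π H (st.2.2.1 u)‖ ^ 2)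
        ∂(runLaw M π est p η κ agg P Hs adv θ₀ t) ≤
      ENNReal.ofReal (M.R / (1 - M.γ) + (η / 2 + η / p) * a +
        2 * (η * ν) * ((1 / 2 ^ κ) ^ 2 * b)) +
      T * ENNReal.ofReal (η * (3 / 2 * a + 2 * (ν * (1 / 2 ^ κ) ^ 2 * b))) := by
  have := adv.seed_prob
  set n : ℕ → ℝ≥0∞ := fun t => ∫⁻ st, ENNReal.ofReal (η / 2 * ‖gradJ M π H (st.2.2.1 u)‖ ^ 2)
        ∂(runLaw M π est p η κ agg P Hs adv θ₀ t) with hn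
  set E : ℕ → ℝ≥0∞ := fun t => ∫⁻ st, ENNReal.ofReal (potential M π H η p ν U u st.2.1 st.2.2.1)
        ∂(runLaw M π est p η κ agg P Hs adv θ₀ t) with hE
  have hE1 : E 1 + n 0 ≤ ENNReal.ofReal (M.R / (1 - M.γ) + (η / 2 + η / p) * a +
        2 * (η * ν) * ((1 / 2 ^ κ) ^ 2 * b)) := by
    simp only [hE, hn]
    refine (add_le_add ((lintegral_runLaw_succ_le 0 _).trans (lintegral_runLaw_zero_le _))
      (lintegral_runLaw_zero_le _)).trans ((le_lintegral_add _ _).trans ?_)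
    refine (lintegral_mono fun z => (h 0 (Nat.succ_pos T)).drift_zero (B := B) hu hp hν0 hN θ₀
      _ _ ha hb).trans ?_
    simp
  have hE2 : ∀ t, t ≠ 0 → t < T + 1 → E (t + 1) + n t ≤ E t +
      ENNReal.ofReal (η * (3 / 2 * a + 2 * (ν * (1 / 2 ^ κ) ^ 2 * b))) := fun t ht0 ht => by
    simp only [hE, hn]
    refine (add_le_add_left (lintegral_runLaw_succ_le t _) _).trans ((le_lintegral_add _ _).trans ?_)
    refine (lintegral_mono fun st : RunState adv.Mem d K =>
      (h t ht).drift_succ hu hp hp1 hN hB ht0 st.2.1 st.2.2.1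
      (fun x => adv.gradMsg t (st.1, st.2.1, st.2.2.1, x))
      (fun x => adv.agreeMsg t (st.1, st.2.1, st.2.2.1, x)) ha hb hc4 hc7 hc5 hc6 hc8 hc9 hc10 hc13 hν h1 h2 h3).trans ?_
    rw [lintegral_add_right _ measurable_const]
    exact add_le_add_right (lintegral_const_runLaw_le hp.le hp1 _ _) _
  -- Telescoping from `E 1`, not from `E 0`: the forced large batch bounds `E 1 + n 0` directly. The
  -- final potential is dropped at the end.
  have hind : ∀ t ≤ T, E (t + 1) + ∑ s ∈ Finset.range (t + 1), n s ≤
      ENNReal.ofReal (M.R / (1 - M.γ) + (η / 2 + η / p) * a +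
        2 * (η * ν) * ((1 / 2 ^ κ) ^ 2 * b)) +
      t * ENNReal.ofReal (η * (3 / 2 * a + 2 * (ν * (1 / 2 ^ κ) ^ 2 * b))) := by
    intro t
    induction t with
    | zero => intro _; simpa using hE1
    | succ t ih =>
      intro ht
      rw [Finset.sum_range_succ]
      calc E (t + 1 + 1) + (∑ s ∈ Finset.range (t + 1), n s + n (t + 1))
          = (E (t + 1 + 1) + n (t + 1)) + ∑ s ∈ Finset.range (t + 1), n s := by ring
        _ ≤ (E (t + 1) + ENNReal.ofReal (η * (3 / 2 * a + 2 * (ν * (1 / 2 ^ κ) ^ 2 * b)))) +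
              ∑ s ∈ Finset.range (t + 1), n s :=
            add_le_add_left (hE2 (t + 1) (Nat.succ_ne_zero t) (by omega)) _
        _ = (E (t + 1) + ∑ s ∈ Finset.range (t + 1), n s) +
              ENNReal.ofReal (η * (3 / 2 * a + 2 * (ν * (1 / 2 ^ κ) ^ 2 * b))) := by
            rw [add_right_comm]
        _ ≤ _ := add_le_add_left (ih (by omega)) _
        _ = _ := by rw [Nat.cast_succ, add_one_mul, add_assoc]
  exact le_add_self.trans (hind T le_rfl)

end RunLaw

end Run

/-! ### The choice of the parameters -/

lemma rate_eq {K : ℕ} {α ε : ℝ} (hα : 0 ≤ α) :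
    rate K α ε = α * √α / ε ^ 4 + √α / (K * ε ^ 4) + √α / (√K * ε ^ 3) + 1 / (K * ε ^ 3) := by
  have h : α ^ (3 / 2 : ℝ) = α * √α := by
    rw [show (3 / 2 : ℝ) = 1 + 1 / 2 by norm_num, Real.rpow_add_of_nonneg hα (by norm_num)
      (by norm_num), Real.rpow_one, Real.sqrt_eq_rpow]
  rw [rate, h, Real.sqrt_eq_rpow, Real.sqrt_eq_rpow]

/-- If Kε ≤ 1, the last summand of the rate already dominates 1/ε². -/
lemma one_div_sq_le_rate {K : ℕ} {α ε : ℝ} (hK : 1 ≤ K) (hα : 0 ≤ α) (hε : 0 < ε)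
    (h : ε ≤ 1 / K) : 1 / ε ^ 2 ≤ rate K α ε := by
  have hK' : (1 : ℝ) ≤ K := by exact_mod_cast hK
  rw [rate_eq hα]
  have h1 : 1 / ε ^ 2 ≤ 1 / (K * ε ^ 3) := by
    refine one_div_le_one_div_of_le (by positivity) ?_
    rw [le_div_iff₀ (by positivity)] at h
    calc K * ε ^ 3 = ε ^ 2 * (ε * K) := by ring
      _ ≤ ε ^ 2 * 1 := by gcongr
      _ = ε ^ 2 := mul_one _
  have : 0 ≤ α * √α / ε ^ 4 + √α / (K * ε ^ 4) + √α / (√K * ε ^ 3) := by positivity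
  linarith

/-- Here y stands for 1/η, and √A is at most √cA (√α N + √(N/K)). The additive 3 in the bound on N
and the smoothness constant in y contribute only multiples of 1/ε². -/
lemma sample_count_le {K : ℕ} {α ε A₀ cA L J N y : ℝ} (hK : 1 ≤ K) (hα : 0 ≤ α) (hα1 : α ≤ 1)
    (hε : 0 < ε) (hε1 : ε ≤ 1) (hA₀ : 0 ≤ A₀) (hcA : 0 ≤ cA) (hL : 0 ≤ L) (hJ : 0 ≤ J)
    (hN0 : 0 ≤ N) (hN : N ≤ A₀ * (1 / K + α) / ε ^ 2 + 3)
    (hy : y ≤ 2 * √(cA * (α * N ^ 2 + N / K)) + 2 * L) :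
    3 * N + 2 + 8 * (J * y / ε ^ 2) ≤
      (16 * (J * (√cA * (A₀ + √A₀))) + (6 * A₀ + 11 + 16 * (J * (L + √cA * 5)))) *
        max (rate K α ε) (1 / ε ^ 2) := by
  have hK' : (1 : ℝ) ≤ K := by exact_mod_cast hK
  have hKi : 1 / (K : ℝ) ≤ 1 := by rw [div_le_one (by linarith)]; exact hK'
  have hsα : √α ≤ 1 := Real.sqrt_le_one.2 hα1
  have hE : 1 ≤ 1 / ε ^ 2 := by
    rw [le_div_iff₀ (by positivity), one_mul]; exact pow_le_one₀ hε.le hε1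
  set E := 1 / ε ^ 2 with hEdef
  set ρ := rate K α ε with hρ
  have hρe := rate_eq (K := K) (ε := ε) hα
  rw [← hρ] at hρe
  have t1 : 0 ≤ α * √α / ε ^ 4 := by positivity
  have t2 : 0 ≤ √α / (K * ε ^ 4) := by positivity
  have t3 : 0 ≤ √α / (√K * ε ^ 3) := by positivity
  have t4 : 0 ≤ 1 / (K * ε ^ 3) := by positivity
  have hNE : N ≤ (2 * A₀ + 3) * E := by
    have : A₀ * (1 / K + α) / ε ^ 2 ≤ A₀ * 2 * E := by
      rw [div_eq_mul_one_div]
      gcongr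
      linarith
    linarith
  -- Source of the two summands of the rate with ε⁴.
  have hαN : √α * N * E ≤ A₀ * ρ + 3 * E := by
    have e : √α * (A₀ * (1 / K + α) / ε ^ 2) * E =
        A₀ * (α * √α / ε ^ 4 + √α / (K * ε ^ 4)) := by
      rw [hEdef]; field_simp; ring
    calc √α * N * E ≤ √α * (A₀ * (1 / K + α) / ε ^ 2 + 3) * E := by gcongr
      _ = √α * (A₀ * (1 / K + α) / ε ^ 2) * E + 3 * (√α * E) := by ring
      _ ≤ A₀ * ρ + 3 * (1 * E) := by
          rw [e]
          gcongr
          linarith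
      _ = _ := by ring
  have hsN : √N ≤ √A₀ * (1 / √K + √α) / ε + 2 := by
    refine (Real.sqrt_le_sqrt hN).trans ?_
    rw [Real.sqrt_le_left (by positivity)]
    have e1 : A₀ * (1 / K + α) / ε ^ 2 ≤ (√A₀ * (1 / √K + √α) / ε) ^ 2 := by
      rw [div_pow, mul_pow, Real.sq_sqrt hA₀]
      gcongr
      have h1 : (1 / √(K : ℝ)) ^ 2 = 1 / K := by rw [div_pow, Real.sq_sqrt (by linarith), one_pow]
      have h2 := Real.sq_sqrt hα
      have h3 : 0 ≤ 1 / √(K : ℝ) * √α := by positivity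
      nlinarith
    have e2 : 0 ≤ √A₀ * (1 / √K + √α) / ε := by positivity
    nlinarith
  -- Source of the two summands of the rate with ε³.
  have hNK : √N / √K * E ≤ √A₀ * ρ + 2 * E := by
    have hsK : 1 ≤ √(K : ℝ) := by rw [Real.one_le_sqrt]; exact hK'
    have e : √A₀ * (1 / √K + √α) / ε / √K * E =
        √A₀ * (√α / (√K * ε ^ 3) + 1 / (√K * √K * ε ^ 3)) := by
      rw [hEdef]; field_simp; ring
    rw [Real.mul_self_sqrt (by linarith)] at e
    calc √N / √K * E ≤ (√A₀ * (1 / √K + √α) / ε + 2) / √K * E := by gcongr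
      _ = √A₀ * (1 / √K + √α) / ε / √K * E + 2 / √K * E := by ring
      _ ≤ √A₀ * ρ + 2 * E := by
          rw [e]
          gcongr
          · linarith
          · exact div_le_self (by norm_num) hsK
  have hsq : √(cA * (α * N ^ 2 + N / K)) ≤ √cA * (√α * N + √N / √K) := by
    rw [Real.sqrt_mul hcA]
    gcongr
    rw [Real.sqrt_le_left (by positivity)]
    have h1 : (√α * N) ^ 2 = α * N ^ 2 := by rw [mul_pow, Real.sq_sqrt hα]
    have h2 : (√N / √K) ^ 2 = N / K := by
      rw [div_pow, Real.sq_sqrt hN0, Real.sq_sqrt (by linarith)]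
    have h3 : 0 ≤ √α * N * (√N / √K) := by positivity
    nlinarith
  have hyE : J * y / ε ^ 2 ≤ J * (2 * (√cA * ((A₀ + √A₀) * ρ + 5 * E)) + 2 * (L * E)) := by
    have e : J * y / ε ^ 2 = J * (y * E) := by rw [hEdef]; ring
    rw [e]
    refine mul_le_mul_of_nonneg_left ?_ hJ
    have hE0 : 0 ≤ E := by linarith
    calc y * E ≤ (2 * (√cA * (√α * N + √N / √K)) + 2 * L) * E := by
          gcongr
          linarith
      _ = 2 * (√cA * (√α * N * E + √N / √K * E)) + 2 * (L * E) := by ring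
      _ ≤ 2 * (√cA * ((A₀ * ρ + 3 * E) + (√A₀ * ρ + 2 * E))) + 2 * (L * E) := by gcongr
      _ = _ := by ring
  have hm1 : ρ ≤ max ρ E := le_max_left _ _
  have hm2 : E ≤ max ρ E := le_max_right _ _
  calc 3 * N + 2 + 8 * (J * y / ε ^ 2)
      ≤ 3 * ((2 * A₀ + 3) * E) + 2 * E +
        8 * (J * (2 * (√cA * ((A₀ + √A₀) * ρ + 5 * E)) + 2 * (L * E))) := by linarith
    _ = 16 * (J * (√cA * (A₀ + √A₀))) * ρ + (6 * A₀ + 11 + 16 * (J * (L + √cA * 5))) * E := by ring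
    _ ≤ 16 * (J * (√cA * (A₀ + √A₀))) * max ρ E +
        (6 * A₀ + 11 + 16 * (J * (L + √cA * 5))) * max ρ E := by gcongr
    _ = _ := by ring

/-- As e^l dominates 2, N and 1/ε, the product X N² ε⁻² is at most e^{(m+4)l}: m factors for X and
two each for N and 1/ε. Finally e ≤ 4. -/
lemma communication_rounds_bound {X N ε l : ℝ} {m κ : ℕ} (hX : X ≤ 2 ^ m) (hN : 0 < N)
    (hε : 0 < ε) (h2 : 2 ≤ Real.exp l) (hNl : N ≤ Real.exp l) (hεl : ε⁻¹ ≤ Real.exp l)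
    (hκ : ((m : ℝ) + 4) * l ≤ κ) :
    X * (1 / 2 ^ κ) ^ 2 ≤ (1 / N) ^ 2 * ε ^ 2 := by
  have h4 : Real.exp κ ≤ 4 ^ κ := by
    rw [← Real.exp_one_pow]
    exact pow_le_pow_left₀ (Real.exp_pos _).le (Real.exp_one_lt_d9.le.trans (by norm_num)) _
  have h1 : X * N ^ 2 * ε⁻¹ ^ 2 ≤ 4 ^ κ := by
    calc X * N ^ 2 * ε⁻¹ ^ 2 ≤ Real.exp l ^ m * Real.exp l ^ 2 * Real.exp l ^ 2 := by
          gcongr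
          exact hX.trans (by gcongr)
      _ = Real.exp (((m : ℝ) + 4) * l) := by
          rw [← pow_add, ← pow_add, ← Real.exp_nat_mul]; push_cast; ring_nf
      _ ≤ Real.exp κ := Real.exp_le_exp.2 hκ
      _ ≤ 4 ^ κ := h4
  have h5 : ((1 : ℝ) / 2 ^ κ) ^ 2 = 1 / 4 ^ κ := by
    rw [div_pow, one_pow, ← pow_mul, mul_comm, pow_mul]; norm_num
  rw [h5, mul_one_div, div_le_iff₀ (by positivity)]
  calc X = (1 / N) ^ 2 * ε ^ 2 * (X * N ^ 2 * ε⁻¹ ^ 2) := by field_simp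
    _ ≤ _ := by gcongr

/-- In units of η(T+1)ε², the initial gap uses 1/4, the first batch 1/16, the first agreement 1/16
and the other iterations 1/8; the total is exactly 1/2. The condition N ≤ T + 1 spreads the weight
η/p = ηN of the first error over all iterations. -/
lemma average_bound {J η ν q b a N T ε : ℝ} (hη : 0 < η) (hT : 0 ≤ T)
    (hNT : N ≤ T + 1) (hJ : 4 * J ≤ η * ε ^ 2 * (T + 1)) (ha0 : 0 ≤ a) (ha : 24 * a ≤ ε ^ 2)
    (hb : 32 * (ν * q * b) ≤ ε ^ 2) :
    J + (η / 2 + η / (1 / N)) * a + 2 * (η * ν) * (q * b) +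
      T * (η * (3 / 2 * a + 2 * (ν * q * b))) ≤ η / 2 * ((T + 1) * ε ^ 2) := by
  have h1 : (η / 2 + η / (1 / N)) * a ≤ η * (3 / 2 * (T + 1)) * a := by
    rw [div_div_eq_mul_div, div_one]
    gcongr
    nlinarith
  have h2 : η * (3 / 2 * (T + 1)) * (24 * a) ≤ η * (3 / 2 * (T + 1)) * ε ^ 2 := by gcongr
  have h3 : η * (32 * (ν * q * b)) ≤ η * ε ^ 2 := by gcongr
  have h4 : T * (η * (3 / 2 * a + 2 * (ν * q * b))) ≤ T * (η * (1 / 8 * ε ^ 2)) := by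
    gcongr
    linarith
  have h5 : 0 ≤ η * ε ^ 2 := by positivity
  have h6 : 0 ≤ T * (η * ε ^ 2) := by positivity
  nlinarith

/-! ### The uniformly chosen output. -/

section Output

variable {S : Type u} {A : Type v} [MeasurableSpace S] [MeasurableSpace A] {d H K N B : ℕ}
variable {M : MDP S A} {π : PolicyClass S A d} {est : Estimator H} {p η ε : ℝ} {κ : ℕ}
  {agg : (Fin K → Param d) → Param d} {P : Protocol.{w'} K d} {Hs : ℕ → Finset (Fin K)}
  {adv : Adversary.{u, v, w} S A d H K N B} {θ₀ : Param d}

lemma lintegral_outputLaw_le {T : ℕ} (hη : 0 < η) (k : Fin K)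
    (h : ∑ t ∈ Finset.range (T + 1),
      ∫⁻ st, ENNReal.ofReal (η / 2 * ‖gradJ M π H (st.2.2.1 k)‖ ^ 2)
        ∂(runLaw M π est p η κ agg P Hs adv θ₀ t) ≤
      ENNReal.ofReal (η / 2 * ((T + 1) * ε ^ 2))) :
    ∫⁻ θ, ‖gradJ M π H θ‖ₑ ^ 2 ∂(outputLaw M π est p η κ (T + 1) agg P Hs adv θ₀ k) ≤
      ENNReal.ofReal (ε ^ 2) := by
  have hη2 : 0 < η / 2 := by positivity
  have he : ∀ v : Param d, ENNReal.ofReal (η / 2 * ‖v‖ ^ 2) = ENNReal.ofReal (η / 2) * ‖v‖ₑ ^ 2 :=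
    fun v => by rw [ENNReal.ofReal_mul hη2.le, ENNReal.ofReal_pow (norm_nonneg _), ofReal_norm]
  simp only [he, lintegral_const_mul' _ _ ENNReal.ofReal_ne_top] at h
  rw [← Finset.mul_sum, ENNReal.ofReal_mul hη2.le] at h
  have h' := (ENNReal.mul_le_mul_iff_right (by simpa using hη) ENNReal.ofReal_ne_top).1 h
  rw [outputLaw, lintegral_smul_measure, lintegral_finsetSum_measure, smul_eq_mul]
  refine (mul_le_mul_right ((Finset.sum_le_sum fun t _ => lintegral_map_le
    (fun θ => ‖gradJ M π H θ‖ₑ ^ 2) (fun st : RunState adv.Mem d K => st.2.2.1 k)).trans h') _).trans ?_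
  rw [ENNReal.ofReal_mul (by positivity), ← Nat.cast_succ, ENNReal.ofReal_natCast, ← mul_assoc,
    ENNReal.inv_mul_cancel (by simp) (by simp), one_mul]

end Output

lemma step_size_bounds {a L η : ℝ} (ha : 0 < a) (hL : 0 < L) (hη : η = 1 / 2 * min (1 / √a) (1 / L)) :
    0 < η ∧ η * (2 * L) ≤ 1 ∧ 4 * a * η ^ 2 ≤ 1 ∧ 1 / η ≤ 2 * √a + 2 * L := by
  have hs : 0 < √a := Real.sqrt_pos.2 ha
  have hη0 : 0 < η := by rw [hη]; positivity
  have h1 : η ≤ 1 / 2 * (1 / L) := by rw [hη]; gcongr; exact min_le_right _ _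
  have h2 : η ≤ 1 / 2 * (1 / √a) := by rw [hη]; gcongr; exact min_le_left _ _
  refine ⟨hη0, ?_, ?_, ?_⟩
  · calc η * (2 * L) ≤ 1 / 2 * (1 / L) * (2 * L) := by gcongr
      _ = 1 := by field_simp
  · calc 4 * a * η ^ 2 ≤ 4 * a * (1 / 2 * (1 / √a)) ^ 2 := by gcongr
      _ = a / √a ^ 2 := by field_simp; norm_num
      _ = 1 := by rw [Real.sq_sqrt ha.le, div_self ha.ne']
  · rcases min_choice (1 / √a) (1 / L) with h | h <;> rw [h] at hη
    · have : 1 / η = 2 * √a := by rw [hη]; field_simp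
      linarith
    · have : 1 / η = 2 * L := by rw [hη]; field_simp
      linarith

end DecByzPG

end

/-! ### Choice of the constants and conclusion. -/

open DecByzPG in
set_option maxHeartbeats 2000000 in
theorem mainTheorem3 {S : Type u} {A : Type v} [MeasurableSpace S]
    [MeasurableSpace A] {d H : ℕ} (hH : 1 ≤ H)
    (M : DecByzPG.MDP S A) (π : DecByzPG.PolicyClass S A d) (est : DecByzPG.Estimator H)
    (G M₂ σ W Cra Cavg : ℝ) (hG : 0 < G) (hM₂ : 0 < M₂) (hσ : 0 < σ) (hW : 0 < W)
    (hCra : 0 < Cra) (hCavg : 0 < Cavg)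
    (hgrad : DecByzPG.LogPolicyGradientBound π G)
    (hsmooth : DecByzPG.LogPolicySmooth π M₂)
    (hvar : DecByzPG.EstimatorVarianceBound M π est σ)
    (hweight : DecByzPG.WeightVarianceBound M π H W) :
    -- the constants hidden in the asymptotic notation
    ∃ C cA c₁ c₂ : ℝ, 0 < C ∧ 0 < cA ∧ 0 < c₁ ∧ 0 < c₂ ∧
      ∀ (K : ℕ) (α εbar ε : ℝ), 1 ≤ K → 0 ≤ α → 0 < εbar → α + εbar < 1 / 4 →
        0 < ε → ε ≤ 1 →
        -- the choice of the parameters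
        ∃ N B T κ : ℕ, 1 ≤ N ∧ 1 ≤ B ∧ 1 ≤ T ∧
          c₁ * max (Real.log (N * K)) (Real.log ε⁻¹) ≤ κ ∧
          κ ≤ c₂ * max (Real.log (N * K)) (Real.log ε⁻¹) ∧
          ∀ p a η : ℝ, p = 1 / N → a = cA * (α / p ^ 2 + 1 / (p * K)) →
            η = 1 / 2 * min (1 / √a) (1 / M.L H G M₂) →
            -- honest agents, subroutines, adversary, initialization
            ∀ (Hs : ℕ → Finset (Fin K))
              (agg : (Fin K → DecByzPG.Param d) → DecByzPG.Param d)
              (P : DecByzPG.Protocol.{w'} K d)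
              (adv : DecByzPG.Adversary.{u, v, w} S A d H K N B)
              (θ₀ : DecByzPG.Param d),
              (∀ t < T, (1 - α) * K ≤ (Hs t).card) →
              Measurable agg → DecByzPG.IsRobustAggregator α Cra agg →
              (∀ t < T, P.AveragingAgreement κ (α + εbar) Cavg (Hs t)
                ((Finset.range T).biUnion Hs)) →
              DecByzPG.ApproxSolution M π H (α + εbar) ε
                (DecByzPG.outputLaw M π est p η κ T agg P Hs adv θ₀) ∧
              DecByzPG.expectedTrajectories M π est p η κ T agg P Hs adv θ₀ ≤
                ENNReal.ofReal (C * max (DecByzPG.rate K α ε) (1 / ε ^ 2)) ∧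
              (ε ≤ 1 / K →
                DecByzPG.expectedTrajectories M π est p η κ T agg P Hs adv θ₀ ≤
                  ENNReal.ofReal (C * DecByzPG.rate K α ε)) := by
  obtain ⟨Cy, hCy, hdiff⟩ := est.exists_hasMeanVar_difference M hsmooth hgrad hW.le hweight
  have hL := M.L_pos (G := G) hH hG hM₂
  set L := M.L H G M₂ with hLdef
  have hJ : 0 < M.R / (1 - M.γ) := div_pos M.R_pos (sub_pos.2 M.γ_lt_one)
  set J := M.R / (1 - M.γ) with hJdef
  obtain ⟨A₀, hA₀⟩ : ∃ x, x = (3 + 8 * (2 * (3 + 2 * Cavg) ^ 2 * Cra)) * σ ^ 2 := ⟨_, rfl⟩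
  obtain ⟨b, hb⟩ : ∃ x, x = 8 * (Cra * σ ^ 2) := ⟨_, rfl⟩
  obtain ⟨c4, hc4⟩ : ∃ x, x = 2 * (3 + 2 * Cavg) ^ 2 := ⟨_, rfl⟩
  obtain ⟨c7, hc7⟩ : ∃ x, x = Cy / (4 * L ^ 2) := ⟨_, rfl⟩
  obtain ⟨c5, hc5⟩ : ∃ x, x = 1 + 2 * (2 * (3 + 2 * Cavg) ^ 2) + 2 * (3 + 2 * Cavg) ^ 2 * Cra :=
    ⟨_, rfl⟩
  obtain ⟨c6, hc6⟩ : ∃ x, x = 2 + Cra := ⟨_, rfl⟩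
  obtain ⟨c8, hc8⟩ : ∃ x, x = 5 * Cy + 108 * (c4 * Cra * Cy) := ⟨_, rfl⟩
  obtain ⟨c9, hc9⟩ : ∃ x, x = 51 + 5 * c7 + 9 * c4 * (1 + 3 * Cra * (1 + c7)) := ⟨_, rfl⟩
  obtain ⟨c10, hc10⟩ : ∃ x, x = 2 + 2 * Cra * (10 + 12 * c7) := ⟨_, rfl⟩
  obtain ⟨c13, hc13⟩ : ∃ x, x = 24 * (Cra * Cy) := ⟨_, rfl⟩
  have hA₀' : 0 < A₀ := by rw [hA₀]; positivity
  have hb' : 0 < b := by rw [hb]; positivity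
  have hc4' : 0 < c4 := by rw [hc4]; positivity
  have hc7' : 0 < c7 := by rw [hc7]; positivity
  have hc5' : 0 < c5 := by rw [hc5]; positivity
  have hc6' : 0 < c6 := by rw [hc6]; positivity
  have hc8' : 0 < c8 := by rw [hc8]; positivity
  have hc9' : 0 < c9 := by rw [hc9]; positivity
  have hc10' : 0 < c10 := by rw [hc10]; positivity
  have hc13' : 0 < c13 := by rw [hc13]; positivity
  -- The three summands encode the requirements on 4^{-κ}: agreement noise below ε², contraction of
  -- disagreement, and absorption of the squared direction.
  obtain ⟨X, hX⟩ : ∃ x, x = 64 * (c9 + c5) * b + 8 * (c10 + c6) + 8 * (c9 + c5) * c13 / L ^ 2 :=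
    ⟨_, rfl⟩
  have hX1 : 64 * (c9 + c5) * b ≤ X := by
    have : 0 ≤ 8 * (c10 + c6) + 8 * (c9 + c5) * c13 / L ^ 2 := by positivity
    linarith
  have hX2 : 8 * (c10 + c6) ≤ X := by
    have : 0 ≤ 64 * (c9 + c5) * b + 8 * (c9 + c5) * c13 / L ^ 2 := by positivity
    linarith
  have hX3 : 8 * (c9 + c5) * c13 / L ^ 2 ≤ X := by
    have : 0 ≤ 64 * (c9 + c5) * b + 8 * (c10 + c6) := by positivity
    linarith
  obtain ⟨m, hm⟩ := pow_unbounded_of_one_lt X (one_lt_two (α := ℝ))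
  -- With this constant, 12 c8 (1/K + α/p) η² equals p · 4Aη², which is at most p by the choice of
  -- η.
  set cA := 3 * c8 with hcA
  refine ⟨16 * (J * (√cA * (24 * A₀ + √(24 * A₀)))) + (6 * (24 * A₀) + 11 +
    16 * (J * (L + √cA * 5))), cA, m + 4, m + 6, by positivity, by positivity, by positivity,
    by positivity, ?_⟩
  intro K α εbar ε hK hα hεbar hαbar hε hε1
  have hK' : (1 : ℝ) ≤ K := by exact_mod_cast hK
  -- The factor 24 brings the large-batch noise below ε²/24. The summand 2 keeps log(NK) above 1/2,
  -- so the ceiling in κ costs at most 2l, whence m + 6.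
  obtain ⟨N, hN⟩ : ∃ x, x = ⌈24 * A₀ * (1 / K + α) / ε ^ 2⌉₊ + 2 := ⟨_, rfl⟩
  have hN2 : (2 : ℝ) ≤ N := by
    have : 2 ≤ N := by omega
    exact_mod_cast this
  have hNlow : 24 * A₀ * (1 / K + α) / ε ^ 2 ≤ N := by
    refine (Nat.le_ceil _).trans ?_
    rw [hN]; push_cast; linarith
  have hNup : (N : ℝ) ≤ 24 * A₀ * (1 / K + α) / ε ^ 2 + 3 := by
    have := Nat.ceil_lt_add_one (show 0 ≤ 24 * A₀ * (1 / K + α) / ε ^ 2 by positivity)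
    rw [hN]; push_cast; linarith
  obtain ⟨l, hl⟩ : ∃ x, x = max (Real.log (N * K)) (Real.log ε⁻¹) := ⟨_, rfl⟩
  have hNK : (N : ℝ) * K ≤ Real.exp l := by
    rw [← Real.exp_log (show (0 : ℝ) < N * K by positivity), hl]
    exact Real.exp_le_exp.2 (le_max_left _ _)
  have hεl : ε⁻¹ ≤ Real.exp l := by
    rw [← Real.exp_log (show (0 : ℝ) < ε⁻¹ by positivity), hl]
    exact Real.exp_le_exp.2 (le_max_right _ _)
  have hNl : (N : ℝ) ≤ Real.exp l := by nlinarith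
  have h2l : 2 ≤ Real.exp l := hN2.trans hNl
  have hl0 : 1 / 2 ≤ l := by
    have h1 : Real.log 2 ≤ l := (Real.log_le_iff_le_exp two_pos).2 h2l
    have h2 := Real.log_two_gt_d9
    linarith
  obtain ⟨κ, hκ⟩ : ∃ x, x = ⌈((m : ℝ) + 4) * l⌉₊ := ⟨_, rfl⟩
  have hκlow : ((m : ℝ) + 4) * l ≤ κ := by rw [hκ]; exact Nat.le_ceil _
  have hκup : (κ : ℝ) ≤ ((m : ℝ) + 6) * l := by
    have := Nat.ceil_lt_add_one (show 0 ≤ ((m : ℝ) + 4) * l by positivity)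
    rw [hκ]; linarith
  obtain ⟨a', ha'⟩ : ∃ x : ℝ, x = cA * (α / (1 / (N : ℝ)) ^ 2 + 1 / (1 / (N : ℝ) * K)) := ⟨_, rfl⟩
  obtain ⟨η', hη'⟩ : ∃ x, x = 1 / 2 * min (1 / √a') (1 / L) := ⟨_, rfl⟩
  have ha'0 : 0 < a' := by rw [ha']; positivity
  obtain ⟨hη0, hηL, hηa, hηy⟩ := step_size_bounds ha'0 hL hη'
  -- The number of iterations is T + 1. The summand N amortizes the first batch, the other one the
  -- initial gap of the objective.
  obtain ⟨T, hT⟩ : ∃ T, T + 1 = N + ⌈4 * J / (η' * ε ^ 2)⌉₊ :=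
    ⟨N + ⌈4 * J / (η' * ε ^ 2)⌉₊ - 1, by omega⟩
  have hTr : (T : ℝ) + 1 = N + (⌈4 * J / (η' * ε ^ 2)⌉₊ : ℝ) := by exact_mod_cast hT
  refine ⟨N, 1, T + 1, κ, by omega, le_rfl, by omega, by rw [← hl]; exact hκlow,
    by rw [← hl]; exact hκup, ?_⟩
  rintro p a η hp ha hη Hs agg P adv θ₀ hHs - hagg hagree
  rw [hp, ← ha'] at ha
  subst ha
  rw [← hη'] at hη
  subst hη
  have hp0 : 0 < p := by rw [hp]; positivity
  have hp1 : p ≤ 1 := by rw [hp, div_le_one (by positivity)]; linarith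
  set U := (Finset.range (T + 1)).biUnion Hs with hU
  have hstep : ∀ t < T + 1, StepAssumptions M π est G M₂ σ Cra Cavg Cy α εbar η κ agg P (Hs t) U :=
    fun t ht =>
    { smooth := hsmooth
      grad := hgrad
      M₂_nonneg := hM₂.le
      variance := hvar
      difference := hdiff
      Cy_nonneg := hCy.le
      Cra_nonneg := hCra.le
      Cavg_nonneg := hCavg.le
      α_nonneg := hα
      α_le := by linarith
      εbar_nonneg := hεbar.le
      η_pos := hη0
      L_pos := hL
      η_le := hηL
      K_pos := hK
      card_le := hHs t ht
      subset := Finset.subset_biUnion_of_mem Hs (Finset.mem_range.2 ht)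
      robust := hagg
      agreement := hagree t ht }
  have hq := communication_rounds_bound (ε := ε) (N := N) hm.le (by positivity) hε h2l hNl hεl hκlow
  rw [← hp] at hq
  obtain ⟨q, hqdef⟩ : ∃ x : ℝ, x = (1 / 2 ^ κ) ^ 2 := ⟨_, rfl⟩
  have hq0 : 0 ≤ q := by rw [hqdef]; positivity
  rw [← hqdef] at hq
  obtain ⟨ν, hν⟩ : ∃ x, x = 2 * (c9 + c5) / p ^ 2 := ⟨_, rfl⟩
  have hν0 : 0 ≤ ν := by rw [hν]; positivity
  have hε2 : ε ^ 2 ≤ 1 := pow_le_one₀ hε.le hε1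
  have hη1 : 12 * (c8 * (1 / K + α / p)) * η ^ 2 ≤ p := by
    have e : 12 * (c8 * (1 / K + α / p)) * η ^ 2 = p * (4 * a * η ^ 2) := by
      rw [ha', ← hp, hcA]; field_simp; ring
    rw [e]
    exact mul_le_of_le_one_right hp0.le hηa
  have hη2 : 2 * ν * q * c13 * η ^ 2 ≤ 1 / 8 := by
    have h1 : η ^ 2 ≤ 1 / (4 * L ^ 2) := by
      rw [le_div_iff₀ (by positivity)]
      have := pow_le_pow_left₀ (by positivity) hηL 2
      nlinarith
    calc 2 * ν * q * c13 * η ^ 2 ≤ 2 * ν * q * c13 * (1 / (4 * L ^ 2)) := by gcongr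
      _ = 1 / 8 * (8 * (c9 + c5) * c13 / L ^ 2 * q / p ^ 2) := by rw [hν]; field_simp; ring
      _ ≤ 1 / 8 * (X * q / p ^ 2) := by gcongr
      _ ≤ 1 / 8 * 1 := by
          gcongr
          rw [div_le_one (by positivity)]
          exact hq.trans (mul_le_of_le_one_right (by positivity) hε2)
      _ = 1 / 8 := mul_one _
  have hη3 : 2 * q * (c10 + c6) ≤ 1 / 4 := by
    have h1 : 8 * (c10 + c6) * q ≤ X * q := by gcongr
    have h2 : p ^ 2 * ε ^ 2 ≤ 1 := mul_le_one₀ (pow_le_one₀ hp0.le hp1) (by positivity) hε2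
    linarith
  have hνq : 32 * (ν * q * b) ≤ ε ^ 2 := by
    calc 32 * (ν * q * b) = 64 * (c9 + c5) * b * q / p ^ 2 := by rw [hν]; ring
      _ ≤ X * q / p ^ 2 := by gcongr
      _ ≤ p ^ 2 * ε ^ 2 / p ^ 2 := by gcongr
      _ = ε ^ 2 := by field_simp
  obtain ⟨e, he⟩ : ∃ x, x = A₀ * ((1 / K + α) * (1 / N)) := ⟨_, rfl⟩
  have he0 : 0 ≤ e := by rw [he]; positivity
  have he1 : 24 * e ≤ ε ^ 2 := by
    rw [div_le_iff₀ (by positivity)] at hNlow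
    rw [he]
    calc 24 * (A₀ * ((1 / K + α) * (1 / N))) = 24 * A₀ * (1 / K + α) / N := by ring
      _ ≤ N * ε ^ 2 / N := by gcongr
      _ = ε ^ 2 := by field_simp
  have hTJ : 4 * J ≤ η * ε ^ 2 * (T + 1) := by
    have h1 := Nat.le_ceil (4 * J / (η * ε ^ 2))
    rw [div_le_iff₀ (by positivity)] at h1
    rw [hTr]
    have : 0 ≤ η * ε ^ 2 * N := by positivity
    linarith
  have hTup : (T : ℝ) ≤ N + 4 * J / (η * ε ^ 2) := by
    have := Nat.ceil_lt_add_one (show 0 ≤ 4 * J / (η * ε ^ 2) by positivity)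
    linarith
  have hcount : expectedTrajectories M π est p η κ (T + 1) agg P Hs adv θ₀ ≤
      ENNReal.ofReal ((16 * (J * (√cA * (24 * A₀ + √(24 * A₀)))) + (6 * (24 * A₀) + 11 +
        16 * (J * (L + √cA * 5)))) * max (rate K α ε) (1 / ε ^ 2)) := by
    have hpN : p * N = 1 := by rw [hp]; field_simp
    refine (expectedTrajectories_le hp0.le hp1 T).trans ?_
    rw [hpN, ← ENNReal.ofReal_natCast N, ← ENNReal.ofReal_natCast T, ← ENNReal.ofReal_natCast 1,
      ← ENNReal.ofReal_add (by norm_num) (by norm_num), ← ENNReal.ofReal_mul (by positivity),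
      ← ENNReal.ofReal_add (by positivity) (by positivity)]
    refine ENNReal.ofReal_le_ofReal (le_trans ?_ (sample_count_le (y := 1 / η) hK hα (by linarith)
      hε hε1 (by positivity) (by positivity) hL.le hJ.le (by positivity) hNup ?_))
    · have : 8 * (J * (1 / η) / ε ^ 2) = 2 * (4 * J / (η * ε ^ 2)) := by field_simp; norm_num
      rw [this]
      push_cast
      linarith
    · have : cA * (α * (N : ℝ) ^ 2 + N / K) = a := by rw [ha']; field_simp
      rw [this]
      exact hηy
  -- The gradient bound holds for every agent of `U`, so a single large honest set suffices as the
  -- good set; its members may be Byzantine later.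
  refine ⟨⟨Hs 0, ?_, fun k hk => lintegral_outputLaw_le hη0 k ?_⟩, hcount, fun hεK => ?_⟩
  · have h1 := hHs 0 (Nat.succ_pos T)
    have h2 : 0 ≤ εbar * K := by positivity
    linarith
  · have hkU : k ∈ U := (hstep 0 (Nat.succ_pos T)).subset hk
    refine (sum_lintegral_gradJ_le (ν := ν) hstep hkU hp0 hp1 (by omega) le_rfl
      (he.trans (by rw [hA₀])) hb hc4 hc7 hc5 hc6 (by rw [hc8]) hc9 hc10 hc13 hν hη1
      (by rw [← hqdef]; exact hη2) (by rw [← hqdef]; exact hη3) hν0).trans ?_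
    rw [← ENNReal.ofReal_natCast T, ← ENNReal.ofReal_mul (by positivity),
      ← ENNReal.ofReal_add (by positivity) (by positivity), ← hqdef, hp]
    refine ENNReal.ofReal_le_ofReal (average_bound hη0 (by positivity) ?_ hTJ he0 he1 hνq)
    rw [hTr]
    have : (0 : ℝ) ≤ (⌈4 * J / (η * ε ^ 2)⌉₊ : ℝ) := by positivity
    linarith
  · rwa [max_eq_left (one_div_sq_le_rate hK hα hε hεK)] at hcount
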